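/- Let $N^{n+m}(\kappa)$ be a real space form, i.e. a smooth $(n+m)$-dimensional Riemannian manifold of constant sectional curvature $\kappa\in\mathbb{R}$, and let $M^n$ be an immersed submanifold, $n=p+q$ with integers $p,q\ge 1$ and $m\ge 0$. For $x\in M$ and a normal vector $\xi\in T_x^{\perp}M$, the second fundamental form along $\xi$ is $\mathrm{II}_\xi(X,Y)=\langle \mathrm{II}(X,Y),\xi\rangle$. The submanifold is austere if for every $x$ and every $\xi\in T_x^\perp M$ the nonzero eigenvalues of $\mathrm{II}_\xi$ (principal curvatures) occur in oppositely signed pairs. It is of type $\mathcal{Q}(p,q)$ if, moreover, at each $x\in M$ there is an orthonormal basis of $T_xM$ with respect to which the matrices of all $\mathrm{II}_\xi$, $\xi\in T_x^\perp M$, lie in $$\mathcal{Q}(p,q)=\left\{\begin{pmatrix}0&a\\ a^{t}&0\end{pmatrix}: a\in M(p,q)\right\},$$ where $M(p,q)$ is the space of real $p\times q$ matrices. Let $R$ be the curvature tensor of the induced metric of $M$ and $R^\perp$ the curvature of the normal connection. For orthonormal bases $(e_i)$ of $T_xM$ and $(\xi_r)$ of $T_x^\perp M$, the normalized scalar curvature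 and the normalized normal scalar curvature are $$\rho=\frac{2}{n(n-1)}\sum_{i<j}\langle R(e_i,e_j)e_j,e_i\rangle,\qquad \rho^\perp=\frac{2}{n(n-1)}\Big(\sum_{i<j}\sum_{r<s}\langle R^\perp(e_i,e_j)\xi_r,\xi_s\rangle^2\Big)^{1/2}.$$ **Theorem.** Let $M^n$ be an austere submanifold of type $\mathcal{Q}(p,q)$ in a real space form $N^{n+m}(\kappa)$. Then at every point of $M$ $$\rho^{\perp}\le\frac{\sqrt2}{2}(\kappa-\rho).$$ Equality holds at a point $x\in M$ if and only if there exist an orthonormal basis $\{e_1,\dots,e_n\}$ of $T_xM$, an orthonormal basis $\{\xi_1,\dots,\xi_m\}$ of $T_x^\perp M$ and a real number $\lambda$ such that the matrices $A_r=(\mathrm{II}_{\xi_r}(e_i,e_j))_{i,j}$ are $$A_1=\lambda\,\mathrm{diag}(C_1,0),\qquad A_2=\lambda\,\mathrm{diag}(C_2,0),\qquad A_r=0\ \text{ for } r>2,$$ where $$C_1=\begin{pmatrix}0&0&1&0\\0&0&0&1\\1&0&0&0\\0&1&0&0\end{pmatrix},\qquad C_2=\begin{pmatrix}0&0&0&-1\\0&0&1&0\\0&1&0&0\\-1&0&0&0\end{pmatrix}.$$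 Here $\lambda\neq 0$ is allowed only if $n\ge 4$ and $m\ge 2$; in the remaining cases the condition means that $A_r=0$ for all $r$. -/

import Mathlib

open scoped Manifold ContDiff

noncomputable section

/-! ### Riemannian geometry in coordinates

`G` is a metric tensor on a finite-dimensional vector space `F`, and `φ : E → F` is a map written in
coordinates.  Everything is used only near one point, at which `G` is smooth and positive
definite. -/

namespace Coord

variable {E F : Type*} [NormedAddCommGroup E] [NormedSpace ℝ E]
  [NormedAddCommGroup F] [NormedSpace ℝ F]

/-- The Christoffel symbol `Γ_y(u, v)` of `G`: the vector with
`G(Γ(u, v), z) = ½ (∂_u G(v, z) + ∂_v G(u, z) - ∂_z G(u, v))` for all `z`. -/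
def christoffel (G : F → F →L[ℝ] F →L[ℝ] ℝ) (y u v : F) : F :=
  (G y).inverse
    ((1 / 2 : ℝ) • (fderiv ℝ G y u v + fderiv ℝ G y v u - ((fderiv ℝ G y).flip u).flip v))

/-- The Levi-Civita covariant derivative `∇_u V` at `x` of a vector field `V` along `φ`. -/
def covDeriv (G : F → F →L[ℝ] F →L[ℝ] ℝ) (φ : E → F) (V : E → F) (x u : E) : F :=
  fderiv ℝ V x u + christoffel G (φ x) (fderiv ℝ φ x u) (V x)

/-- The curvature tensor `R(u, v) w = ∇_u ∇_v w - ∇_v ∇_u w` of `G` at `y`, where `u`, `v`, `w` are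
extended to constant (hence commuting) coordinate fields. -/
def curvature (G : F → F →L[ℝ] F →L[ℝ] ℝ) (y u v w : F) : F :=
  covDeriv G id (fun y' => covDeriv G id (fun _ => w) y' v) y u -
    covDeriv G id (fun y' => covDeriv G id (fun _ => w) y' u) y v

/-- The bilinear form `(u, v) ↦ B(A u, A v)`. -/
def pullForm (B : F →L[ℝ] F →L[ℝ] ℝ) (A : E →L[ℝ] F) : E →L[ℝ] E →L[ℝ] ℝ :=
  B.bilinearComp A A

/-- The first fundamental form `h_x(u, v) = G(dφ u, dφ v)`. -/
def firstForm (G : F → F →L[ℝ] F →L[ℝ] ℝ) (φ : E → F) (x : E) : E →L[ℝ] E →L[ℝ] ℝ :=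
  pullForm (G (φ x)) (fderiv ℝ φ x)

/-- The orthogonal projection to the normal space: `w` minus its tangential part `dφ t`, where
`h(t, u) = G(w, dφ u)` for all `u`. -/
def normalProj (G : F → F →L[ℝ] F →L[ℝ] ℝ) (φ : E → F) (x : E) (w : F) : F :=
  w - fderiv ℝ φ x ((firstForm G φ x).inverse ((G (φ x) w).comp (fderiv ℝ φ x)))

/-- The second fundamental form `II(u, v) = (∇_u (dφ v))^⊥`. -/
def secondForm (G : F → F →L[ℝ] F →L[ℝ] ℝ) (φ : E → F) (x u v : E) : F :=
  normalProj G φ x (covDeriv G φ (fun x' => fderiv ℝ φ x' v) x u)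

/-- The normal connection `∇^⊥_u ξ = (∇_u ξ)^⊥`. -/
def normalCovDeriv (G : F → F →L[ℝ] F →L[ℝ] ℝ) (φ : E → F) (ξ : E → F) (x u : E) : F :=
  normalProj G φ x (covDeriv G φ ξ x u)

/-- The curvature `R^⊥(u, v) ξ = ∇^⊥_u ∇^⊥_v ξ - ∇^⊥_v ∇^⊥_u ξ` of the normal connection, where the
normal vector `ξ` at `x` is extended to the normal field `x' ↦ (ξ)^⊥` and `u`, `v` to constant
coordinate fields. -/
def normalCurvature (G : F → F →L[ℝ] F →L[ℝ] ℝ) (φ : E → F) (x u v : E) (ξ : F) : F :=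
  normalCovDeriv G φ (fun x' => normalCovDeriv G φ (fun x'' => normalProj G φ x'' ξ) x' v) x u -
    normalCovDeriv G φ (fun x' => normalCovDeriv G φ (fun x'' => normalProj G φ x'' ξ) x' u) x v

end Coord

/-! ### Riemannian manifolds -/

/-- A field of bilinear forms on the tangent spaces of a `d`-dimensional manifold. -/
abbrev BilinField (d : ℕ) (X : Type*) [TopologicalSpace X]
    [ChartedSpace (EuclideanSpace ℝ (Fin d)) X] : Type _ :=
  ∀ x : X, TangentSpace (𝓡 d) x →L[ℝ] TangentSpace (𝓡 d) x →L[ℝ] ℝ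

/-- A smooth Riemannian metric on a `d`-dimensional manifold. -/
abbrev SmoothMetric (d : ℕ) (X : Type*) [TopologicalSpace X]
    [ChartedSpace (EuclideanSpace ℝ (Fin d)) X] [IsManifold (𝓡 d) ∞ X] : Type _ :=
  Bundle.ContMDiffRiemannianMetric (𝓡 d) ∞ (EuclideanSpace ℝ (Fin d))
    (fun x : X => TangentSpace (𝓡 d) x)

section Intrinsic

variable {d : ℕ} {X : Type*} [TopologicalSpace X] [ChartedSpace (EuclideanSpace ℝ (Fin d)) X]

/-- The expression of `T` in the preferred chart around `x₀`. -/
def BilinField.inChart (T : BilinField d X) (x₀ : X) (y : EuclideanSpace ℝ (Fin d)) :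
    EuclideanSpace ℝ (Fin d) →L[ℝ] EuclideanSpace ℝ (Fin d) →L[ℝ] ℝ :=
  Coord.pullForm (E := EuclideanSpace ℝ (Fin d)) (F := EuclideanSpace ℝ (Fin d))
    (T ((extChartAt (𝓡 d) x₀).symm y))
    (mfderiv 𝓘(ℝ, EuclideanSpace ℝ (Fin d)) (𝓡 d) (extChartAt (𝓡 d) x₀).symm y)

/-- The Riemann curvature tensor at `x`, computed in the preferred chart around `x`; the tangent
space at `x` is identified with the model space by the differential of this chart. -/
def riemannCurvature (T : BilinField d X) (x : X) (u v w : TangentSpace (𝓡 d) x) :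
    TangentSpace (𝓡 d) x :=
  Coord.curvature (F := EuclideanSpace ℝ (Fin d)) (T.inChart x) (extChartAt (𝓡 d) x x) u v w

/-- All sectional curvatures equal `κ`:
`⟨R(u, v) v, u⟩ = κ (|u|² |v|² - ⟨u, v⟩²)` for all tangent vectors `u`, `v`. -/
def HasConstantSectionalCurvature (T : BilinField d X) (κ : ℝ) : Prop :=
  ∀ (x : X) (u v : TangentSpace (𝓡 d) x),
    T x (riemannCurvature T x u v v) u = κ * (T x u u * T x v v - T x u v ^ 2)

/-- `e` is orthonormal with respect to `T` at `x`.  If `T` is positive definite and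
`k = d`, then `e` is an orthonormal basis of the tangent space. -/
def IsOrthonormalFrame (T : BilinField d X) (x : X) {k : ℕ}
    (e : Fin k → TangentSpace (𝓡 d) x) : Prop :=
  ∀ i j, T x (e i) (e j) = if i = j then 1 else 0

open Classical in
/-- The normalized scalar curvature
`ρ = 2 / (d (d - 1)) ∑_{i < j} ⟨R(e_i, e_j) e_j, e_i⟩` for an orthonormal basis `(e_i)` of the
tangent space.  The value does not depend on the basis; one is chosen. -/
def normalizedScalarCurvature (T : BilinField d X) (x : X) : ℝ :=
  if h : ∃ e : Fin d → TangentSpace (𝓡 d) x, IsOrthonormalFrame T x e then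
    2 / ((d : ℝ) * ((d : ℝ) - 1)) * ∑ i, ∑ j ∈ Finset.Ioi i,
      T x (riemannCurvature T x (h.choose i) (h.choose j) (h.choose j)) (h.choose i)
  else 0

end Intrinsic

/-! ### Immersed submanifolds -/

section Submanifold

variable {n m : ℕ}
  {M : Type*} [TopologicalSpace M] [ChartedSpace (EuclideanSpace ℝ (Fin n)) M]
  {N : Type*} [TopologicalSpace N] [ChartedSpace (EuclideanSpace ℝ (Fin (n + m))) N]

/-- A smooth map with injective differential at every point. -/
def IsSmoothImmersion (f : M → N) : Prop :=
  ContMDiff (𝓡 n) (𝓡 (n + m)) ∞ f ∧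
    ∀ x : M, Function.Injective (mfderiv (𝓡 n) (𝓡 (n + m)) f x)

/-- The metric `f^* T` induced on `M`. -/
def inducedMetric (T : BilinField (n + m) N) (f : M → N) : BilinField n M := fun x =>
  Coord.pullForm (E := EuclideanSpace ℝ (Fin n)) (F := EuclideanSpace ℝ (Fin (n + m)))
    (T (f x)) (mfderiv (𝓡 n) (𝓡 (n + m)) f x)

/-- `ξ ∈ T_{f(x)} N` is normal to the immersed submanifold at `x`. -/
def IsNormalVector (T : BilinField (n + m) N) (f : M → N) (x : M)
    (ξ : TangentSpace (𝓡 (n + m)) (f x)) : Prop :=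
  ∀ u : TangentSpace (𝓡 n) x, T (f x) ξ (mfderiv (𝓡 n) (𝓡 (n + m)) f x u) = 0

/-- `e` is an orthonormal basis of the tangent space `T_x M` (for the induced metric). -/
def IsTangentFrame (T : BilinField (n + m) N) (f : M → N) (x : M)
    (e : Fin n → TangentSpace (𝓡 n) x) : Prop :=
  IsOrthonormalFrame (inducedMetric T f) x e

/-- `ξ` is an orthonormal basis of the normal space at `x`, which has dimension `m`. -/
def IsNormalFrame (T : BilinField (n + m) N) (f : M → N) (x : M)
    (ξ : Fin m → TangentSpace (𝓡 (n + m)) (f x)) : Prop :=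
  (∀ r, IsNormalVector T f x (ξ r)) ∧ IsOrthonormalFrame T (f x) ξ

/-- The second fundamental form `II(u, v)` at `x`, computed in the preferred charts around `x` and
`f x`. -/
def secondFundamentalForm (T : BilinField (n + m) N) (f : M → N) (x : M)
    (u v : TangentSpace (𝓡 n) x) : TangentSpace (𝓡 (n + m)) (f x) :=
  Coord.secondForm (E := EuclideanSpace ℝ (Fin n)) (F := EuclideanSpace ℝ (Fin (n + m)))
    (T.inChart (f x)) (writtenInExtChartAt (𝓡 n) (𝓡 (n + m)) x f)
    (extChartAt (𝓡 n) x x) u v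

/-- The curvature `R^⊥(u, v) ξ` of the normal connection at `x`, computed in the preferred charts
around `x` and `f x`. -/
def normalCurvature (T : BilinField (n + m) N) (f : M → N) (x : M)
    (u v : TangentSpace (𝓡 n) x) (ξ : TangentSpace (𝓡 (n + m)) (f x)) :
    TangentSpace (𝓡 (n + m)) (f x) :=
  Coord.normalCurvature (E := EuclideanSpace ℝ (Fin n)) (F := EuclideanSpace ℝ (Fin (n + m)))
    (T.inChart (f x)) (writtenInExtChartAt (𝓡 n) (𝓡 (n + m)) x f)
    (extChartAt (𝓡 n) x x) u v ξ

open Classical in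
/-- The normalized normal scalar curvature
`ρ^⊥ = 2 / (n (n - 1)) √(∑_{i < j} ∑_{r < s} ⟨R^⊥(e_i, e_j) ξ_r, ξ_s⟩²)` for orthonormal bases
`(e_i)` of the tangent space and `(ξ_r)` of the normal space.  The value does not depend on the
bases; a pair of them is chosen. -/
def normalizedNormalScalarCurvature (T : BilinField (n + m) N) (f : M → N) (x : M) : ℝ :=
  if h : (∃ e : Fin n → TangentSpace (𝓡 n) x, IsTangentFrame T f x e) ∧
      ∃ ξ : Fin m → TangentSpace (𝓡 (n + m)) (f x), IsNormalFrame T f x ξ then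
    2 / ((n : ℝ) * ((n : ℝ) - 1)) * √(∑ i, ∑ j ∈ Finset.Ioi i, ∑ r, ∑ s ∈ Finset.Ioi r,
      T (f x) (normalCurvature T f x (h.1.choose i) (h.1.choose j) (h.2.choose r))
        (h.2.choose s) ^ 2)
  else 0

/-- The matrix `(⟨II(e_i, e_j), ξ⟩)` of the second fundamental form along `ξ` in the frame `e`. -/
def shapeMatrix (T : BilinField (n + m) N) (f : M → N) (x : M)
    (e : Fin n → TangentSpace (𝓡 n) x) (ξ : TangentSpace (𝓡 (n + m)) (f x)) :
    Matrix (Fin n) (Fin n) ℝ :=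
  Matrix.of fun i j => T (f x) (secondFundamentalForm T f x (e i) (e j)) ξ

/-- A real symmetric matrix is austere if its nonzero eigenvalues occur in oppositely signed
pairs, i.e. the multiset of its eigenvalues is invariant under negation. -/
def IsAustereMatrix (A : Matrix (Fin n) (Fin n) ℝ) : Prop :=
  A.IsSymm ∧ A.charpoly.roots.map (fun t => -t) = A.charpoly.roots

/-- The nonzero principal curvatures in every normal direction occur in oppositely signed pairs. -/
def IsAustere (T : BilinField (n + m) N) (f : M → N) : Prop :=
  ∀ (x : M) (e : Fin n → TangentSpace (𝓡 n) x) (ξ : TangentSpace (𝓡 (n + m)) (f x)),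
    IsTangentFrame T f x e → IsNormalVector T f x ξ → IsAustereMatrix (shapeMatrix T f x e ξ)

/-- The space `|II_x|` spanned by the second fundamental forms along all normal vectors, as a space
of matrices in the frame `e`. -/
def secondFormSpace (T : BilinField (n + m) N) (f : M → N) (x : M)
    (e : Fin n → TangentSpace (𝓡 n) x) : Submodule ℝ (Matrix (Fin n) (Fin n) ℝ) :=
  Submodule.span ℝ {A | ∃ ξ, IsNormalVector T f x ξ ∧ A = shapeMatrix T f x e ξ}

/-- `f` is an austere submanifold of type `Q`: at each point, `|II_x| ⊆ Q` in some orthonormal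
basis of the tangent space. -/
def IsAustereOfType (T : BilinField (n + m) N) (f : M → N)
    (Q : Submodule ℝ (Matrix (Fin n) (Fin n) ℝ)) : Prop :=
  IsAustere T f ∧ ∀ x : M, ∃ e : Fin n → TangentSpace (𝓡 n) x,
    IsTangentFrame T f x e ∧ secondFormSpace T f x e ≤ Q

end Submanifold

/-! ### The matrices -/

/-- The space `Q(p, q)` of all block matrices `[0, a; aᵀ, 0]` with `a` a `p × q` matrix. -/
def austereQ (p q : ℕ) : Submodule ℝ (Matrix (Fin (p + q)) (Fin (p + q)) ℝ) where
  carrier := {A | ∃ a : Matrix (Fin p) (Fin q) ℝ,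
    A = Matrix.reindex finSumFinEquiv finSumFinEquiv (Matrix.fromBlocks 0 a a.transpose 0)}
  zero_mem' := ⟨0, by ext; simp⟩
  add_mem' := by
    rintro _ _ ⟨a, rfl⟩ ⟨b, rfl⟩
    refine ⟨a + b, ?_⟩
    have h : Matrix.fromBlocks (0 : Matrix (Fin p) (Fin p) ℝ) (a + b) (a + b).transpose
          (0 : Matrix (Fin q) (Fin q) ℝ) =
        Matrix.fromBlocks 0 a a.transpose 0 + Matrix.fromBlocks 0 b b.transpose 0 := by
      simp [Matrix.fromBlocks_add]
    rw [h]
    rfl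
  smul_mem' := by
    rintro c _ ⟨a, rfl⟩
    refine ⟨c • a, ?_⟩
    have h : Matrix.fromBlocks (0 : Matrix (Fin p) (Fin p) ℝ) (c • a) (c • a).transpose
          (0 : Matrix (Fin q) (Fin q) ℝ) = c • Matrix.fromBlocks 0 a a.transpose 0 := by
      simp [Matrix.fromBlocks_smul]
    rw [h]
    rfl

/-- The matrix `C₁`. -/
def matC1 : Matrix (Fin 4) (Fin 4) ℝ :=
  !![0, 0, 1, 0;
     0, 0, 0, 1;
     1, 0, 0, 0;
     0, 1, 0, 0]

/-- The matrix `C₂`. -/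
def matC2 : Matrix (Fin 4) (Fin 4) ℝ :=
  !![0, 0, 0, -1;
     0, 0, 1, 0;
     0, 1, 0, 0;
     -1, 0, 0, 0]

/-- The `n × n` matrix `diag(C, 0)`, for `4 ≤ n`. -/
def diagZero (n : ℕ) (C : Matrix (Fin 4) (Fin 4) ℝ) : Matrix (Fin n) (Fin n) ℝ :=
  Matrix.of fun i j => if h : i.val < 4 ∧ j.val < 4 then C ⟨i, h.1⟩ ⟨j, h.2⟩ else 0

/-- The model family `A_1 = c diag(C₁, 0)`, `A_2 = c diag(C₂, 0)`, `A_r = 0` for `r > 2`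
(indices start from `0` here). -/
def modelShape (n m : ℕ) (c : ℝ) (r : Fin m) : Matrix (Fin n) (Fin n) ℝ :=
  if r.val = 0 then c • diagZero n matC1
  else if r.val = 1 then c • diagZero n matC2
  else 0

end

/-! ### The Frobenius norm -/

section Frobenius

variable {ι κ : Type*} [Fintype ι] [Fintype κ]

/-- The square of the Frobenius norm of a real matrix. -/
def frobSq (X : Matrix ι κ ℝ) : ℝ := ∑ i, ∑ j, X i j ^ 2

/-- The Frobenius inner product of two real matrices. -/
def frobInner (X Y : Matrix ι κ ℝ) : ℝ := ∑ i, ∑ j, X i j * Y i j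

lemma frobInner_self (X : Matrix ι κ ℝ) : frobInner X X = frobSq X := by
  simp [frobInner, frobSq, sq]

lemma frobSq_nonneg (X : Matrix ι κ ℝ) : 0 ≤ frobSq X := by
  unfold frobSq; positivity

lemma frobInner_eq_trace (X Y : Matrix ι κ ℝ) : frobInner X Y = (X.transpose * Y).trace := by
  simp only [frobInner, Matrix.trace, Matrix.diag, Matrix.mul_apply, Matrix.transpose_apply]
  rw [Finset.sum_comm]

lemma frobInner_comm (X Y : Matrix ι κ ℝ) : frobInner X Y = frobInner Y X := by
  simp [frobInner, mul_comm]

lemma frobInner_transpose (X Y : Matrix ι κ ℝ) :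
    frobInner X.transpose Y.transpose = frobInner X Y := by
  simp only [frobInner, Matrix.transpose_apply]
  rw [Finset.sum_comm]

lemma frobSq_transpose (X : Matrix ι κ ℝ) : frobSq X.transpose = frobSq X := by
  rw [← frobInner_self, frobInner_transpose, frobInner_self]

lemma frobInner_smul_left (c : ℝ) (X Y : Matrix ι κ ℝ) :
    frobInner (c • X) Y = c * frobInner X Y := by
  simp [frobInner, Finset.mul_sum, mul_assoc]

lemma frobInner_smul_right (c : ℝ) (X Y : Matrix ι κ ℝ) :
    frobInner X (c • Y) = c * frobInner X Y := by
  rw [frobInner_comm, frobInner_smul_left, frobInner_comm]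

lemma frobInner_sum_left {τ : Type*} (S : Finset τ) (X : τ → Matrix ι κ ℝ) (Y : Matrix ι κ ℝ) :
    frobInner (∑ s ∈ S, X s) Y = ∑ s ∈ S, frobInner (X s) Y := by
  rw [frobInner_eq_trace, Matrix.transpose_sum, Matrix.sum_mul, Matrix.trace_sum]
  exact Finset.sum_congr rfl fun s _ => (frobInner_eq_trace _ _).symm

lemma frobInner_sum_right {τ : Type*} (S : Finset τ) (X : Matrix ι κ ℝ) (Y : τ → Matrix ι κ ℝ) :
    frobInner X (∑ s ∈ S, Y s) = ∑ s ∈ S, frobInner X (Y s) := by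
  rw [frobInner_comm, frobInner_sum_left]
  exact Finset.sum_congr rfl fun s _ => frobInner_comm _ _

lemma frobSq_smul (c : ℝ) (X : Matrix ι κ ℝ) : frobSq (c • X) = c ^ 2 * frobSq X := by
  simp [frobSq, Finset.mul_sum, mul_pow]

lemma frobSq_eq_zero {X : Matrix ι κ ℝ} : frobSq X = 0 ↔ X = 0 := by
  constructor
  · intro h
    ext i j
    have h1 := (Finset.sum_eq_zero_iff_of_nonneg
      (fun i _ => Finset.sum_nonneg fun j _ => sq_nonneg (X i j))).1 h i (Finset.mem_univ i)
    have h2 := (Finset.sum_eq_zero_iff_of_nonneg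
      (fun j _ => sq_nonneg (X i j))).1 h1 j (Finset.mem_univ j)
    simpa using h2
  · rintro rfl
    simp [frobSq]

lemma frobInner_mul_left_orthogonal [DecidableEq ι] {U : Matrix ι ι ℝ} (hU : U.transpose * U = 1)
    (X Y : Matrix ι κ ℝ) : frobInner (U * X) (U * Y) = frobInner X Y := by
  rw [frobInner_eq_trace, frobInner_eq_trace, Matrix.transpose_mul, Matrix.mul_assoc,
    ← Matrix.mul_assoc _ U, hU, Matrix.one_mul]

lemma frobInner_conj [DecidableEq ι] [DecidableEq κ] {U : Matrix ι ι ℝ} {V : Matrix κ κ ℝ}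
    (hU : U.transpose * U = 1) (hV : V.transpose * V = 1) (X Y : Matrix ι κ ℝ) :
    frobInner (U * X * V.transpose) (U * Y * V.transpose) = frobInner X Y := by
  rw [← frobInner_transpose, Matrix.transpose_mul, Matrix.transpose_mul _ V.transpose,
    Matrix.transpose_transpose, frobInner_mul_left_orthogonal hV, frobInner_transpose,
    frobInner_mul_left_orthogonal hU]

lemma frobSq_conj [DecidableEq ι] [DecidableEq κ] {U : Matrix ι ι ℝ} {V : Matrix κ κ ℝ}
    (hU : U.transpose * U = 1) (hV : V.transpose * V = 1) (X : Matrix ι κ ℝ) :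
    frobSq (U * X * V.transpose) = frobSq X := by
  rw [← frobInner_self, frobInner_conj hU hV, frobInner_self]

end Frobenius

/-! ### A bound for the signless Laplacian of a weighted graph -/

section SignlessLaplacian

variable {ι : Type*} [Fintype ι]

lemma two_mul_degree_add_degree_le {T : ι → ι → ℝ} (hsymm : ∀ i j, T i j = T j i)
    (hnonneg : ∀ i j, 0 ≤ T i j) (hdiag : ∀ i, T i i = 0) {i j : ι} (hij : i ≠ j) (k l : ι)
    (hki : k ≠ i) (hkj : k ≠ j) (hli : l ≠ i) (hlj : l ≠ j) :
    2 * ((∑ k, T i k) + ∑ k, T j k) + T k l ≤ (∑ k, ∑ l, T k l) + 2 * T i j := by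
  classical
  let δ : ι → ℝ := fun k => 1 - (if k = i then 1 else 0) - (if k = j then 1 else 0)
  have hδ : ∀ k, 0 ≤ δ k := by
    intro k
    by_cases h1 : k = i
    · subst h1; simp [δ, hij]
    · by_cases h2 : k = j <;> simp [δ, h1, h2]
      rw [if_neg (fun h => hij h.symm)]
  have hR : T k l ≤ ∑ k, ∑ l, T k l * (δ k * δ l) := by
    have h1 : T k l = T k l * (δ k * δ l) := by simp [δ, hki, hkj, hli, hlj]
    have h2 : ∀ a b, 0 ≤ T a b * (δ a * δ b) := fun a b =>
      mul_nonneg (hnonneg a b) (mul_nonneg (hδ a) (hδ b))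
    calc T k l = T k l * (δ k * δ l) := h1
      _ ≤ ∑ b, T k b * (δ k * δ b) :=
          Finset.single_le_sum (f := fun b => T k b * (δ k * δ b)) (fun b _ => h2 k b)
            (Finset.mem_univ l)
      _ ≤ _ := Finset.single_le_sum (f := fun a => ∑ b, T a b * (δ a * δ b))
            (fun a _ => Finset.sum_nonneg fun b _ => h2 a b) (Finset.mem_univ k)
  have hin : ∀ k, ∑ l, T k l * (δ k * δ l) = δ k * ((∑ l, T k l) - T k i - T k j) := by
    intro k
    have : ∀ l, T k l * (δ k * δ l) = δ k * (T k l - (if l = i then T k l else 0)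
        - (if l = j then T k l else 0)) := by
      intro l
      simp only [δ]
      split_ifs <;> ring
    simp_rw [this, ← Finset.mul_sum, Finset.sum_sub_distrib]
    simp
  have hout : ∑ k, ∑ l, T k l * (δ k * δ l) =
      (∑ k, ∑ l, T k l) - 2 * ((∑ k, T i k) + ∑ k, T j k) + 2 * T i j := by
    simp_rw [hin]
    have : ∀ k, δ k * ((∑ l, T k l) - T k i - T k j) = ((∑ l, T k l) - T i k - T j k)
        - (if k = i then ((∑ l, T k l) - T k i - T k j) else 0)
        - (if k = j then ((∑ l, T k l) - T k i - T k j) else 0) := by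
      intro k
      simp only [δ]
      rw [hsymm i k, hsymm j k]
      split_ifs <;> ring
    simp_rw [this, Finset.sum_sub_distrib]
    simp only [Finset.sum_ite_eq', Finset.mem_univ, if_true, hdiag]
    rw [hsymm j i]
    ring
  linarith

lemma degree_add_degree_le {T : ι → ι → ℝ} (hsymm : ∀ i j, T i j = T j i)
    (hnonneg : ∀ i j, 0 ≤ T i j) (hle : ∀ i j, T i j ≤ 1) (hdiag : ∀ i, T i i = 0) {i j : ι}
    (hij : i ≠ j) :
    (∑ k, T i k) + ∑ k, T j k ≤ (∑ k, ∑ l, T k l) / 2 + 1 := by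
  classical
  by_cases h : ∃ k, k ≠ i ∧ k ≠ j
  · obtain ⟨k, h1, h2⟩ := h
    have := two_mul_degree_add_degree_le hsymm hnonneg hdiag hij k k h1 h2 h1 h2
    linarith [hdiag k, hle i j]
  · push Not at h
    have huniv : (Finset.univ : Finset ι) = {i, j} := by
      ext k
      simp only [Finset.mem_univ, Finset.mem_insert, Finset.mem_singleton, true_iff]
      by_cases hk : k = i
      · exact Or.inl hk
      · exact Or.inr (h k hk)
    simp only [huniv, Finset.sum_pair hij, hdiag]
    linarith [hsymm i j, hle i j]

/-- The largest eigenvalue of the signless Laplacian of a graph with edge weights in `[0, 1]` is at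
most the total weight plus one; the slack comes from pairs of disjoint edges. -/
lemma signlessLaplacian_sq_le {T : ι → ι → ℝ} (hsymm : ∀ i j, T i j = T j i)
    (hnonneg : ∀ i j, 0 ≤ T i j) (σ : ι → ℝ) :
    (∑ i, ∑ j, T i j * (σ i + σ j) ^ 2) ^ 2 +
        2 * (∑ i, σ i ^ 2) * ∑ i, ∑ j, ((∑ k, ∑ l, T k l) / 2 + 1 - ((∑ k, T i k) + ∑ k, T j k)) *
          (T i j * (σ i + σ j) ^ 2) ≤
      (∑ i, σ i ^ 2) * ((∑ i, ∑ j, T i j) + 2) * ∑ i, ∑ j, T i j * (σ i + σ j) ^ 2 := by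
  set τ := ∑ i, ∑ j, T i j with hτ
  set s := ∑ i, σ i ^ 2 with hs
  set Y := ∑ i, ∑ j, T i j * (σ i + σ j) ^ 2 with hY
  let d : ι → ℝ := fun i => ∑ k, T i k
  let Z : ι → ℝ := fun i => ∑ j, T i j * (σ i + σ j)
  have hYZ : Y = 2 * ∑ i, σ i * Z i := by
    have h1 : ∑ i, ∑ j, T i j * (σ i + σ j) * σ j = ∑ i, σ i * Z i := by
      rw [Finset.sum_comm]
      refine Finset.sum_congr rfl fun i _ => ?_
      simp only [Z, Finset.mul_sum]
      refine Finset.sum_congr rfl fun j _ => ?_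
      rw [hsymm j i]; ring
    have h2 : ∑ i, ∑ j, T i j * (σ i + σ j) * σ i = ∑ i, σ i * Z i := by
      refine Finset.sum_congr rfl fun i _ => ?_
      simp only [Z, Finset.mul_sum]
      refine Finset.sum_congr rfl fun j _ => ?_
      ring
    rw [two_mul, ← h1]
    nth_rewrite 2 [h1]
    rw [← h2, ← Finset.sum_add_distrib, hY]
    refine Finset.sum_congr rfl fun i _ => ?_
    rw [← Finset.sum_add_distrib]
    refine Finset.sum_congr rfl fun j _ => ?_
    ring
  have hZ : ∀ i, Z i ^ 2 ≤ d i * ∑ j, T i j * (σ i + σ j) ^ 2 := by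
    intro i
    apply Finset.sum_sq_le_sum_mul_sum_of_sq_le_mul
    · exact fun j _ => hnonneg i j
    · exact fun j _ => mul_nonneg (hnonneg i j) (sq_nonneg _)
    · intro j _; exact le_of_eq (by ring)
  have hdY : 2 * ∑ i, d i * ∑ j, T i j * (σ i + σ j) ^ 2 =
      ∑ i, ∑ j, (d i + d j) * (T i j * (σ i + σ j) ^ 2) := by
    have h1 : ∑ i, ∑ j, d j * (T i j * (σ i + σ j) ^ 2) =
        ∑ i, d i * ∑ j, T i j * (σ i + σ j) ^ 2 := by
      rw [Finset.sum_comm]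
      refine Finset.sum_congr rfl fun i _ => ?_
      rw [Finset.mul_sum]
      refine Finset.sum_congr rfl fun j _ => ?_
      rw [hsymm j i]; ring
    simp_rw [add_mul, Finset.sum_add_distrib, h1, ← Finset.mul_sum]
    ring
  have hQ : ∑ i, ∑ j, (τ / 2 + 1 - (d i + d j)) * (T i j * (σ i + σ j) ^ 2) =
      (τ / 2 + 1) * Y - ∑ i, ∑ j, (d i + d j) * (T i j * (σ i + σ j) ^ 2) := by
    simp_rw [sub_mul, Finset.sum_sub_distrib, ← Finset.mul_sum]
    rfl
  have hC : (∑ i, σ i * Z i) ^ 2 ≤ s * ∑ i, Z i ^ 2 :=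
    Finset.sum_mul_sq_le_sq_mul_sq _ _ _
  have hs0 : 0 ≤ s := Finset.sum_nonneg fun i _ => sq_nonneg _
  have hZs : ∑ i, Z i ^ 2 ≤ ∑ i, d i * ∑ j, T i j * (σ i + σ j) ^ 2 :=
    Finset.sum_le_sum fun i _ => hZ i
  have h3 : Y ^ 2 ≤ 4 * (s * ∑ i, d i * ∑ j, T i j * (σ i + σ j) ^ 2) := by
    rw [hYZ, mul_pow]
    have := mul_le_mul_of_nonneg_left hZs hs0
    linarith
  have h4 : 2 * s * (∑ i, ∑ j, (τ / 2 + 1 - (d i + d j)) * (T i j * (σ i + σ j) ^ 2)) =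
      s * (τ + 2) * Y - 4 * (s * ∑ i, d i * ∑ j, T i j * (σ i + σ j) ^ 2) := by
    rw [hQ, ← hdY]; ring
  change Y ^ 2 + 2 * s * (∑ i, ∑ j, (τ / 2 + 1 - (d i + d j)) * (T i j * (σ i + σ j) ^ 2)) ≤ _
  rw [h4]
  linarith

end SignlessLaplacian

/-! ### Commutators of block off-diagonal matrices -/

section Cross

variable {ι : Type*} [Fintype ι]

/-- The squared norm of the commutator of the symmetric matrices with off-diagonal blocks `a`
and `b`. -/
def crossSq (a b : Matrix ι ι ℝ) : ℝ :=
  frobSq (a * b.transpose - b * a.transpose) + frobSq (a.transpose * b - b.transpose * a)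

lemma crossSq_conj [DecidableEq ι] {U V : Matrix ι ι ℝ} (hU : U.transpose * U = 1)
    (hV : V.transpose * V = 1) (a b : Matrix ι ι ℝ) :
    crossSq (U * a * V.transpose) (U * b * V.transpose) = crossSq a b := by
  have h1 : ∀ a b : Matrix ι ι ℝ, (U * a * V.transpose) * (U * b * V.transpose).transpose =
      U * (a * b.transpose) * U.transpose := by
    intro a b
    simp only [Matrix.transpose_mul, Matrix.transpose_transpose, Matrix.mul_assoc]
    rw [← Matrix.mul_assoc V.transpose V, hV, Matrix.one_mul]
  have h2 : ∀ a b : Matrix ι ι ℝ, (U * a * V.transpose).transpose * (U * b * V.transpose) =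
      V * (a.transpose * b) * V.transpose := by
    intro a b
    simp only [Matrix.transpose_mul, Matrix.transpose_transpose, Matrix.mul_assoc]
    rw [← Matrix.mul_assoc U.transpose U, hU, Matrix.one_mul]
  unfold crossSq
  rw [h1, h1, h2, h2, ← Matrix.sub_mul, ← Matrix.mul_sub, ← Matrix.sub_mul, ← Matrix.mul_sub,
    frobSq_conj hU hU, frobSq_conj hV hV]

lemma crossSq_smul_smul (c d : ℝ) (a b : Matrix ι ι ℝ) :
    crossSq (c • a) (d • b) = c ^ 2 * d ^ 2 * crossSq a b := by
  have h1 : (c • a) * (d • b).transpose - (d • b) * (c • a).transpose =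
      (c * d) • (a * b.transpose - b * a.transpose) := by
    simp [smul_sub, smul_smul, mul_comm]
  have h2 : (c • a).transpose * (d • b) - (d • b).transpose * (c • a) =
      (c * d) • (a.transpose * b - b.transpose * a) := by
    simp [smul_sub, smul_smul, mul_comm]
  unfold crossSq
  rw [h1, h2, frobSq_smul, frobSq_smul]
  ring

lemma crossSq_self (a : Matrix ι ι ℝ) : crossSq a a = 0 := by
  simp [crossSq, frobSq]

/-- The symmetric part of an entry. -/
noncomputable def symmEntry (b : Matrix ι ι ℝ) (i j : ι) : ℝ := (b i j + b j i) / 2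

/-- The skew-symmetric part of an entry. -/
noncomputable def skewEntry (b : Matrix ι ι ℝ) (i j : ι) : ℝ := (b i j - b j i) / 2

lemma frobSq_eq_symm_add_skew (b : Matrix ι ι ℝ) :
    frobSq b = ∑ i, ∑ j, (symmEntry b i j ^ 2 + skewEntry b i j ^ 2) := by
  have h : frobSq b = (1 / 2) * (frobSq b + frobSq b.transpose) := by
    rw [frobSq_transpose]; ring
  rw [h]
  simp only [frobSq, ← Finset.sum_add_distrib, Finset.mul_sum, symmEntry, skewEntry,
    Matrix.transpose_apply]
  refine Finset.sum_congr rfl fun i _ => Finset.sum_congr rfl fun j _ => ?_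
  ring

lemma crossSq_diagonal [DecidableEq ι] (σ : ι → ℝ) (b : Matrix ι ι ℝ) :
    crossSq (Matrix.diagonal σ) b = 2 * ∑ i, ∑ j,
      ((σ i - σ j) ^ 2 * symmEntry b i j ^ 2 + (σ i + σ j) ^ 2 * skewEntry b i j ^ 2) := by
  simp only [crossSq, frobSq, ← Finset.sum_add_distrib, Finset.mul_sum, symmEntry, skewEntry,
    Matrix.transpose_apply, Matrix.sub_apply, Matrix.diagonal_transpose, Matrix.diagonal_mul,
    Matrix.mul_diagonal]
  refine Finset.sum_congr rfl fun i _ => Finset.sum_congr rfl fun j _ => ?_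
  ring

lemma frobSq_diagonal [DecidableEq ι] (σ : ι → ℝ) :
    frobSq (Matrix.diagonal σ) = ∑ i, σ i ^ 2 := by
  unfold frobSq
  refine Finset.sum_congr rfl fun i _ => ?_
  rw [Finset.sum_eq_single i]
  · simp
  · intro j _ hj
    simp [Matrix.diagonal_apply_ne' _ hj]
  · simp

/-- Bessel's inequality for the Frobenius inner product. -/
lemma frobInner_bessel {κ : Type*} [Fintype κ] [DecidableEq κ] {b : κ → Matrix ι ι ℝ}
    (hb : ∀ s t, frobInner (b s) (b t) = if s = t then 1 else 0) (z : Matrix ι ι ℝ) :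
    ∑ s, frobInner (b s) z ^ 2 ≤ frobSq z := by
  let toE : Matrix ι ι ℝ → EuclideanSpace ℝ (ι × ι) := fun X => WithLp.toLp 2 fun p => X p.1 p.2
  have hin : ∀ X Y, inner ℝ (toE X) (toE Y) = frobInner X Y := by
    intro X Y
    simp [toE, PiLp.inner_apply, Fintype.sum_prod_type, frobInner, mul_comm]
  have hon : Orthonormal ℝ fun s => toE (b s) := by
    rw [orthonormal_iff_ite]
    intro s t
    rw [hin, hb]
  have h := hon.sum_inner_products_le (s := Finset.univ) (toE z)
  rw [← real_inner_self_eq_norm_sq, hin, frobInner_self] at h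
  simpa [hin] using h

lemma sum_skewEntry_sq_le {κ : Type*} [Fintype κ] [DecidableEq κ] {b : κ → Matrix ι ι ℝ}
    (hb : ∀ s t, frobInner (b s) (b t) = if s = t then 1 else 0) (i j : ι) :
    ∑ s, skewEntry (b s) i j ^ 2 ≤ 1 / 2 := by
  classical
  by_cases hij : i = j
  · subst hij
    simp [skewEntry]
  let z : Matrix ι ι ℝ := fun k l =>
    (if k = i ∧ l = j then 1 / 2 else 0) - (if k = j ∧ l = i then 1 / 2 else 0)
  have h1 : ∀ X, frobInner X z = skewEntry X i j := by
    intro X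
    simp only [frobInner, z, mul_sub, Finset.sum_sub_distrib, ite_and, mul_ite, mul_zero]
    simp [skewEntry]
    ring
  have h := frobInner_bessel hb z
  rw [← frobInner_self, h1] at h
  simp only [h1] at h
  refine h.trans (le_of_eq ?_)
  simp [skewEntry, z, hij, Ne.symm hij]

end Cross

/-! ### Singular value decomposition of a square matrix -/

section SVD

variable {d : ℕ}

/-- The matrix whose columns are the vectors of an orthonormal basis. -/
noncomputable def basisMatrix (u : OrthonormalBasis (Fin d) ℝ (EuclideanSpace ℝ (Fin d))) :
    Matrix (Fin d) (Fin d) ℝ := Matrix.of fun i j => u j i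

lemma basisMatrix_transpose_mul (u : OrthonormalBasis (Fin d) ℝ (EuclideanSpace ℝ (Fin d))) :
    (basisMatrix u).transpose * basisMatrix u = 1 := by
  ext i j
  have h := orthonormal_iff_ite.1 u.orthonormal i j
  simp only [PiLp.inner_apply, RCLike.inner_apply, conj_trivial] at h
  rw [Matrix.mul_apply, Matrix.one_apply, ← h]
  refine Finset.sum_congr rfl fun k _ => ?_
  simp [basisMatrix, mul_comm]

/-- Orthonormal columns indexed by a subset can be completed to an orthogonal matrix. -/
lemma exists_orthogonal_extension (s : Set (Fin d)) (w : Fin d → Fin d → ℝ)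
    (hw : ∀ i ∈ s, ∀ j ∈ s, ∑ k, w i k * w j k = if i = j then 1 else 0) :
    ∃ U : Matrix (Fin d) (Fin d) ℝ, U.transpose * U = 1 ∧ ∀ i ∈ s, ∀ k, U k i = w i k := by
  let v : Fin d → EuclideanSpace ℝ (Fin d) := fun i => WithLp.toLp 2 (w i)
  have hv : Orthonormal ℝ (s.domRestrict v) := by
    rw [orthonormal_iff_ite]
    rintro ⟨i, hi⟩ ⟨j, hj⟩
    have := hw i hi j hj
    simp only [v, PiLp.inner_apply, RCLike.inner_apply, conj_trivial,
      Subtype.mk.injEq]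
    rw [← this]
    exact Finset.sum_congr rfl fun k _ => mul_comm _ _
  obtain ⟨u, hu⟩ := hv.exists_orthonormalBasis_extension_of_card_eq (by simp)
  refine ⟨basisMatrix u, basisMatrix_transpose_mul u, fun i hi k => ?_⟩
  simp [basisMatrix, hu i hi, v]

/-- A real symmetric matrix is diagonalised by an orthogonal matrix. -/
lemma exists_orthogonal_diagonalization {A : Matrix (Fin d) (Fin d) ℝ} (hA : A.IsSymm) :
    ∃ (V : Matrix (Fin d) (Fin d) ℝ) (μ : Fin d → ℝ), V.transpose * V = 1 ∧
      V.transpose * A * V = Matrix.diagonal μ := by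
  have hH : A.IsHermitian := by
    rw [Matrix.IsHermitian, Matrix.conjTranspose_eq_transpose_of_trivial]
    exact hA
  let V : Matrix (Fin d) (Fin d) ℝ := hH.eigenvectorUnitary
  have hV : V.transpose * V = 1 := by
    have := Matrix.mem_unitaryGroup_iff'.1 hH.eigenvectorUnitary.2
    simpa [Matrix.star_eq_conjTranspose, Matrix.conjTranspose_eq_transpose_of_trivial] using this
  refine ⟨V, hH.eigenvalues, hV, ?_⟩
  have h := hH.spectral_theorem
  have h2 : A = V * Matrix.diagonal hH.eigenvalues * V.transpose := by
    conv_lhs => rw [h]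
    rw [Unitary.conjStarAlgAut_apply]
    simp [V, Matrix.star_eq_conjTranspose, Matrix.conjTranspose_eq_transpose_of_trivial]
  calc V.transpose * A * V = V.transpose * (V * Matrix.diagonal hH.eigenvalues * V.transpose) * V := by
        rw [← h2]
    _ = (V.transpose * V) * Matrix.diagonal hH.eigenvalues * (V.transpose * V) := by
        simp only [Matrix.mul_assoc]
    _ = _ := by rw [hV, Matrix.one_mul, Matrix.mul_one]

/-- Singular value decomposition of a real square matrix. -/
lemma exists_svd (a : Matrix (Fin d) (Fin d) ℝ) :
    ∃ (U V : Matrix (Fin d) (Fin d) ℝ) (σ : Fin d → ℝ), U.transpose * U = 1 ∧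
      V.transpose * V = 1 ∧ (∀ i, 0 ≤ σ i) ∧ a = U * Matrix.diagonal σ * V.transpose := by
  obtain ⟨V, μ, hV, hμ⟩ := exists_orthogonal_diagonalization
    (A := a.transpose * a) (by simp [Matrix.IsSymm, Matrix.transpose_mul])
  let W := a * V
  have hW : W.transpose * W = Matrix.diagonal μ := by
    rw [← hμ]; simp [W, Matrix.transpose_mul, Matrix.mul_assoc]
  have hWe : ∀ i j, ∑ k, W k i * W k j = if i = j then μ i else 0 := by
    intro i j
    have := congrFun (congrFun hW i) j
    simpa [Matrix.mul_apply, Matrix.diagonal_apply] using this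
  have hμ0 : ∀ i, 0 ≤ μ i := by
    intro i
    have := hWe i i
    rw [if_pos rfl] at this
    rw [← this]
    exact Finset.sum_nonneg fun k _ => mul_self_nonneg _
  obtain ⟨U, hU, hUW⟩ := exists_orthogonal_extension {i | μ i ≠ 0}
    (fun i k => (√(μ i))⁻¹ * W k i) (by
      intro i hi j hj
      have : ∀ k, (√(μ i))⁻¹ * W k i * ((√(μ j))⁻¹ * W k j) =
          (√(μ i))⁻¹ * (√(μ j))⁻¹ * (W k i * W k j) := fun k => by ring
      simp_rw [this, ← Finset.mul_sum, hWe]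
      split_ifs with h
      · subst h
        rw [← mul_inv, Real.mul_self_sqrt (hμ0 i), inv_mul_cancel₀ hi]
      · simp)
  refine ⟨U, V, fun i => √(μ i), hU, hV, fun i => Real.sqrt_nonneg _, ?_⟩
  have h1 : U * Matrix.diagonal (fun i => √(μ i)) = W := by
    ext k i
    rw [Matrix.mul_diagonal]
    by_cases hi : μ i = 0
    · have h2 := hWe i i
      rw [if_pos rfl, hi] at h2
      have h3 := (Finset.sum_eq_zero_iff_of_nonneg
        (fun k _ => mul_self_nonneg (W k i))).1 h2 k (Finset.mem_univ k)
      rw [hi, mul_self_eq_zero.1 h3]; simp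
    · rw [hUW i hi k]
      have : √(μ i) ≠ 0 := (Real.sqrt_pos.2 (lt_of_le_of_ne (hμ0 i) (Ne.symm hi))).ne'
      field_simp
  rw [h1, Matrix.mul_assoc, mul_eq_one_comm.1 hV, Matrix.mul_one]

end SVD

/-! ### Commutators of a fixed matrix with an orthonormal family -/

section Family

variable {ι κ : Type*} [Fintype ι] [Fintype κ]

/-- The `x ∧ y` form of a skew-symmetric matrix all of whose `4 × 4` Pfaffians are monomials that
vanish. -/
lemma exists_wedge_of_skew {b : Matrix ι ι ℝ} (hskew : ∀ i j, b i j = -b j i)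
    (hb : b ≠ 0)
    (hdisj : ∀ i j k l, i ≠ j → k ≠ l → i ≠ k → i ≠ l → j ≠ k → j ≠ l → b i j * b k l = 0) :
    ∃ (c : ℝ) (x y : ι → ℝ), ∑ i, x i ^ 2 = 1 ∧ ∑ i, y i ^ 2 = 1 ∧ ∑ i, x i * y i = 0 ∧
      ∀ i j, b i j = c * (x i * y j - y i * x j) := by
  classical
  have hdiag : ∀ i, b i i = 0 := fun i => by linarith [hskew i i]
  obtain ⟨p, q, hpq⟩ : ∃ p q, b p q ≠ 0 := by
    by_contra h
    push Not at h
    exact hb (by ext i j; simpa using h i j)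
  have hpne : p ≠ q := by rintro rfl; exact hpq (hdiag p)
  have hpl : ∀ i j, b p q * b i j = b p i * b q j - b p j * b q i := by
    intro i j
    by_cases hij : i = j
    · subst hij; rw [hdiag]; ring
    by_cases hip : i = p
    · subst hip; rw [hdiag, hskew q i]; ring
    by_cases hiq : i = q
    · subst hiq; rw [hdiag]; ring
    by_cases hjp : j = p
    · subst hjp; rw [hdiag, hskew q j, hskew i j]; ring
    by_cases hjq : j = q
    · subst hjq; rw [hdiag, hskew i j]; ring
    rw [hdisj p q i j hpne hij (Ne.symm hip) (Ne.symm hjp) (Ne.symm hiq) (Ne.symm hjq),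
      hdisj p i q j (Ne.symm hip) (Ne.symm hjq) hpne (Ne.symm hjp) hiq hij,
      hdisj p j q i (Ne.symm hjp) (Ne.symm hiq) hpne (Ne.symm hip) hjq (Ne.symm hij)]
    ring
  let X : ℝ := ∑ i, b p i ^ 2
  have hX : 0 < X :=
    Finset.sum_pos' (fun i _ => sq_nonneg _)
      ⟨q, Finset.mem_univ q, lt_of_le_of_ne (sq_nonneg _) (pow_ne_zero 2 hpq).symm⟩
  let m : ℝ := ∑ i, b p i * b q i
  let z : ι → ℝ := fun i => b q i - m / X * b p i
  have hxz : ∑ i, b p i * z i = 0 := by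
    have : ∀ i, b p i * z i = b p i * b q i - m / X * b p i ^ 2 := fun i => by simp only [z]; ring
    simp_rw [this, Finset.sum_sub_distrib, ← Finset.mul_sum]
    change m - m / X * X = 0
    field_simp
    ring
  let Z : ℝ := ∑ i, z i ^ 2
  have hZ : 0 < Z := by
    refine Finset.sum_pos' (fun i _ => sq_nonneg _) ⟨p, Finset.mem_univ p, ?_⟩
    have : z p = - b p q := by simp only [z, hdiag]; rw [hskew q p]; ring
    rw [this, neg_sq]
    exact lt_of_le_of_ne (sq_nonneg _) (pow_ne_zero 2 hpq).symm
  have hsX : √X ^ 2 = X := Real.sq_sqrt hX.le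
  have hsZ : √Z ^ 2 = Z := Real.sq_sqrt hZ.le
  have hsX0 : √X ≠ 0 := (Real.sqrt_pos.2 hX).ne'
  have hsZ0 : √Z ≠ 0 := (Real.sqrt_pos.2 hZ).ne'
  refine ⟨√X * √Z / b p q, fun i => b p i / √X, fun i => z i / √Z, ?_, ?_, ?_, ?_⟩
  · simp_rw [div_pow, ← Finset.sum_div, hsX]
    exact div_self hX.ne'
  · simp_rw [div_pow, ← Finset.sum_div, hsZ]
    exact div_self hZ.ne'
  · have : ∀ i, b p i / √X * (z i / √Z) = (b p i * z i) / (√X * √Z) := fun i => by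
      field_simp
    simp_rw [this, ← Finset.sum_div, hxz, zero_div]
  · intro i j
    have h := hpl i j
    have : b i j = (b p i * b q j - b p j * b q i) / b p q := by
      rw [← h]; field_simp
    rw [this]
    simp only [z]
    field_simp
    ring

variable {σ : ι → ℝ}

lemma add_sq_le_of_ne {i j : ι} (hij : i ≠ j) : σ i ^ 2 + σ j ^ 2 ≤ ∑ k, σ k ^ 2 := by
  classical
  rw [← Finset.sum_pair (f := fun k => σ k ^ 2) hij]
  exact Finset.sum_le_sum_of_subset_of_nonneg (Finset.subset_univ _) fun k _ _ => sq_nonneg _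

lemma sub_sq_le_sum_sq (hσ : ∀ i, 0 ≤ σ i) (i j : ι) : (σ i - σ j) ^ 2 ≤ ∑ k, σ k ^ 2 := by
  by_cases hij : i = j
  · subst hij; simp; positivity
  · nlinarith [add_sq_le_of_ne (σ := σ) hij, mul_nonneg (hσ i) (hσ j)]

lemma add_sq_le_of_sub_sq_eq (hσ : ∀ i, 0 ≤ σ i) {i j : ι}
    (h : (σ i - σ j) ^ 2 = ∑ k, σ k ^ 2) {k l : ι} (hkl : k ≠ l) :
    (σ k + σ l) ^ 2 ≤ ∑ k, σ k ^ 2 := by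
  have key : ∃ i₀, ∑ k, σ k ^ 2 = σ i₀ ^ 2 := by
    by_cases hij : i = j
    · subst hij
      refine ⟨i, ?_⟩
      have h1 := Finset.single_le_sum (f := fun k => σ k ^ 2) (fun k _ => sq_nonneg _)
        (Finset.mem_univ i)
      nlinarith [sq_nonneg (σ i)]
    · have h1 := add_sq_le_of_ne (σ := σ) hij
      have h2 : σ i * σ j = 0 := le_antisymm (by nlinarith) (mul_nonneg (hσ i) (hσ j))
      rcases mul_eq_zero.1 h2 with h3 | h3
      · exact ⟨j, by rw [← h, h3]; ring⟩
      · exact ⟨i, by rw [← h, h3]; ring⟩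
  obtain ⟨i₀, h0⟩ := key
  have hz : ∀ k, k ≠ i₀ → σ k = 0 := by
    intro k hk
    have := add_sq_le_of_ne (σ := σ) hk
    have : σ k ^ 2 = 0 := le_antisymm (by linarith) (sq_nonneg _)
    exact pow_eq_zero_iff (two_ne_zero) |>.1 this
  have hprod : σ k * σ l = 0 := by
    by_cases hk : k = i₀
    · rw [hz l (by rintro rfl; exact hkl hk), mul_zero]
    · rw [hz k hk, zero_mul]
  nlinarith [add_sq_le_of_ne (σ := σ) hkl]

lemma sum_symm_add_skew_of_orthonormal [DecidableEq κ] {b : κ → Matrix ι ι ℝ}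
    (hb : ∀ s t, frobInner (b s) (b t) = if s = t then 1 else 0) :
    (∑ i, ∑ j, ∑ s, symmEntry (b s) i j ^ 2) + ∑ i, ∑ j, ∑ s, skewEntry (b s) i j ^ 2 =
      Fintype.card κ := by
  have h1 : ∀ s, ∑ i, ∑ j, (symmEntry (b s) i j ^ 2 + skewEntry (b s) i j ^ 2) = 1 := by
    intro s
    rw [← frobSq_eq_symm_add_skew, ← frobInner_self, hb]; simp
  have h2 : ∑ s, ∑ i, ∑ j, (symmEntry (b s) i j ^ 2 + skewEntry (b s) i j ^ 2) =
      Fintype.card κ := by simp [h1]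
  have h3 : ∀ f : κ → ι → ι → ℝ, ∑ s, ∑ i, ∑ j, f s i j = ∑ i, ∑ j, ∑ s, f s i j := by
    intro f
    rw [Finset.sum_comm]
    exact Finset.sum_congr rfl fun i _ => Finset.sum_comm
  rw [← h2, h3]
  simp_rw [Finset.sum_add_distrib]

lemma sum_crossSq_diagonal [DecidableEq ι] (σ : ι → ℝ) (b : κ → Matrix ι ι ℝ) :
    ∑ s, crossSq (Matrix.diagonal σ) (b s) =
      2 * (∑ i, ∑ j, (σ i - σ j) ^ 2 * ∑ s, symmEntry (b s) i j ^ 2) +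
      2 * ∑ i, ∑ j, (σ i + σ j) ^ 2 * ∑ s, skewEntry (b s) i j ^ 2 := by
  simp_rw [crossSq_diagonal]
  rw [← Finset.mul_sum, ← mul_add, ← Finset.sum_add_distrib, Finset.sum_comm]
  congr 1
  refine Finset.sum_congr rfl fun i _ => ?_
  rw [Finset.sum_comm, ← Finset.sum_add_distrib]
  refine Finset.sum_congr rfl fun j _ => ?_
  rw [Finset.sum_add_distrib, Finset.mul_sum, Finset.mul_sum]

/-- The bound for the commutators of a diagonal matrix with an orthonormal family, together with the
rigidity in the equality case. -/
lemma sum_crossSq_diagonal_le [DecidableEq ι] [DecidableEq κ] (hσ : ∀ i, 0 ≤ σ i) {b : κ → Matrix ι ι ℝ}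
    (hb : ∀ s t, frobInner (b s) (b t) = if s = t then 1 else 0) :
    ∑ s, crossSq (Matrix.diagonal σ) (b s) ≤ 2 * (Fintype.card κ + 1) * ∑ i, σ i ^ 2 ∧
    (0 < ∑ i, σ i ^ 2 →
      ∑ s, crossSq (Matrix.diagonal σ) (b s) = 2 * (Fintype.card κ + 1) * ∑ i, σ i ^ 2 →
      ∀ s, (∀ i j, b s i j = -b s j i) ∧
        ∀ i j k l, i ≠ j → k ≠ l → i ≠ k → i ≠ l → j ≠ k → j ≠ l → b s i j * b s k l = 0) := by
  have hcard := sum_symm_add_skew_of_orthonormal hb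
  rw [sum_crossSq_diagonal]
  let S : ι → ι → ℝ := fun i j => ∑ s, symmEntry (b s) i j ^ 2
  let K : ι → ι → ℝ := fun i j => ∑ s, skewEntry (b s) i j ^ 2
  have hS0 : ∀ i j, 0 ≤ S i j := fun i j => Finset.sum_nonneg fun s _ => sq_nonneg _
  have hK0 : ∀ i j, 0 ≤ K i j := fun i j => Finset.sum_nonneg fun s _ => sq_nonneg _
  have hK1 : ∀ i j, K i j ≤ 1 / 2 := sum_skewEntry_sq_le hb
  change (∑ i, ∑ j, S i j) + (∑ i, ∑ j, K i j) = _ at hcard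
  change 2 * (∑ i, ∑ j, (σ i - σ j) ^ 2 * S i j) + 2 * (∑ i, ∑ j, (σ i + σ j) ^ 2 * K i j) ≤ _ ∧
    (_ → 2 * (∑ i, ∑ j, (σ i - σ j) ^ 2 * S i j) + 2 * (∑ i, ∑ j, (σ i + σ j) ^ 2 * K i j) = _
      → _)
  rw [← hcard]
  have hKsymm : ∀ i j, K i j = K j i := by
    intro i j
    refine Finset.sum_congr rfl fun s _ => ?_
    simp only [skewEntry]; ring
  have hKdiag : ∀ i, K i i = 0 := by intro i; simp [K, skewEntry]
  let T : ι → ι → ℝ := fun i j => if σ i + σ j = 0 then 0 else 2 * K i j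
  have hT0 : ∀ i j, 0 ≤ T i j := fun i j => by
    simp only [T]; split_ifs <;> linarith [hK0 i j]
  have hT1 : ∀ i j, T i j ≤ 1 := fun i j => by
    simp only [T]; split_ifs <;> linarith [hK1 i j]
  have hTK : ∀ i j, T i j ≤ 2 * K i j := fun i j => by
    simp only [T]; split_ifs <;> linarith [hK0 i j]
  have hTsymm : ∀ i j, T i j = T j i := fun i j => by
    simp only [T]; rw [add_comm, hKsymm i j]
  have hTdiag : ∀ i, T i i = 0 := fun i => by simp [T, hKdiag]
  set s := ∑ i, σ i ^ 2 with hs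
  have hs0 : 0 ≤ s := Finset.sum_nonneg fun i _ => sq_nonneg _
  set τ := ∑ i, ∑ j, T i j with hτ
  set Y := ∑ i, ∑ j, T i j * (σ i + σ j) ^ 2 with hY
  have hYK : 2 * ∑ i, ∑ j, (σ i + σ j) ^ 2 * K i j = Y := by
    rw [Finset.mul_sum]
    refine Finset.sum_congr rfl fun i _ => ?_
    rw [Finset.mul_sum]
    refine Finset.sum_congr rfl fun j _ => ?_
    simp only [T]
    split_ifs with h
    · rw [h]; ring
    · ring
  have hτK : τ ≤ 2 * ∑ i, ∑ j, K i j := by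
    rw [Finset.mul_sum]
    refine Finset.sum_le_sum fun i _ => ?_
    rw [Finset.mul_sum]
    exact Finset.sum_le_sum fun j _ => hTK i j
  have hτ0 : 0 ≤ τ := Finset.sum_nonneg fun i _ => Finset.sum_nonneg fun j _ => hT0 i j
  have hterm : ∀ i j, 0 ≤ (τ / 2 + 1 - ((∑ k, T i k) + ∑ k, T j k)) *
      (T i j * (σ i + σ j) ^ 2) := by
    intro i j
    by_cases hij : i = j
    · subst hij; rw [hTdiag]; simp
    · exact mul_nonneg (by linarith [degree_add_degree_le hTsymm hT0 hT1 hTdiag hij])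
        (mul_nonneg (hT0 i j) (sq_nonneg _))
  have hL := signlessLaplacian_sq_le hTsymm hT0 σ
  rw [← hs, ← hτ, ← hY] at hL
  set R := ∑ i, ∑ j, (τ / 2 + 1 - ((∑ k, T i k) + ∑ k, T j k)) * (T i j * (σ i + σ j) ^ 2) with hR
  have hR0 : 0 ≤ R := Finset.sum_nonneg fun i _ => Finset.sum_nonneg fun j _ => hterm i j
  have hY0 : 0 ≤ Y := Finset.sum_nonneg fun i _ => Finset.sum_nonneg fun j _ =>
    mul_nonneg (hT0 i j) (sq_nonneg _)
  have hYle : Y ≤ s * (τ + 2) := by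
    by_cases h : Y = 0
    · rw [h]; positivity
    · have hpos : 0 < Y := lt_of_le_of_ne hY0 (Ne.symm h)
      have : Y * Y ≤ s * (τ + 2) * Y := by nlinarith [mul_nonneg hs0 hR0]
      exact le_of_mul_le_mul_right this hpos
  have hSle : ∑ i, ∑ j, (σ i - σ j) ^ 2 * S i j ≤ s * ∑ i, ∑ j, S i j := by
    simp_rw [Finset.mul_sum]
    exact Finset.sum_le_sum fun i _ => Finset.sum_le_sum fun j _ =>
      mul_le_mul_of_nonneg_right (sub_sq_le_sum_sq hσ i j) (hS0 i j)
  have hsτ : s * τ ≤ s * (2 * ∑ i, ∑ j, K i j) := mul_le_mul_of_nonneg_left hτK hs0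
  rw [hYK]
  refine ⟨by nlinarith, fun hspos heq => ?_⟩
  have e1 : ∑ i, ∑ j, (σ i - σ j) ^ 2 * S i j = s * ∑ i, ∑ j, S i j := by nlinarith
  have e2 : Y = s * (τ + 2) := by nlinarith
  have e3 : τ = 2 * ∑ i, ∑ j, K i j := by
    have : s * τ = s * (2 * ∑ i, ∑ j, K i j) := by nlinarith
    exact mul_left_cancel₀ hspos.ne' this
  have hYpos : 0 < Y := by rw [e2]; positivity
  have eR : R = 0 := by
    have h1 : s * R ≤ 0 := by rw [e2] at hL; nlinarith
    exact le_antisymm (by nlinarith) hR0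
  have hStermwise : ∀ i j, S i j = 0 := by
    intro i j
    have h1 : ∑ i, ∑ j, (s - (σ i - σ j) ^ 2) * S i j = 0 := by
      simp_rw [sub_mul, Finset.sum_sub_distrib, ← Finset.mul_sum]
      linarith
    have hnn : ∀ i j, 0 ≤ (s - (σ i - σ j) ^ 2) * S i j := fun i j =>
      mul_nonneg (by linarith [sub_sq_le_sum_sq hσ i j]) (hS0 i j)
    have h2 := (Finset.sum_eq_zero_iff_of_nonneg (fun i _ => Finset.sum_nonneg
      fun j _ => hnn i j)).1 h1 i (Finset.mem_univ i)
    have h3 := (Finset.sum_eq_zero_iff_of_nonneg (fun j _ => hnn i j)).1 h2 j (Finset.mem_univ j)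
    rcases mul_eq_zero.1 h3 with h4 | h4
    · exfalso
      have h5 : (σ i - σ j) ^ 2 = ∑ k, σ k ^ 2 := by rw [← hs]; linarith
      have h6 : Y ≤ s * τ := by
        rw [hY, hτ, Finset.mul_sum]
        refine Finset.sum_le_sum fun k _ => ?_
        rw [Finset.mul_sum]
        refine Finset.sum_le_sum fun l _ => ?_
        by_cases hkl : k = l
        · subst hkl; rw [hTdiag]; simp
        · rw [mul_comm]
          exact mul_le_mul_of_nonneg_right (add_sq_le_of_sub_sq_eq hσ h5 hkl) (hT0 k l)
      nlinarith
    · exact h4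
  have hTeq : ∀ i j, T i j = 2 * K i j := by
    intro i j
    have h1 : ∑ i, ∑ j, (2 * K i j - T i j) = 0 := by
      simp_rw [Finset.sum_sub_distrib, ← Finset.mul_sum]
      linarith
    have hnn : ∀ i j, 0 ≤ 2 * K i j - T i j := fun i j => by linarith [hTK i j]
    have h2 := (Finset.sum_eq_zero_iff_of_nonneg (fun i _ => Finset.sum_nonneg
      fun j _ => hnn i j)).1 h1 i (Finset.mem_univ i)
    have h3 := (Finset.sum_eq_zero_iff_of_nonneg (fun j _ => hnn i j)).1 h2 j (Finset.mem_univ j)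
    linarith
  have hRterm : ∀ i j, (τ / 2 + 1 - ((∑ k, T i k) + ∑ k, T j k)) * (T i j * (σ i + σ j) ^ 2) = 0 := by
    intro i j
    have h2 := (Finset.sum_eq_zero_iff_of_nonneg (fun i _ => Finset.sum_nonneg
      fun j _ => hterm i j)).1 eR i (Finset.mem_univ i)
    exact (Finset.sum_eq_zero_iff_of_nonneg (fun j _ => hterm i j)).1 h2 j (Finset.mem_univ j)
  intro t
  have hsk : ∀ i j, b t i j = -b t j i := by
    intro i j
    have := (Finset.sum_eq_zero_iff_of_nonneg (fun s _ => sq_nonneg (symmEntry (b s) i j))).1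
      (hStermwise i j) t (Finset.mem_univ t)
    have := pow_eq_zero_iff (two_ne_zero) |>.1 this
    simp only [symmEntry] at this
    linarith
  refine ⟨hsk, fun i j k l hij hkl hik hil hjk hjl => ?_⟩
  by_contra hne
  have hKpos : ∀ i j, b t i j ≠ 0 → 0 < K i j := by
    intro i j h
    refine Finset.sum_pos' (fun s _ => sq_nonneg _) ⟨t, Finset.mem_univ t, ?_⟩
    have : skewEntry (b t) i j = b t i j := by
      simp only [skewEntry]; linarith [hsk i j]
    rw [this]; positivity
  have hij0 := hKpos i j (left_ne_zero_of_mul hne)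
  have hkl0 := hKpos k l (right_ne_zero_of_mul hne)
  have hTij := hTeq i j
  have hTkl := hTeq k l
  have hσij : σ i + σ j ≠ 0 := by
    intro h
    simp only [T, h, if_true] at hTij
    linarith
  rcases mul_eq_zero.1 (hRterm i j) with h | h
  · have := two_mul_degree_add_degree_le hTsymm hT0 hTdiag hij k l hik.symm hjk.symm hil.symm
      hjl.symm
    linarith [hT1 i j]
  · rcases mul_eq_zero.1 h with h | h
    · linarith
    · exact hσij (pow_eq_zero_iff (two_ne_zero) |>.1 h)

end Family

/-! ### Orthonormal pairs of vectors and the extremal configuration -/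

section Pairs

open Matrix

/-- Two orthonormal vectors. -/
structure OrthoPair {ι : Type*} [Fintype ι] (x y : ι → ℝ) : Prop where
  left : x ⬝ᵥ x = 1
  right : y ⬝ᵥ y = 1
  ortho : x ⬝ᵥ y = 0

variable {d : ℕ}

lemma mulVec_dotProduct_mulVec {U : Matrix (Fin d) (Fin d) ℝ} (hU : Uᵀ * U = 1)
    (x y : Fin d → ℝ) : (U *ᵥ x) ⬝ᵥ (U *ᵥ y) = x ⬝ᵥ y := by
  rw [Matrix.dotProduct_mulVec, ← Matrix.mulVec_transpose, Matrix.mulVec_mulVec, hU,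
    Matrix.one_mulVec]

lemma mul_vecMulVec_mul_transpose (U V : Matrix (Fin d) (Fin d) ℝ) (x y : Fin d → ℝ) :
    U * vecMulVec x y * Vᵀ = vecMulVec (U *ᵥ x) (V *ᵥ y) := by
  rw [Matrix.mul_vecMulVec, Matrix.vecMulVec_mul, Matrix.vecMul_transpose]

lemma OrthoPair.nontrivial {x y : Fin d → ℝ} (h : OrthoPair x y) : ∃ i j : Fin d, i ≠ j := by
  by_contra hne
  push Not at hne
  rcases d with _ | d
  · have := h.left; simp at this
  · have hs : Subsingleton (Fin (d + 1)) := ⟨hne⟩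
    have h1 := h.left
    have h2 := h.right
    have h3 := h.ortho
    simp only [dotProduct, Fintype.sum_subsingleton _ (0 : Fin (d + 1))] at h1 h2 h3
    rcases mul_eq_zero.1 h3 with h4 | h4 <;> simp [h4] at h1 h2

/-- An orthonormal pair forms two columns of an orthogonal matrix. -/
lemma OrthoPair.exists_orthogonal {x y : Fin d → ℝ} (h : OrthoPair x y) {i j : Fin d}
    (hij : i ≠ j) : ∃ U : Matrix (Fin d) (Fin d) ℝ, Uᵀ * U = 1 ∧ (∀ k, U k i = x k) ∧
      ∀ k, U k j = y k := by
  obtain ⟨U, hU, hUw⟩ := exists_orthogonal_extension {i, j} (fun k => if k = i then x else y) (by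
    have h1 := h.left
    have h2 := h.right
    have h3 := h.ortho
    have h4 := h3
    rw [dotProduct_comm] at h4
    simp only [dotProduct] at h1 h2 h3 h4
    rintro a (rfl | rfl) b (rfl | rfl) <;> simp [hij, Ne.symm hij, h1, h2, h3, h4])
  refine ⟨U, hU, fun k => ?_, fun k => ?_⟩
  · rw [hUw i (by simp) k]; simp
  · rw [hUw j (by simp) k]; simp [Ne.symm hij]

lemma sum_pair_le_sum_sum {ι : Type*} [Fintype ι] {g : ι → ι → ℝ} (hg : ∀ i j, 0 ≤ g i j)
    {i₀ i₁ : ι} (h01 : i₀ ≠ i₁) (i j : ι) (h1 : (i, j) ≠ (i₀, i₁)) (h2 : (i, j) ≠ (i₁, i₀)) :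
    g i₀ i₁ + g i₁ i₀ + g i j ≤ ∑ i, ∑ j, g i j := by
  classical
  rw [← Fintype.sum_prod_type']
  have hne : ((i₀, i₁) : ι × ι) ≠ (i₁, i₀) := fun h => h01 (congrArg Prod.fst h)
  have h : ∑ p ∈ ({(i₀, i₁), (i₁, i₀), (i, j)} : Finset (ι × ι)), g p.1 p.2 =
      g i₀ i₁ + g i₁ i₀ + g i j := by
    rw [Finset.sum_insert (by simp [hne, h1.symm]), Finset.sum_pair h2.symm]
    ring
  rw [← h]
  exact Finset.sum_le_sum_of_subset_of_nonneg (Finset.subset_univ _) fun p _ _ => hg _ _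

variable {κ : Type*} [Fintype κ] [DecidableEq κ]

lemma conj_transpose_conj {U V : Matrix (Fin d) (Fin d) ℝ} (hU : Uᵀ * U = 1) (hV : Vᵀ * V = 1)
    (b : Matrix (Fin d) (Fin d) ℝ) : U * (Uᵀ * b * V) * Vᵀ = b := by
  have hU' := mul_eq_one_comm.1 hU
  have hV' := mul_eq_one_comm.1 hV
  calc U * (Uᵀ * b * V) * Vᵀ = (U * Uᵀ) * b * (V * Vᵀ) := by simp only [Matrix.mul_assoc]
    _ = b := by rw [hU', hV', Matrix.one_mul, Matrix.mul_one]

lemma frobInner_transpose_conj {U V : Matrix (Fin d) (Fin d) ℝ} (hU : Uᵀ * U = 1)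
    (hV : Vᵀ * V = 1) (b c : Matrix (Fin d) (Fin d) ℝ) :
    frobInner (Uᵀ * b * V) (Uᵀ * c * V) = frobInner b c := by
  rw [← frobInner_conj hU hV (Uᵀ * b * V), conj_transpose_conj hU hV, conj_transpose_conj hU hV]

/-- The bound for the commutators of a fixed matrix with an orthonormal family; in the equality
case every member of the family has rank two with equal singular values. -/
lemma sum_crossSq_le (a : Matrix (Fin d) (Fin d) ℝ) {b : κ → Matrix (Fin d) (Fin d) ℝ}
    (hb : ∀ s t, frobInner (b s) (b t) = if s = t then 1 else 0) :
    ∑ s, crossSq a (b s) ≤ 2 * (Fintype.card κ + 1) * frobSq a ∧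
    (a ≠ 0 → ∑ s, crossSq a (b s) = 2 * (Fintype.card κ + 1) * frobSq a →
      ∀ s, ∃ (t : ℝ) (u₁ u₂ v₁ v₂ : Fin d → ℝ), OrthoPair u₁ u₂ ∧ OrthoPair v₁ v₂ ∧
        b s = t • (vecMulVec u₁ v₁ + vecMulVec u₂ v₂)) := by
  obtain ⟨U, V, σ, hU, hV, hσ, ha⟩ := exists_svd a
  let b' : κ → Matrix (Fin d) (Fin d) ℝ := fun s => Uᵀ * b s * V
  have hb' : ∀ s, b s = U * b' s * Vᵀ := fun s => (conj_transpose_conj hU hV _).symm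
  have hon : ∀ s t, frobInner (b' s) (b' t) = if s = t then 1 else 0 := fun s t => by
    rw [frobInner_transpose_conj hU hV, hb]
  have hcross : ∀ s, crossSq a (b s) = crossSq (Matrix.diagonal σ) (b' s) := fun s => by
    rw [ha, hb' s, crossSq_conj hU hV]
  have hfrob : frobSq a = ∑ i, σ i ^ 2 := by rw [ha, frobSq_conj hU hV, frobSq_diagonal]
  simp_rw [hcross, hfrob]
  have hmain := sum_crossSq_diagonal_le hσ hon
  refine ⟨hmain.1, fun hane heq s => ?_⟩
  have hpos : 0 < ∑ i, σ i ^ 2 := by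
    rw [← hfrob]
    exact lt_of_le_of_ne (frobSq_nonneg a) fun h => hane (frobSq_eq_zero.1 h.symm)
  obtain ⟨hsk, hdisj⟩ := hmain.2 hpos heq s
  have hbne : b' s ≠ 0 := by
    intro h
    have := hon s s
    rw [h] at this
    simp [frobInner] at this
  obtain ⟨c, x, y, hx, hy, hxy, hxyb⟩ := exists_wedge_of_skew hsk hbne hdisj
  have hxx : x ⬝ᵥ x = 1 := by rw [← hx]; simp [dotProduct, sq]
  have hyy : y ⬝ᵥ y = 1 := by rw [← hy]; simp [dotProduct, sq]
  have hxy' : x ⬝ᵥ y = 0 := hxy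
  refine ⟨c, U *ᵥ x, -(U *ᵥ y), V *ᵥ y, V *ᵥ x, ⟨?_, ?_, ?_⟩, ⟨?_, ?_, ?_⟩, ?_⟩
  · rw [mulVec_dotProduct_mulVec hU, hxx]
  · rw [neg_dotProduct_neg, mulVec_dotProduct_mulVec hU, hyy]
  · rw [dotProduct_neg, mulVec_dotProduct_mulVec hU, hxy', neg_zero]
  · rw [mulVec_dotProduct_mulVec hV, hyy]
  · rw [mulVec_dotProduct_mulVec hV, hxx]
  · rw [mulVec_dotProduct_mulVec hV, dotProduct_comm, hxy']
  · have h1 : b' s = c • (vecMulVec x y - vecMulVec y x) := by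
      ext i j
      rw [hxyb]; simp [vecMulVec_apply]
    rw [hb' s, h1, Matrix.mul_smul, Matrix.smul_mul, Matrix.mul_sub, Matrix.sub_mul,
      mul_vecMulVec_mul_transpose, mul_vecMulVec_mul_transpose, Matrix.neg_vecMulVec,
      sub_eq_add_neg]

/-- If the fixed matrix has rank two with equal singular values, the extremal family has only one
member, which is determined up to a factor. -/
lemma eq_of_sum_crossSq_eq {t : ℝ} (ht : t ≠ 0) {u₁ u₂ v₁ v₂ : Fin d → ℝ} (hu : OrthoPair u₁ u₂)
    (hv : OrthoPair v₁ v₂) {b : κ → Matrix (Fin d) (Fin d) ℝ}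
    (hb : ∀ s t, frobInner (b s) (b t) = if s = t then 1 else 0) (s₀ : κ)
    (heq : ∑ s, crossSq (t • (vecMulVec u₁ v₁ + vecMulVec u₂ v₂)) (b s) =
      2 * (Fintype.card κ + 1) * frobSq (t • (vecMulVec u₁ v₁ + vecMulVec u₂ v₂))) :
    Fintype.card κ = 1 ∧ ∃ c : ℝ, b s₀ = c • (vecMulVec u₁ v₂ - vecMulVec u₂ v₁) := by
  obtain ⟨i₀, i₁, h01⟩ := hu.nontrivial
  obtain ⟨U, hU, hU0, hU1⟩ := hu.exists_orthogonal h01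
  obtain ⟨V, hV, hV0, hV1⟩ := hv.exists_orthogonal h01
  let σ : Fin d → ℝ := fun i => (if i = i₀ then t else 0) + (if i = i₁ then t else 0)
  have h10 : i₁ ≠ i₀ := h01.symm
  have hσ0 : σ i₀ = t := by simp [σ, h01]
  have hσ1 : σ i₁ = t := by simp [σ, h10]
  have hσ : ∀ i, i ≠ i₀ → i ≠ i₁ → σ i = 0 := fun i h h' => by simp [σ, h, h']
  have ha : t • (vecMulVec u₁ v₁ + vecMulVec u₂ v₂) = U * Matrix.diagonal σ * Vᵀ := by
    ext k l
    rw [Matrix.mul_apply]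
    simp only [Matrix.mul_diagonal, Matrix.transpose_apply, σ, mul_add, add_mul,
      Finset.sum_add_distrib, mul_ite, ite_mul, mul_zero, zero_mul, Finset.sum_ite_eq',
      Finset.mem_univ, if_true, hU0, hU1, hV0, hV1, Matrix.smul_apply, Matrix.add_apply,
      vecMulVec_apply, smul_eq_mul]
    ring
  let b' : κ → Matrix (Fin d) (Fin d) ℝ := fun s => Uᵀ * b s * V
  have hb' : ∀ s, b s = U * b' s * Vᵀ := fun s => (conj_transpose_conj hU hV _).symm
  have hon : ∀ s t, frobInner (b' s) (b' t) = if s = t then 1 else 0 := fun s t => by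
    rw [frobInner_transpose_conj hU hV, hb]
  have hsum : ∑ i, σ i ^ 2 = 2 * t ^ 2 := by
    rw [← Finset.sum_subset (Finset.subset_univ {i₀, i₁}), Finset.sum_pair h01, hσ0, hσ1]
    · ring
    · intro i _ hi
      simp only [Finset.mem_insert, Finset.mem_singleton, not_or] at hi
      rw [hσ i hi.1 hi.2]; ring
  rw [ha, frobSq_conj hU hV, frobSq_diagonal, hsum] at heq
  simp_rw [hb', crossSq_conj hU hV] at heq
  rw [sum_crossSq_diagonal] at heq
  have hcard := sum_symm_add_skew_of_orthonormal hon
  let S : Fin d → Fin d → ℝ := fun i j => ∑ s, symmEntry (b' s) i j ^ 2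
  let K : Fin d → Fin d → ℝ := fun i j => ∑ s, skewEntry (b' s) i j ^ 2
  have hS0 : ∀ i j, 0 ≤ S i j := fun i j => Finset.sum_nonneg fun s _ => sq_nonneg _
  have hK0 : ∀ i j, 0 ≤ K i j := fun i j => Finset.sum_nonneg fun s _ => sq_nonneg _
  have hK1 : ∀ i j, K i j ≤ 1 / 2 := sum_skewEntry_sq_le hon
  have hKdiag : ∀ i, K i i = 0 := by intro i; simp [K, skewEntry]
  have hKsymm : ∀ i j, K i j = K j i := by
    intro i j
    refine Finset.sum_congr rfl fun s _ => ?_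
    simp only [skewEntry]; ring
  change (∑ i, ∑ j, S i j) + (∑ i, ∑ j, K i j) = _ at hcard
  change 2 * (∑ i, ∑ j, (σ i - σ j) ^ 2 * S i j) + 2 * (∑ i, ∑ j, (σ i + σ j) ^ 2 * K i j) = _
    at heq
  have ht2 : 0 < t ^ 2 := by positivity
  have hσ01 : ∀ i, σ i = t ∧ (i = i₀ ∨ i = i₁) ∨ σ i = 0 := by
    intro i
    by_cases h : i = i₀
    · subst h; exact Or.inl ⟨hσ0, Or.inl rfl⟩
    by_cases h' : i = i₁
    · subst h'; exact Or.inl ⟨hσ1, Or.inr rfl⟩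
    exact Or.inr (hσ i h h')
  have hSle : ∑ i, ∑ j, (σ i - σ j) ^ 2 * S i j ≤ t ^ 2 * ∑ i, ∑ j, S i j := by
    simp_rw [Finset.mul_sum]
    refine Finset.sum_le_sum fun i _ => Finset.sum_le_sum fun j _ =>
      mul_le_mul_of_nonneg_right ?_ (hS0 i j)
    rcases hσ01 i with ⟨h, _⟩ | h <;> rcases hσ01 j with ⟨h', _⟩ | h' <;> rw [h, h'] <;>
      nlinarith
  have hKle : ∑ i, ∑ j, (σ i + σ j) ^ 2 * K i j ≤ t ^ 2 * (∑ i, ∑ j, K i j) + 6 * t ^ 2 * K i₀ i₁ := by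
    have h1 : ∀ i j, (σ i + σ j) ^ 2 * K i j ≤ t ^ 2 * K i j +
        ((if i = i₀ then (if j = i₁ then 3 * t ^ 2 * K i j else 0) else 0) +
        (if i = i₁ then (if j = i₀ then 3 * t ^ 2 * K i j else 0) else 0)) := by
      intro i j
      have hKij := hK0 i j
      have hnn : 0 ≤ t ^ 2 * K i j := by positivity
      by_cases hij : i = j
      · subst hij
        rw [hKdiag]; simp
      rcases hσ01 i with ⟨h, hi⟩ | h
      · rcases hσ01 j with ⟨h', hj⟩ | h'
        · rw [h, h']
          rcases hi with rfl | rfl <;> rcases hj with rfl | rfl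
          · exact absurd rfl hij
          · simp [h01]; nlinarith
          · simp [h10]; nlinarith
          · exact absurd rfl hij
        · rw [h, h', add_zero]
          exact le_add_of_nonneg_right (by positivity)
      · rw [h, zero_add]
        have : σ j ^ 2 ≤ t ^ 2 := by
          rcases hσ01 j with ⟨h', _⟩ | h' <;> rw [h'] ; nlinarith
        exact le_add_of_le_of_nonneg (mul_le_mul_of_nonneg_right this hKij) (by positivity)
    refine (Finset.sum_le_sum fun i _ => Finset.sum_le_sum fun j _ => h1 i j).trans (le_of_eq ?_)
    simp_rw [Finset.sum_add_distrib, Finset.mul_sum]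
    congr 1
    have hsingle : ∀ p q, (∑ i, ∑ j, if i = p then (if j = q then 3 * t ^ 2 * K i j else 0) else 0)
        = 3 * t ^ 2 * K p q := by
      intro p q
      rw [Finset.sum_eq_single p (fun i _ hi => by simp [hi]) (by simp)]
      simp
    rw [hsingle, hsingle, hKsymm i₁ i₀]; ring
  have hk1 : 1 ≤ Fintype.card κ := Fintype.card_pos_iff.2 ⟨s₀⟩
  have hk1' : (1 : ℝ) ≤ Fintype.card κ := by exact_mod_cast hk1
  have hbound : 2 * ((Fintype.card κ : ℝ) + 1) ≤ Fintype.card κ + 6 * K i₀ i₁ := by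
    have : t ^ 2 * (2 * ((Fintype.card κ : ℝ) + 1)) ≤ t ^ 2 * (Fintype.card κ + 6 * K i₀ i₁) := by
      rw [← hcard] at heq ⊢
      nlinarith
    exact le_of_mul_le_mul_left this ht2
  have hcard1 : Fintype.card κ = 1 := by
    have : (Fintype.card κ : ℝ) ≤ 1 := by linarith [hK1 i₀ i₁]
    exact le_antisymm (by exact_mod_cast this) hk1
  refine ⟨hcard1, ?_⟩
  have hK01 : K i₀ i₁ = 1 / 2 := by
    refine le_antisymm (hK1 _ _) ?_
    rw [hcard1] at hbound
    push_cast at hbound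
    linarith
  have huniq : ∀ s, s = s₀ := fun s => by
    have := Fintype.card_le_one_iff_subsingleton.1 hcard1.le
    exact Subsingleton.elim _ _
  have hKs : ∀ i j, K i j = skewEntry (b' s₀) i j ^ 2 := fun i j => by
    simp only [K]
    rw [Finset.sum_eq_single s₀ (fun s _ hs => absurd (huniq s) hs) (by simp)]
  let g : Fin d → Fin d → ℝ := fun i j => symmEntry (b' s₀) i j ^ 2 + skewEntry (b' s₀) i j ^ 2
  have hg0 : ∀ i j, 0 ≤ g i j := fun i j => add_nonneg (sq_nonneg _) (sq_nonneg _)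
  have hgsum : ∑ i, ∑ j, g i j = 1 := by
    rw [← frobSq_eq_symm_add_skew, ← frobInner_self, hon]; simp
  have hk01 : skewEntry (b' s₀) i₀ i₁ ^ 2 = 1 / 2 := by rw [← hKs, hK01]
  have hk10 : skewEntry (b' s₀) i₁ i₀ ^ 2 = 1 / 2 := by rw [← hKs, hKsymm, hK01]
  have hs01 : symmEntry (b' s₀) i₀ i₁ = 0 := by
    have h := sum_pair_le_sum_sum hg0 h01 i₀ i₀ (by simp [h01]) (by simp [h01])
    have h2 := hg0 i₀ i₀
    rw [hgsum] at h
    simp only [g, hk01, hk10] at h h2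
    have : symmEntry (b' s₀) i₀ i₁ ^ 2 = 0 :=
      le_antisymm (by nlinarith [sq_nonneg (symmEntry (b' s₀) i₁ i₀)]) (sq_nonneg _)
    exact pow_eq_zero_iff (two_ne_zero) |>.1 this
  have hother : ∀ i j, (i, j) ≠ (i₀, i₁) → (i, j) ≠ (i₁, i₀) → b' s₀ i j = 0 := by
    intro i j h1 h2
    have h := sum_pair_le_sum_sum hg0 h01 i j h1 h2
    rw [hgsum] at h
    simp only [g, hk01, hk10] at h
    have e1 : symmEntry (b' s₀) i j ^ 2 = 0 := le_antisymm (by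
      nlinarith [sq_nonneg (symmEntry (b' s₀) i₁ i₀), sq_nonneg (symmEntry (b' s₀) i₀ i₁),
        sq_nonneg (skewEntry (b' s₀) i j)]) (sq_nonneg _)
    have e2 : skewEntry (b' s₀) i j ^ 2 = 0 := le_antisymm (by
      nlinarith [sq_nonneg (symmEntry (b' s₀) i₁ i₀), sq_nonneg (symmEntry (b' s₀) i₀ i₁),
        sq_nonneg (symmEntry (b' s₀) i j)]) (sq_nonneg _)
    have e1' := pow_eq_zero_iff (two_ne_zero) |>.1 e1
    have e2' := pow_eq_zero_iff (two_ne_zero) |>.1 e2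
    simp only [symmEntry, skewEntry] at e1' e2'
    linarith
  refine ⟨b' s₀ i₀ i₁, ?_⟩
  have h10' : b' s₀ i₁ i₀ = -b' s₀ i₀ i₁ := by
    simp only [symmEntry] at hs01; linarith
  have hbs : b' s₀ = b' s₀ i₀ i₁ • (vecMulVec (Pi.single i₀ 1) (Pi.single i₁ 1) -
      vecMulVec (Pi.single i₁ 1) (Pi.single i₀ 1)) := by
    ext i j
    simp only [Matrix.smul_apply, Matrix.sub_apply, vecMulVec_apply, smul_eq_mul]
    by_cases h1 : (i, j) = (i₀, i₁)
    · simp only [Prod.mk.injEq] at h1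
      obtain ⟨rfl, rfl⟩ := h1
      simp [h01]
    by_cases h2 : (i, j) = (i₁, i₀)
    · simp only [Prod.mk.injEq] at h2
      obtain ⟨rfl, rfl⟩ := h2
      simp [h01, h10']
    rw [hother i j h1 h2]
    simp only [Prod.mk.injEq, not_and] at h1 h2
    by_cases hi : i = i₀
    · subst hi
      simp [h1 rfl, h01]
    · by_cases hi' : i = i₁
      · subst hi'
        simp [h2 rfl, hi]
      · simp [hi, hi']
  have hUe : U *ᵥ Pi.single i₀ 1 = u₁ ∧ U *ᵥ Pi.single i₁ 1 = u₂ ∧ V *ᵥ Pi.single i₀ 1 = v₁ ∧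
      V *ᵥ Pi.single i₁ 1 = v₂ := by
    refine ⟨?_, ?_, ?_, ?_⟩ <;> ext k <;> simp [hU0, hU1, hV0, hV1]
  rw [hb' s₀]
  nth_rewrite 1 [hbs]
  rw [Matrix.mul_smul, Matrix.smul_mul, Matrix.mul_sub, Matrix.sub_mul,
    mul_vecMulVec_mul_transpose, mul_vecMulVec_mul_transpose, hUe.1, hUe.2.1, hUe.2.2.1,
    hUe.2.2.2]

end Pairs

/-! ### The commutator inequality for orthogonal families -/

section OrthogonalFamily

open Matrix

variable {d m : ℕ} {a : Fin m → Matrix (Fin d) (Fin d) ℝ}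

lemma frobSq_pos {A : Matrix (Fin d) (Fin d) ℝ} (h : A ≠ 0) : 0 < frobSq A :=
  lt_of_le_of_ne (frobSq_nonneg A) fun h' => h (frobSq_eq_zero.1 h'.symm)

/-- The normalised members of an orthogonal family. -/
noncomputable def normalizedFamily (a : Fin m → Matrix (Fin d) (Fin d) ℝ) (P : Finset (Fin m))
    (s : P) : Matrix (Fin d) (Fin d) ℝ := (√(frobSq (a s)))⁻¹ • a s

lemma normalizedFamily_orthonormal (horth : ∀ r s, r ≠ s → frobInner (a r) (a s) = 0)
    {P : Finset (Fin m)} (hP : ∀ s ∈ P, a s ≠ 0) (s t : P) :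
    frobInner (normalizedFamily a P s) (normalizedFamily a P t) = if s = t then 1 else 0 := by
  unfold normalizedFamily
  rw [frobInner_smul_left, frobInner_smul_right]
  split_ifs with h
  · subst h
    have hpos := frobSq_pos (hP s s.2)
    rw [frobInner_self, ← mul_assoc, ← mul_inv, Real.mul_self_sqrt hpos.le,
      inv_mul_cancel₀ hpos.ne']
  · rw [horth _ _ fun h' => h (Subtype.ext h')]; ring

lemma sum_crossSq_normalizedFamily (A : Matrix (Fin d) (Fin d) ℝ) (P : Finset (Fin m)) :
    ∑ s, crossSq A (normalizedFamily a P s) = ∑ s ∈ P, crossSq A (a s) / frobSq (a s) := by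
  rw [← Finset.sum_coe_sort P]
  refine Finset.sum_congr rfl fun s _ => ?_
  have := crossSq_smul_smul 1 (√(frobSq (a s)))⁻¹ A (a s)
  rw [one_smul] at this
  rw [normalizedFamily, this, inv_pow, Real.sq_sqrt (frobSq_nonneg _)]
  ring

/-- The excess of the normalised commutator of two members over its average value. -/
noncomputable def crossExcess (a : Fin m → Matrix (Fin d) (Fin d) ℝ) (r s : Fin m) : ℝ :=
  max (crossSq (a r) (a s) / (frobSq (a r) * frobSq (a s)) - 2) 0

lemma crossExcess_nonneg (r s : Fin m) : 0 ≤ crossExcess a r s := le_max_right _ _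

lemma crossSq_comm (A B : Matrix (Fin d) (Fin d) ℝ) : crossSq A B = crossSq B A := by
  have h : ∀ X Y : Matrix (Fin d) (Fin d) ℝ, frobSq (X - Y) = frobSq (Y - X) := by
    intro X Y
    refine Finset.sum_congr rfl fun i _ => Finset.sum_congr rfl fun j _ => ?_
    simp only [Matrix.sub_apply]
    ring
  unfold crossSq
  rw [h, h (A.transpose * B)]

lemma crossExcess_comm (r s : Fin m) : crossExcess a r s = crossExcess a s r := by
  unfold crossExcess
  rw [crossSq_comm, mul_comm (frobSq _)]

lemma sum_crossExcess_le (horth : ∀ r s, r ≠ s → frobInner (a r) (a s) = 0) (r : Fin m) :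
    ∑ s, crossExcess a r s ≤ 2 := by
  classical
  let Q : Fin m → ℝ := fun s => crossSq (a r) (a s) / (frobSq (a r) * frobSq (a s))
  let P : Finset (Fin m) := Finset.univ.filter fun s => 2 < Q s
  have hne : ∀ s ∈ P, a r ≠ 0 ∧ a s ≠ 0 := by
    intro s hs
    have h : 2 < Q s := (Finset.mem_filter.1 hs).2
    constructor <;> intro h0 <;> simp [Q, h0, frobSq] at h <;> linarith
  have hsum : ∑ s, crossExcess a r s = ∑ s ∈ P, (Q s - 2) := by
    rw [Finset.sum_filter]
    refine Finset.sum_congr rfl fun s _ => ?_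
    change max (Q s - 2) 0 = _
    split_ifs with h
    · exact max_eq_left (by linarith)
    · exact max_eq_right (by linarith)
  rw [hsum]
  by_cases hr : a r = 0
  · have : P = ∅ := Finset.eq_empty_of_forall_notMem fun s hs => (hne s hs).1 hr
    rw [this]; simp
  have h := (sum_crossSq_le (a r) (normalizedFamily_orthonormal horth fun s hs => (hne s hs).2)).1
  rw [sum_crossSq_normalizedFamily, Fintype.card_coe] at h
  have hpos := frobSq_pos hr
  have h2 : ∑ s ∈ P, crossSq (a r) (a s) / frobSq (a s) = (∑ s ∈ P, Q s) * frobSq (a r) := by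
    rw [Finset.sum_mul]
    refine Finset.sum_congr rfl fun s hs => ?_
    have := frobSq_pos (hne s hs).2
    simp only [Q]
    field_simp
  rw [h2] at h
  have h3 := le_of_mul_le_mul_right h hpos
  rw [Finset.sum_sub_distrib, Finset.sum_const, nsmul_eq_mul]
  linarith

lemma crossSq_eq_zero_of_left {A B : Matrix (Fin d) (Fin d) ℝ} (h : A = 0) : crossSq A B = 0 := by
  subst h; simp [crossSq, frobSq]

lemma crossSq_le_crossExcess (r s : Fin m) :
    crossSq (a r) (a s) ≤ (2 + crossExcess a r s) * (frobSq (a r) * frobSq (a s)) := by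
  by_cases hr : a r = 0
  · rw [crossSq_eq_zero_of_left hr, hr]; simp [frobSq]
  by_cases hs : a s = 0
  · rw [crossSq_comm, crossSq_eq_zero_of_left hs, hs]; simp [frobSq]
  have h1 := mul_pos (frobSq_pos hr) (frobSq_pos hs)
  have h2 : crossSq (a r) (a s) / (frobSq (a r) * frobSq (a s)) - 2 ≤ crossExcess a r s :=
    le_max_left _ _
  rw [← div_le_iff₀ h1]
  linarith

/-- The total excess, weighted by the squared norms. -/
lemma sum_crossExcess_mul_add (a : Fin m → Matrix (Fin d) (Fin d) ℝ) :
    (∑ r, ∑ s, crossExcess a r s * (frobSq (a r) * frobSq (a s))) +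
      (∑ r, ∑ s, crossExcess a r s * (frobSq (a r) - frobSq (a s)) ^ 2) / 2 =
      ∑ r, frobSq (a r) ^ 2 * ∑ s, crossExcess a r s := by
  have h1 : ∑ r, ∑ s, crossExcess a r s * frobSq (a s) ^ 2 =
      ∑ r, ∑ s, crossExcess a r s * frobSq (a r) ^ 2 := by
    rw [Finset.sum_comm]
    refine Finset.sum_congr rfl fun r _ => Finset.sum_congr rfl fun s _ => ?_
    rw [crossExcess_comm]
  have h2 : ∑ r, frobSq (a r) ^ 2 * ∑ s, crossExcess a r s =
      ∑ r, ∑ s, crossExcess a r s * frobSq (a r) ^ 2 := by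
    refine Finset.sum_congr rfl fun r _ => ?_
    rw [Finset.mul_sum]
    exact Finset.sum_congr rfl fun s _ => mul_comm _ _
  have h3 : ∑ r, ∑ s, crossExcess a r s * (frobSq (a r) - frobSq (a s)) ^ 2 =
      (∑ r, ∑ s, crossExcess a r s * frobSq (a r) ^ 2) +
      (∑ r, ∑ s, crossExcess a r s * frobSq (a s) ^ 2) -
      2 * ∑ r, ∑ s, crossExcess a r s * (frobSq (a r) * frobSq (a s)) := by
    simp_rw [Finset.mul_sum, ← Finset.sum_add_distrib, ← Finset.sum_sub_distrib]
    refine Finset.sum_congr rfl fun r _ => Finset.sum_congr rfl fun s _ => ?_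
    ring
  rw [h3, h1, h2]
  ring

/-- A family consisting of at most two nonzero matrices `t (u₁ v₁ᵀ + u₂ v₂ᵀ)` and
`c (u₁ v₂ᵀ - u₂ v₁ᵀ)`, with `c² = t²`. -/
def IsExtremalFamily (a : Fin m → Matrix (Fin d) (Fin d) ℝ) : Prop :=
  (∀ r, a r = 0) ∨ ∃ (r₀ s₀ : Fin m) (t c : ℝ) (u₁ u₂ v₁ v₂ : Fin d → ℝ), r₀ ≠ s₀ ∧ t ≠ 0 ∧
    c ^ 2 = t ^ 2 ∧ OrthoPair u₁ u₂ ∧ OrthoPair v₁ v₂ ∧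
    a r₀ = t • (vecMulVec u₁ v₁ + vecMulVec u₂ v₂) ∧
    a s₀ = c • (vecMulVec u₁ v₂ - vecMulVec u₂ v₁) ∧ ∀ r, r ≠ r₀ → r ≠ s₀ → a r = 0

lemma frobSq_vecMulVec_add {u₁ u₂ v₁ v₂ : Fin d → ℝ} (hu : OrthoPair u₁ u₂)
    (hv : OrthoPair v₁ v₂) : frobSq (vecMulVec u₁ v₁ + vecMulVec u₂ v₂) = 2 := by
  have h : ∀ i j, (vecMulVec u₁ v₁ + vecMulVec u₂ v₂) i j ^ 2 =
      (u₁ i * u₁ i) * (v₁ j * v₁ j) + 2 * ((u₁ i * u₂ i) * (v₁ j * v₂ j)) +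
        (u₂ i * u₂ i) * (v₂ j * v₂ j) := by
    intro i j
    simp only [Matrix.add_apply, vecMulVec_apply]; ring
  simp only [frobSq, h, Finset.sum_add_distrib, ← Finset.mul_sum, ← Finset.sum_mul]
  have h1 := hu.left
  have h2 := hu.right
  have h3 := hu.ortho
  have h4 := hv.left
  have h5 := hv.right
  simp only [dotProduct] at h1 h2 h3 h4 h5
  rw [h1, h2, h3, h4, h5]; norm_num

lemma OrthoPair.symm {x y : Fin d → ℝ} (h : OrthoPair x y) : OrthoPair y x :=
  ⟨h.right, h.left, by rw [dotProduct_comm]; exact h.ortho⟩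

lemma OrthoPair.neg_right {x y : Fin d → ℝ} (h : OrthoPair x y) : OrthoPair x (-y) :=
  ⟨h.left, by rw [neg_dotProduct_neg]; exact h.right, by rw [dotProduct_neg, h.ortho, neg_zero]⟩

theorem sum_crossSq_le_of_orthogonal (horth : ∀ r s, r ≠ s → frobInner (a r) (a s) = 0) :
    ∑ r, ∑ s, crossSq (a r) (a s) ≤ 2 * (∑ r, frobSq (a r)) ^ 2 ∧
    (∑ r, ∑ s, crossSq (a r) (a s) = 2 * (∑ r, frobSq (a r)) ^ 2 → IsExtremalFamily a) := by
  classical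
  let x : Fin m → ℝ := fun r => frobSq (a r)
  let D : Fin m → Fin m → ℝ := crossExcess a
  have hx : ∀ r, 0 ≤ x r := fun r => frobSq_nonneg _
  have hD : ∀ r s, 0 ≤ D r s := crossExcess_nonneg
  let w : Fin m → Fin m → ℝ := fun r s =>
    ((if r = s then 0 else 2) + D r s) * (x r * x s) - crossSq (a r) (a s)
  have hw : ∀ r s, 0 ≤ w r s := by
    intro r s
    by_cases h : r = s
    · subst h
      simp only [w, crossSq_self, if_true]
      have := mul_nonneg (hD r r) (mul_nonneg (hx r) (hx r))
      linarith
    · simp only [w, h, if_false]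
      exact sub_nonneg.2 (crossSq_le_crossExcess r s)
  have hident : 2 * (∑ r, x r) ^ 2 - ∑ r, ∑ s, crossSq (a r) (a s) =
      (∑ r, ∑ s, w r s) + (∑ r, ∑ s, D r s * (x r - x s) ^ 2) / 2 +
        ∑ r, x r ^ 2 * (2 - ∑ s, D r s) := by
    have h1 : ∑ r, ∑ s, w r s = 2 * (∑ r, x r) ^ 2 - 2 * ∑ r, x r ^ 2 +
        (∑ r, ∑ s, D r s * (x r * x s)) - ∑ r, ∑ s, crossSq (a r) (a s) := by
      have h2 : ∀ r s, w r s = 2 * (x r * x s) - (if r = s then 2 * (x r * x s) else 0) +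
          D r s * (x r * x s) - crossSq (a r) (a s) := by
        intro r s
        simp only [w]
        split_ifs <;> ring
      simp_rw [h2, Finset.sum_sub_distrib, Finset.sum_add_distrib, Finset.sum_sub_distrib]
      simp only [Finset.sum_ite_eq, Finset.mem_univ, if_true, ← Finset.mul_sum]
      rw [sq, Finset.sum_mul_sum, Finset.sum_congr rfl fun r _ => (sq (x r)).symm]
      simp only [Finset.mul_sum]
    have h3 := sum_crossExcess_mul_add a
    have h4 : ∑ r, x r ^ 2 * (2 - ∑ s, D r s) =
        2 * (∑ r, x r ^ 2) - ∑ r, x r ^ 2 * ∑ s, D r s := by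
      simp_rw [mul_sub, Finset.sum_sub_distrib, ← Finset.sum_mul]
      ring
    rw [h1, h4]
    change (∑ r, ∑ s, D r s * (x r * x s)) + (∑ r, ∑ s, D r s * (x r - x s) ^ 2) / 2 =
      ∑ r, x r ^ 2 * ∑ s, D r s at h3
    linarith
  have n1 : 0 ≤ ∑ r, ∑ s, w r s := Finset.sum_nonneg fun r _ => Finset.sum_nonneg fun s _ => hw r s
  have n2 : 0 ≤ ∑ r, ∑ s, D r s * (x r - x s) ^ 2 := Finset.sum_nonneg fun r _ =>
    Finset.sum_nonneg fun s _ => mul_nonneg (hD r s) (sq_nonneg _)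
  have hn3 : ∀ r, 0 ≤ x r ^ 2 * (2 - ∑ s, D r s) := fun r =>
    mul_nonneg (sq_nonneg _) (by linarith [sum_crossExcess_le horth r])
  have n3 : 0 ≤ ∑ r, x r ^ 2 * (2 - ∑ s, D r s) := Finset.sum_nonneg fun r _ => hn3 r
  change _ ≤ 2 * (∑ r, x r) ^ 2 ∧ (_ = 2 * (∑ r, x r) ^ 2 → _)
  refine ⟨by linarith, fun heq => ?_⟩
  have e1 : ∑ r, ∑ s, w r s = 0 := by linarith
  have e3 : ∑ r, x r ^ 2 * (2 - ∑ s, D r s) = 0 := by linarith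
  have hw0 : ∀ r s, w r s = 0 := by
    intro r s
    have h2 := (Finset.sum_eq_zero_iff_of_nonneg (fun r _ => Finset.sum_nonneg
      fun s _ => hw r s)).1 e1 r (Finset.mem_univ r)
    exact (Finset.sum_eq_zero_iff_of_nonneg (fun s _ => hw r s)).1 h2 s (Finset.mem_univ s)
  have hD2 : ∀ r, a r ≠ 0 → ∑ s, D r s = 2 := by
    intro r hr
    have h := (Finset.sum_eq_zero_iff_of_nonneg (fun r _ => hn3 r)).1 e3 r (Finset.mem_univ r)
    rcases mul_eq_zero.1 h with h | h
    · exact absurd (pow_eq_zero_iff (two_ne_zero) |>.1 h) (frobSq_pos hr).ne'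
    · linarith
  let P : Fin m → Finset (Fin m) := fun r => Finset.univ.filter fun s => s ≠ r ∧ a s ≠ 0
  have hPmem : ∀ r s, s ∈ P r ↔ s ≠ r ∧ a s ≠ 0 := fun r s => by simp [P]
  have hPne : ∀ r, ∀ s ∈ P r, a s ≠ 0 := fun r s hs => ((hPmem r s).1 hs).2
  have hPsum : ∀ r, a r ≠ 0 → ∑ s, D r s = ∑ s ∈ P r, D r s := by
    intro r hr
    symm
    refine Finset.sum_subset (Finset.subset_univ _) fun s _ hs => ?_
    by_cases h : a s = 0
    · change max (crossSq (a r) (a s) / (frobSq (a r) * frobSq (a s)) - 2) 0 = 0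
      rw [h]; simp [frobSq]
    · have hsr : s = r := by
        by_contra h'
        exact hs ((hPmem r s).2 ⟨h', h⟩)
      subst hsr
      change max (crossSq (a s) (a s) / (frobSq (a s) * frobSq (a s)) - 2) 0 = 0
      rw [crossSq_self]; simp
  have hL : ∀ r, a r ≠ 0 → ∑ s, crossSq (a r) (normalizedFamily a (P r) s) =
      2 * (Fintype.card (P r) + 1) * frobSq (a r) := by
    intro r hr
    rw [sum_crossSq_normalizedFamily, Fintype.card_coe]
    have h1 : ∀ s ∈ P r, crossSq (a r) (a s) / frobSq (a s) = (2 + D r s) * x r := by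
      intro s hs
      obtain ⟨hsr, hs0⟩ := (hPmem r s).1 hs
      have h2 := hw0 r s
      simp only [w, Ne.symm hsr, if_false] at h2
      have h3 : frobSq (a s) ≠ 0 := (frobSq_pos hs0).ne'
      rw [div_eq_iff h3]
      change _ = (2 + D r s) * x r * x s
      linarith
    rw [Finset.sum_congr rfl h1, ← Finset.sum_mul, Finset.sum_add_distrib, ← hPsum r hr, hD2 r hr,
      Finset.sum_const, nsmul_eq_mul]
    ring
  by_cases hall : ∀ r, a r = 0
  · exact Or.inl hall
  right
  push Not at hall
  obtain ⟨r, hr⟩ := hall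
  have hPr : (P r).Nonempty := by
    rw [Finset.nonempty_iff_ne_empty]
    intro h
    have h1 := hD2 r hr
    rw [hPsum r hr, h] at h1
    simp at h1
  obtain ⟨s, hs⟩ := hPr
  obtain ⟨hsr, hs0⟩ := (hPmem r s).1 hs
  obtain ⟨t, u₁, u₂, v₁, v₂, hu, hv, hst⟩ := (sum_crossSq_le (a r)
    (normalizedFamily_orthonormal horth (hPne r))).2 hr (hL r hr) ⟨s, hs⟩
  have hunnorm : ∀ (P : Finset (Fin m)) (p : P), a p ≠ 0 →
      a p = √(frobSq (a p)) • normalizedFamily a P p := by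
    intro P p hp
    have : √(frobSq (a p)) ≠ 0 := (Real.sqrt_pos.2 (frobSq_pos hp)).ne'
    rw [normalizedFamily, smul_smul, mul_inv_cancel₀ this, one_smul]
  have has := hunnorm _ ⟨s, hs⟩ hs0
  simp only at has
  rw [hst, smul_smul] at has
  set t' := √(frobSq (a s)) * t with ht'
  have ht0 : t' ≠ 0 := by
    intro h
    rw [h, zero_smul] at has
    exact hs0 has
  have hrs : r ∈ P s := (hPmem s r).2 ⟨Ne.symm hsr, hr⟩
  have hLs := hL s hs0
  have hbase := eq_of_sum_crossSq_eq ht0 hu hv (normalizedFamily_orthonormal horth (hPne s))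
    ⟨r, hrs⟩ (by rw [← has]; exact hLs)
  obtain ⟨hcard, c, hc⟩ := hbase
  have har := hunnorm _ ⟨r, hrs⟩ hr
  simp only at har
  rw [hc, smul_smul] at har
  set c' := √(frobSq (a r)) * c with hc'
  have hzero : ∀ p, p ≠ s → p ≠ r → a p = 0 := by
    intro p hps hpr
    by_contra hp
    rw [Fintype.card_coe, Finset.card_eq_one] at hcard
    obtain ⟨q, hq⟩ := hcard
    have h1 : r ∈ ({q} : Finset _) := hq ▸ hrs
    have h2 : p ∈ ({q} : Finset _) := hq ▸ (hPmem s p).2 ⟨hps, hp⟩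
    rw [Finset.mem_singleton] at h1 h2
    exact hpr (h2.trans h1.symm)
  refine ⟨s, r, t', c', u₁, u₂, v₁, v₂, hsr, ht0, ?_, hu, hv, has, har, hzero⟩
  have hxs : x s = t' ^ 2 * 2 := by
    simp only [x]; rw [has, frobSq_smul, frobSq_vecMulVec_add hu hv]
  have hxr : x r = c' ^ 2 * 2 := by
    simp only [x]
    rw [har, frobSq_smul]
    have : vecMulVec u₁ v₂ - vecMulVec u₂ v₁ = vecMulVec u₁ v₂ + vecMulVec (-u₂) v₁ := by
      rw [Matrix.neg_vecMulVec, sub_eq_add_neg]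
    rw [this, frobSq_vecMulVec_add hu.neg_right hv.symm]
  have hDrs : D r s = 2 := by
    have h1 := hD2 r hr
    rwa [Finset.sum_eq_single s (fun p _ hps => ?_) (by simp)] at h1
    by_cases hpr : p = r
    · subst hpr
      change max (crossSq (a p) (a p) / (frobSq (a p) * frobSq (a p)) - 2) 0 = 0
      rw [crossSq_self]; simp
    · change max (crossSq (a r) (a p) / (frobSq (a r) * frobSq (a p)) - 2) 0 = 0
      rw [hzero p hps hpr]; simp [frobSq]
  have e2 : ∑ r, ∑ s, D r s * (x r - x s) ^ 2 = 0 := by linarith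
  have hd0 : ∀ r s, 0 ≤ D r s * (x r - x s) ^ 2 := fun r s => mul_nonneg (hD r s) (sq_nonneg _)
  have h2 := (Finset.sum_eq_zero_iff_of_nonneg (fun r _ => Finset.sum_nonneg
    fun s _ => hd0 r s)).1 e2 r (Finset.mem_univ r)
  have h3 := (Finset.sum_eq_zero_iff_of_nonneg (fun s _ => hd0 r s)).1 h2 s (Finset.mem_univ s)
  rw [hDrs] at h3
  have h4 : (x r - x s) ^ 2 = 0 := by linarith
  have h5 := pow_eq_zero_iff (two_ne_zero) |>.1 h4
  linarith

end OrthogonalFamily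

/-! ### Rotations of families of matrices -/

section Rotation

open Matrix

variable {n m : ℕ}

/-- The sum of the squared norms of the members of a family. -/
def normSum (A : Fin m → Matrix (Fin n) (Fin n) ℝ) : ℝ := ∑ r, frobSq (A r)

/-- The sum of the squared norms of the commutators of a family. -/
def commSum (A : Fin m → Matrix (Fin n) (Fin n) ℝ) : ℝ :=
  ∑ r, ∑ s, frobSq (A r * A s - A s * A r)

/-- The family in rotated bases of the space of vectors and of the space of indices. -/
def rotFamily (R : Matrix (Fin n) (Fin n) ℝ) (O : Matrix (Fin m) (Fin m) ℝ)
    (A : Fin m → Matrix (Fin n) (Fin n) ℝ) (r : Fin m) : Matrix (Fin n) (Fin n) ℝ :=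
  ∑ s, O s r • (Rᵀ * A s * R)

lemma rotFamily_eq_conj (R : Matrix (Fin n) (Fin n) ℝ) (O : Matrix (Fin m) (Fin m) ℝ)
    (A : Fin m → Matrix (Fin n) (Fin n) ℝ) (r : Fin m) :
    rotFamily R O A r = Rᵀ * (∑ s, O s r • A s) * R := by
  simp [rotFamily, Matrix.mul_sum, Matrix.sum_mul]

lemma sum_sq_orthogonal {O : Matrix (Fin m) (Fin m) ℝ} (hO : Oᵀ * O = 1) (z : Fin m → ℝ) :
    ∑ r, (∑ s, O s r * z s) ^ 2 = ∑ s, z s ^ 2 := by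
  have h := mulVec_dotProduct_mulVec (U := Oᵀ) (by
    rw [Matrix.transpose_transpose]; exact mul_eq_one_comm.1 hO) z z
  simpa [dotProduct, Matrix.mulVec, sq] using h

lemma frobSq_transpose_conj {R : Matrix (Fin n) (Fin n) ℝ} (hR : Rᵀ * R = 1)
    (X : Matrix (Fin n) (Fin n) ℝ) : frobSq (Rᵀ * X * R) = frobSq X := by
  rw [← frobInner_self, frobInner_transpose_conj hR hR, frobInner_self]

lemma normSum_rotFamily {R : Matrix (Fin n) (Fin n) ℝ} (hR : Rᵀ * R = 1)
    {O : Matrix (Fin m) (Fin m) ℝ} (hO : Oᵀ * O = 1) (A : Fin m → Matrix (Fin n) (Fin n) ℝ) :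
    normSum (rotFamily R O A) = normSum A := by
  unfold normSum
  simp_rw [rotFamily_eq_conj, frobSq_transpose_conj hR, frobSq]
  rw [Finset.sum_comm, Finset.sum_comm (s := Finset.univ (α := Fin m))]
  refine Finset.sum_congr rfl fun i _ => ?_
  rw [Finset.sum_comm, Finset.sum_comm (s := Finset.univ (α := Fin m))]
  refine Finset.sum_congr rfl fun j _ => ?_
  refine Eq.trans ?_ (sum_sq_orthogonal hO fun s => A s i j)
  simp [Matrix.sum_apply]

lemma commSum_rotFamily {R : Matrix (Fin n) (Fin n) ℝ} (hR : Rᵀ * R = 1)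
    {O : Matrix (Fin m) (Fin m) ℝ} (hO : Oᵀ * O = 1) (A : Fin m → Matrix (Fin n) (Fin n) ℝ) :
    commSum (rotFamily R O A) = commSum A := by
  have hR' := mul_eq_one_comm.1 hR
  have h1 : ∀ r s, rotFamily R O A r * rotFamily R O A s - rotFamily R O A s * rotFamily R O A r =
      Rᵀ * (∑ k, ∑ l, (O k r * O l s) • (A k * A l - A l * A k)) * R := by
    intro r s
    have h2 : ∀ X Y : Matrix (Fin n) (Fin n) ℝ, Rᵀ * X * R * (Rᵀ * Y * R) = Rᵀ * (X * Y) * R := by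
      intro X Y
      calc Rᵀ * X * R * (Rᵀ * Y * R) = Rᵀ * X * (R * Rᵀ) * Y * R := by
            simp only [Matrix.mul_assoc]
        _ = _ := by rw [hR', Matrix.mul_one]; simp only [Matrix.mul_assoc]
    rw [rotFamily_eq_conj, rotFamily_eq_conj, h2, h2, ← Matrix.sub_mul, ← Matrix.mul_sub]
    congr 2
    rw [Finset.sum_mul_sum, Finset.sum_mul_sum]
    rw [Finset.sum_comm (f := fun i j => O i s • A i * O j r • A j), ← Finset.sum_sub_distrib]
    refine Finset.sum_congr rfl fun k _ => ?_
    rw [← Finset.sum_sub_distrib]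
    refine Finset.sum_congr rfl fun l _ => ?_
    simp only [Matrix.smul_mul, Matrix.mul_smul, smul_smul, smul_sub]
    rw [mul_comm (O k r)]
  have h3 : ∀ Z : Matrix (Fin m) (Fin m) ℝ, ∑ r, ∑ s, (∑ k, ∑ l, O k r * O l s * Z k l) ^ 2 =
      ∑ k, ∑ l, Z k l ^ 2 := by
    intro Z
    have h := frobSq_transpose_conj hO Z
    rw [frobSq, frobSq] at h
    rw [← h]
    refine Finset.sum_congr rfl fun r _ => Finset.sum_congr rfl fun s _ => ?_
    congr 1
    simp only [Matrix.mul_apply, Matrix.transpose_apply, Finset.sum_mul]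
    rw [Finset.sum_comm]
    refine Finset.sum_congr rfl fun k _ => Finset.sum_congr rfl fun l _ => ?_
    ring
  have h4 : ∀ f : Fin m → Fin m → Fin n → Fin n → ℝ, ∑ r, ∑ s, ∑ i, ∑ j, f r s i j =
      ∑ i, ∑ j, ∑ r, ∑ s, f r s i j := by
    intro f
    calc ∑ r, ∑ s, ∑ i, ∑ j, f r s i j = ∑ r, ∑ i, ∑ j, ∑ s, f r s i j := by
          refine Finset.sum_congr rfl fun r _ => ?_
          rw [Finset.sum_comm]
          exact Finset.sum_congr rfl fun i _ => Finset.sum_comm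
      _ = _ := by
          rw [Finset.sum_comm]
          exact Finset.sum_congr rfl fun i _ => Finset.sum_comm
  unfold commSum
  simp_rw [h1, frobSq_transpose_conj hR, frobSq]
  rw [h4, h4]
  refine Finset.sum_congr rfl fun i _ => Finset.sum_congr rfl fun j _ => ?_
  rw [← h3 (fun k l => (A k * A l - A l * A k) i j)]
  refine Finset.sum_congr rfl fun r _ => Finset.sum_congr rfl fun s _ => ?_
  simp only [Matrix.sum_apply, Matrix.smul_apply, smul_eq_mul]

lemma frobInner_add_left {X Y Z : Matrix (Fin n) (Fin n) ℝ} :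
    frobInner (X + Y) Z = frobInner X Z + frobInner Y Z := by
  simp [frobInner, add_mul, Finset.sum_add_distrib]

lemma frobSq_add {X Y : Matrix (Fin n) (Fin n) ℝ} (h : frobInner X Y = 0) :
    frobSq (X + Y) = frobSq X + frobSq Y := by
  rw [← frobInner_self, frobInner_add_left, frobInner_comm X, frobInner_comm Y,
    frobInner_add_left, frobInner_add_left, frobInner_comm Y X, h, frobInner_self, frobInner_self]
  ring

lemma frobSq_add_transpose {a : Matrix (Fin n) (Fin n) ℝ} (ha : a * a = 0) :
    frobSq (a + aᵀ) = 2 * frobSq a := by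
  rw [frobSq_add, frobSq_transpose, two_mul]
  rw [frobInner_eq_trace, ← Matrix.transpose_mul, ha]; simp

lemma frobSq_commutator {a b : Matrix (Fin n) (Fin n) ℝ} (haa : a * a = 0) (hab : a * b = 0)
    (hba : b * a = 0) (hbb : b * b = 0) :
    frobSq ((a + aᵀ) * (b + bᵀ) - (b + bᵀ) * (a + aᵀ)) = crossSq a b := by
  have h1 : aᵀ * bᵀ = 0 := by rw [← Matrix.transpose_mul, hba, Matrix.transpose_zero]
  have h2 : bᵀ * aᵀ = 0 := by rw [← Matrix.transpose_mul, hab, Matrix.transpose_zero]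
  have h3 : (a + aᵀ) * (b + bᵀ) - (b + bᵀ) * (a + aᵀ) =
      (a * bᵀ - b * aᵀ) + (aᵀ * b - bᵀ * a) := by
    simp only [Matrix.add_mul, Matrix.mul_add, hab, hba, h1, h2]
    abel
  rw [h3, frobSq_add, crossSq]
  have h4 : (a * bᵀ - b * aᵀ)ᵀ * (aᵀ * b - bᵀ * a) = 0 := by
    simp only [Matrix.transpose_sub, Matrix.transpose_mul, Matrix.transpose_transpose,
      Matrix.sub_mul, Matrix.mul_sub]
    have e1 : b * aᵀ * (aᵀ * b) = b * (aᵀ * aᵀ) * b := by simp only [Matrix.mul_assoc]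
    have e2 : b * aᵀ * (bᵀ * a) = b * (aᵀ * bᵀ) * a := by simp only [Matrix.mul_assoc]
    have e3 : a * bᵀ * (aᵀ * b) = a * (bᵀ * aᵀ) * b := by simp only [Matrix.mul_assoc]
    have e4 : a * bᵀ * (bᵀ * a) = a * (bᵀ * bᵀ) * a := by simp only [Matrix.mul_assoc]
    rw [e1, e2, e3, e4, h1, h2, ← Matrix.transpose_mul, ← Matrix.transpose_mul, haa, hbb]
    simp
  rw [frobInner_eq_trace, h4, Matrix.trace_zero]

end Rotation

/-! ### The model family -/

section Model

open Matrix

variable {n m : ℕ}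

lemma conj_sum_vecMulVec {E : Fin 4 → Fin n → ℝ}
    (hE : ∀ a b, E a ⬝ᵥ E b = if a = b then 1 else 0) :
    4 ≤ n ∧ ∃ R : Matrix (Fin n) (Fin n) ℝ, Rᵀ * R = 1 ∧ ∀ C : Matrix (Fin 4) (Fin 4) ℝ,
      Rᵀ * (∑ a, ∑ b, C a b • vecMulVec (E a) (E b)) * R = diagZero n C := by
  have hn : 4 ≤ n := by
    have hon : Orthonormal ℝ fun a => (WithLp.toLp 2 (E a) : EuclideanSpace ℝ (Fin n)) := by
      rw [orthonormal_iff_ite]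
      intro a b
      rw [← hE a b]
      simp [PiLp.inner_apply, dotProduct, mul_comm]
    have := hon.linearIndependent.fintype_card_le_finrank
    simpa using this
  refine ⟨hn, ?_⟩
  obtain ⟨R, hR, hRE⟩ := exists_orthogonal_extension (d := n) {i | i.val < 4}
    (fun i => if h : i.val < 4 then E ⟨i, h⟩ else 0) (by
      intro i hi j hj
      simp only [Set.mem_ofPred_eq] at hi hj
      have := hE ⟨i, hi⟩ ⟨j, hj⟩
      simp only [dotProduct, Fin.mk.injEq] at this
      simp only [hi, hj, dif_pos, this, Fin.ext_iff])
  refine ⟨R, hR, fun C => ?_⟩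
  have hcol : ∀ (i : Fin n) (a : Fin 4), (Rᵀ *ᵥ E a) i = if i.val = a.val then 1 else 0 := by
    intro i a
    have h1 : ∀ k, E a k = R k ⟨a, by omega⟩ := by
      intro k
      rw [hRE ⟨a, by omega⟩ (by simp) k]
      simp
    have h2 := congrFun (congrFun hR i) ⟨a, by omega⟩
    simp only [Matrix.mul_apply, Matrix.one_apply, Fin.ext_iff] at h2
    rw [← h2]
    simp only [Matrix.mulVec, dotProduct, h1]
  have hv : ∀ a b, Rᵀ * vecMulVec (E a) (E b) * R = vecMulVec (Rᵀ *ᵥ E a) (Rᵀ *ᵥ E b) := by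
    intro a b
    have := mul_vecMulVec_mul_transpose Rᵀ Rᵀ (E a) (E b)
    rwa [Matrix.transpose_transpose] at this
  have hexp : Rᵀ * (∑ a, ∑ b, C a b • vecMulVec (E a) (E b)) * R =
      ∑ a, ∑ b, C a b • vecMulVec (Rᵀ *ᵥ E a) (Rᵀ *ᵥ E b) := by
    simp only [Matrix.mul_sum, Matrix.sum_mul, Matrix.mul_smul, Matrix.smul_mul, hv]
  rw [hexp]
  ext i j
  simp only [Matrix.sum_apply, Matrix.smul_apply, vecMulVec_apply, hcol, diagZero, Matrix.of_apply,
    smul_eq_mul]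
  split_ifs with h
  · rw [Finset.sum_eq_single ⟨i, h.1⟩, Finset.sum_eq_single ⟨j, h.2⟩]
    · simp
    · intro b _ hb
      have : j.val ≠ b.val := fun h' => hb (Fin.ext h'.symm)
      simp [this]
    · simp
    · intro b _ hb
      have : i.val ≠ b.val := fun h' => hb (Fin.ext h'.symm)
      simp [this]
    · simp
  · refine Finset.sum_eq_zero fun a _ => Finset.sum_eq_zero fun b _ => ?_
    by_cases hi : i.val = a.val
    · have : j.val ≠ b.val := fun hj => h ⟨by omega, by omega⟩
      simp [this]
    · simp [hi]

lemma exists_perm_apply_eq {α : Type*} [DecidableEq α] {i j r s : α} (hij : i ≠ j) (hrs : r ≠ s) :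
    ∃ π : Equiv.Perm α, π i = r ∧ π j = s := by
  have h1 : Equiv.swap i r j ≠ r := by
    intro h
    have : Equiv.swap i r j = Equiv.swap i r i := by rw [h, Equiv.swap_apply_left]
    exact hij ((Equiv.swap i r).injective this).symm
  refine ⟨(Equiv.swap i r).trans (Equiv.swap (Equiv.swap i r j) s), ?_, ?_⟩
  · rw [Equiv.trans_apply, Equiv.swap_apply_left, Equiv.swap_apply_of_ne_of_ne h1.symm hrs]
  · rw [Equiv.trans_apply, Equiv.swap_apply_left]

lemma rotFamily_rotFamily (R : Matrix (Fin n) (Fin n) ℝ) (O : Matrix (Fin m) (Fin m) ℝ)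
    (π : Equiv.Perm (Fin m)) (A : Fin m → Matrix (Fin n) (Fin n) ℝ) (r : Fin m) :
    rotFamily R (O.submatrix id π) A r = Rᵀ * rotFamily 1 O A (π r) * R := by
  rw [rotFamily_eq_conj, rotFamily_eq_conj]
  simp

/-- The members of an extremal family, in suitable bases. -/
lemma exists_model_of_extremal {a : Fin m → Matrix (Fin n) (Fin n) ℝ}
    (haa : ∀ r s, a r * a s = 0) (hext : IsExtremalFamily a) :
    ∃ (c : ℝ) (R : Matrix (Fin n) (Fin n) ℝ) (π : Equiv.Perm (Fin m)), Rᵀ * R = 1 ∧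
      (c ≠ 0 → 4 ≤ n ∧ 2 ≤ m) ∧
      ∀ r, Rᵀ * (a (π r) + (a (π r))ᵀ) * R = modelShape n m c r := by
  rcases hext with h0 | ⟨r₀, s₀, t, c, u₁, u₂, v₁, v₂, hrs, ht, hct, hu, hv, hr₀, hs₀, hz⟩
  · refine ⟨0, 1, Equiv.refl _, by simp, by simp, fun r => ?_⟩
    simp [h0, modelShape]
  have hcross : ∀ x y z w : Fin n → ℝ, (a r₀) *ᵥ y = t • x → (a r₀)ᵀ *ᵥ z = t • w →
      x ⬝ᵥ w = 0 := by
    intro x y z w h1 h2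
    have h3 : (t • x) ⬝ᵥ (t • w) = 0 := by
      rw [← h1, ← h2, Matrix.dotProduct_mulVec, ← Matrix.mulVec_transpose,
        Matrix.transpose_transpose, Matrix.mulVec_mulVec, haa, Matrix.zero_mulVec,
        zero_dotProduct]
    rw [smul_dotProduct, dotProduct_smul, smul_eq_mul, smul_eq_mul] at h3
    simpa [ht] using h3
  have m1 : (a r₀) *ᵥ v₁ = t • u₁ := by
    rw [hr₀, Matrix.smul_mulVec, Matrix.add_mulVec, Matrix.vecMulVec_mulVec,
      Matrix.vecMulVec_mulVec, hv.left, hv.symm.ortho]; simp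
  have m2 : (a r₀) *ᵥ v₂ = t • u₂ := by
    rw [hr₀, Matrix.smul_mulVec, Matrix.add_mulVec, Matrix.vecMulVec_mulVec,
      Matrix.vecMulVec_mulVec, hv.ortho, hv.right]; simp
  have m3 : (a r₀)ᵀ *ᵥ u₁ = t • v₁ := by
    rw [hr₀, Matrix.transpose_smul, Matrix.transpose_add, Matrix.transpose_vecMulVec,
      Matrix.transpose_vecMulVec, Matrix.smul_mulVec, Matrix.add_mulVec, Matrix.vecMulVec_mulVec,
      Matrix.vecMulVec_mulVec, hu.left, hu.symm.ortho]; simp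
  have m4 : (a r₀)ᵀ *ᵥ u₂ = t • v₂ := by
    rw [hr₀, Matrix.transpose_smul, Matrix.transpose_add, Matrix.transpose_vecMulVec,
      Matrix.transpose_vecMulVec, Matrix.smul_mulVec, Matrix.add_mulVec, Matrix.vecMulVec_mulVec,
      Matrix.vecMulVec_mulVec, hu.ortho, hu.right]; simp
  have o11 := hcross _ _ _ _ m1 m3
  have o12 := hcross _ _ _ _ m1 m4
  have o21 := hcross _ _ _ _ m2 m3
  have o22 := hcross _ _ _ _ m2 m4
  have hm : 2 ≤ m := by
    by_contra h
    have : Subsingleton (Fin m) := Fin.subsingleton_iff_le_one.2 (by omega)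
    exact hrs (Subsingleton.elim _ _)
  obtain ⟨π, hπ0, hπ1⟩ := exists_perm_apply_eq (i := (⟨0, by omega⟩ : Fin m))
    (j := ⟨1, by omega⟩) (by simp) hrs
  obtain ⟨E, hE, hE1, hE2⟩ : ∃ E : Fin 4 → Fin n → ℝ,
      (∀ a b, E a ⬝ᵥ E b = if a = b then 1 else 0) ∧
      a r₀ + (a r₀)ᵀ = t • ∑ i, ∑ j, matC1 i j • vecMulVec (E i) (E j) ∧
      a s₀ + (a s₀)ᵀ = t • ∑ i, ∑ j, matC2 i j • vecMulVec (E i) (E j) := by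
    have d11 := o11; have d12 := o12; have d21 := o21; have d22 := o22
    rw [dotProduct_comm] at d11 d12 d21 d22
    rcases sq_eq_sq_iff_eq_or_eq_neg.1 hct with rfl | rfl
    · refine ⟨![u₂, u₁, v₂, v₁], ?_, ?_, ?_⟩
      · intro i j
        fin_cases i <;> fin_cases j <;>
          simp [hu.left, hu.right, hu.ortho, hu.symm.ortho, hv.left, hv.right, hv.ortho,
            hv.symm.ortho, o11, o12, o21, o22, d11, d12, d21, d22]
      · rw [hr₀]
        simp [Fin.sum_univ_four, matC1, Matrix.transpose_smul, Matrix.transpose_add,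
          Matrix.transpose_vecMulVec]
        abel
      · rw [hs₀]
        simp [Fin.sum_univ_four, matC2, Matrix.transpose_smul,
          Matrix.transpose_vecMulVec, smul_sub]
        abel
    · refine ⟨![u₁, u₂, v₁, v₂], ?_, ?_, ?_⟩
      · intro i j
        fin_cases i <;> fin_cases j <;>
          simp [hu.left, hu.right, hu.ortho, hu.symm.ortho, hv.left, hv.right, hv.ortho,
            hv.symm.ortho, o11, o12, o21, o22, d11, d12, d21, d22]
      · rw [hr₀]
        simp [Fin.sum_univ_four, matC1, Matrix.transpose_smul, Matrix.transpose_add,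
          Matrix.transpose_vecMulVec]
        abel
      · rw [hs₀]
        simp [Fin.sum_univ_four, matC2, Matrix.transpose_smul,
          Matrix.transpose_vecMulVec, smul_sub]
        abel
  obtain ⟨hn, R, hR, hRC⟩ := conj_sum_vecMulVec hE
  refine ⟨t, R, π, hR, fun _ => ⟨hn, hm⟩, fun r => ?_⟩
  unfold modelShape
  split_ifs with h h'
  · have : r = ⟨0, by omega⟩ := Fin.ext h
    rw [this, hπ0, hE1, Matrix.mul_smul, Matrix.smul_mul, hRC]
  · have : r = ⟨1, by omega⟩ := Fin.ext h'
    rw [this, hπ1, hE2, Matrix.mul_smul, Matrix.smul_mul, hRC]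
  · have h1 : π r ≠ r₀ := by
      rw [← hπ0]
      exact fun h2 => h (by rw [π.injective h2])
    have h2 : π r ≠ s₀ := by
      rw [← hπ1]
      exact fun h2 => h' (by rw [π.injective h2])
    rw [hz _ h1 h2]; simp

/-- The commutator inequality for symmetric matrices `a + aᵀ` with off-diagonal blocks `a`, with the
characterisation of the equality case. -/
theorem commSum_le {A a : Fin m → Matrix (Fin n) (Fin n) ℝ} (haa : ∀ r s, a r * a s = 0)
    (hA : ∀ r, A r = a r + (a r)ᵀ) :
    commSum A ≤ normSum A ^ 2 / 2 ∧ (commSum A = normSum A ^ 2 / 2 →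
      ∃ (c : ℝ) (R : Matrix (Fin n) (Fin n) ℝ) (O : Matrix (Fin m) (Fin m) ℝ), Rᵀ * R = 1 ∧
        Oᵀ * O = 1 ∧ (c ≠ 0 → 4 ≤ n ∧ 2 ≤ m) ∧
        ∀ r, rotFamily R O A r = modelShape n m c r) := by
  let G : Matrix (Fin m) (Fin m) ℝ := Matrix.of fun r s => frobInner (a r) (a s)
  have hG : G.IsSymm := by
    ext r s
    simp [G, frobInner_comm (a r)]
  obtain ⟨O, μ, hO, hμ⟩ := exists_orthogonal_diagonalization hG
  let b : Fin m → Matrix (Fin n) (Fin n) ℝ := fun r => ∑ s, O s r • a s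
  have hbb : ∀ r s, b r * b s = 0 := by
    intro r s
    simp only [b, Finset.sum_mul_sum, Matrix.smul_mul, Matrix.mul_smul, haa]
    simp
  have hrot : ∀ r, rotFamily 1 O A r = b r + (b r)ᵀ := by
    intro r
    rw [rotFamily_eq_conj]
    simp [b, hA, Matrix.transpose_sum, Finset.sum_add_distrib]
  have horth : ∀ r s, r ≠ s → frobInner (b r) (b s) = 0 := by
    intro r s hrs
    have h := congrFun (congrFun hμ r) s
    rw [Matrix.diagonal_apply_ne _ hrs] at h
    rw [← h]
    simp only [b, frobInner_sum_left, frobInner_sum_right, frobInner_smul_left,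
      frobInner_smul_right, Matrix.mul_apply, Matrix.transpose_apply, Finset.sum_mul, G,
      Matrix.of_apply, Finset.mul_sum]
    refine Finset.sum_congr rfl fun k _ => Finset.sum_congr rfl fun l _ => ?_
    ring
  have hone : (1 : Matrix (Fin n) (Fin n) ℝ)ᵀ * 1 = 1 := by simp
  have hN : normSum A = 2 * ∑ r, frobSq (b r) := by
    rw [← normSum_rotFamily hone hO A, normSum, Finset.mul_sum]
    refine Finset.sum_congr rfl fun r _ => ?_
    rw [hrot, frobSq_add_transpose (hbb r r)]
  have hC : commSum A = ∑ r, ∑ s, crossSq (b r) (b s) := by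
    rw [← commSum_rotFamily hone hO A, commSum]
    refine Finset.sum_congr rfl fun r _ => Finset.sum_congr rfl fun s _ => ?_
    rw [hrot, hrot, frobSq_commutator (hbb r r) (hbb r s) (hbb s r) (hbb s s)]
  obtain ⟨hle, heq⟩ := sum_crossSq_le_of_orthogonal horth
  rw [hN, hC]
  refine ⟨by linarith, fun h => ?_⟩
  obtain ⟨c, R, π, hR, hc, hmodel⟩ := exists_model_of_extremal hbb (heq (by linarith))
  refine ⟨c, R, O.submatrix id π, hR, ?_, hc, fun r => ?_⟩
  · rw [Matrix.transpose_submatrix, ← Matrix.submatrix_mul _ _ _ _ _ Function.bijective_id, hO,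
      Matrix.submatrix_one_equiv]
  · rw [rotFamily_rotFamily, hrot, hmodel]

/-- A block off-diagonal symmetric matrix is `a + aᵀ`, with `a` its upper right block. -/
def upperBlock (p q : ℕ) (A : Matrix (Fin (p + q)) (Fin (p + q)) ℝ) :
    Matrix (Fin (p + q)) (Fin (p + q)) ℝ :=
  Matrix.of fun i j => if i.val < p ∧ p ≤ j.val then A i j else 0

lemma upperBlock_mul_upperBlock {p q : ℕ} (A B : Matrix (Fin (p + q)) (Fin (p + q)) ℝ) :
    upperBlock p q A * upperBlock p q B = 0 := by
  ext i j
  simp only [Matrix.mul_apply, upperBlock, Matrix.of_apply, Matrix.zero_apply]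
  refine Finset.sum_eq_zero fun k _ => ?_
  by_cases hk : k.val < p
  · simp [not_le.2 hk]
  · simp [hk]

lemma eq_upperBlock_add_transpose {p q : ℕ} {A : Matrix (Fin (p + q)) (Fin (p + q)) ℝ}
    (hA : A ∈ austereQ p q) : A = upperBlock p q A + (upperBlock p q A)ᵀ := by
  obtain ⟨a, rfl⟩ := hA
  ext i j
  obtain ⟨i, rfl⟩ := finSumFinEquiv.surjective i
  obtain ⟨j, rfl⟩ := finSumFinEquiv.surjective j
  rcases i with i | i <;> rcases j with j | j <;> simp [upperBlock]

lemma trace_eq_zero_of_mem_austereQ {p q : ℕ} {A : Matrix (Fin (p + q)) (Fin (p + q)) ℝ}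
    (hA : A ∈ austereQ p q) : A.trace = 0 := by
  rw [eq_upperBlock_add_transpose hA, Matrix.trace_add, Matrix.trace_transpose]
  have : (upperBlock p q A).trace = 0 := by
    refine Finset.sum_eq_zero fun i _ => ?_
    simp only [Matrix.diag_apply, upperBlock, Matrix.of_apply]
    rw [if_neg (by omega)]
  rw [this, add_zero]

/-- The model family attains equality. -/
lemma commSum_modelShape {c : ℝ} (hc : c ≠ 0 → 4 ≤ n ∧ 2 ≤ m) :
    commSum (modelShape n m c) = normSum (modelShape n m c) ^ 2 / 2 := by
  by_cases h0 : c = 0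
  · subst h0
    have : modelShape n m 0 = fun _ => 0 := by
      ext r i j; simp [modelShape]
    rw [this]
    simp [commSum, normSum, frobSq]
  obtain ⟨hn, hm⟩ := hc h0
  obtain ⟨k, rfl⟩ := Nat.exists_eq_add_of_le hn
  obtain ⟨l, rfl⟩ := Nat.exists_eq_add_of_le hm
  have hdz : ∀ C, diagZero (4 + k) C = Matrix.reindex finSumFinEquiv finSumFinEquiv
      (Matrix.fromBlocks C 0 0 (0 : Matrix (Fin k) (Fin k) ℝ)) := by
    intro C
    ext i j
    obtain ⟨i, rfl⟩ := finSumFinEquiv.surjective i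
    obtain ⟨j, rfl⟩ := finSumFinEquiv.surjective j
    rcases i with i | i <;> rcases j with j | j <;> simp [diagZero]
  have hmul : ∀ C D, diagZero (4 + k) C * diagZero (4 + k) D = diagZero (4 + k) (C * D) := by
    intro C D
    rw [hdz, hdz, hdz]
    simp only [Matrix.reindex_apply]
    rw [Matrix.submatrix_mul_equiv, Matrix.fromBlocks_multiply]
    simp
  have hsub : ∀ C D, diagZero (4 + k) C - diagZero (4 + k) D = diagZero (4 + k) (C - D) := by
    intro C D
    ext i j
    simp only [diagZero, Matrix.sub_apply, Matrix.of_apply]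
    split_ifs <;> simp
  have hfrob : ∀ C, frobSq (diagZero (4 + k) C) = frobSq C := by
    intro C
    rw [hdz]
    unfold frobSq
    rw [← finSumFinEquiv.sum_comp]
    simp only [Fintype.sum_sum_type]
    simp [← finSumFinEquiv.sum_comp]
  have hs0 : modelShape (4 + k) (2 + l) c (Fin.castAdd l 0) = c • diagZero (4 + k) matC1 := by
    simp [modelShape]
  have hs1 : modelShape (4 + k) (2 + l) c (Fin.castAdd l 1) = c • diagZero (4 + k) matC2 := by
    simp [modelShape]
  have hs2 : ∀ r, modelShape (4 + k) (2 + l) c (Fin.natAdd 2 r) = 0 := by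
    intro r
    simp [modelShape]
    intro h; omega
  have f1 : frobSq matC1 = 4 := by
    simp [frobSq, matC1, Fin.sum_univ_four]; norm_num
  have f2 : frobSq matC2 = 4 := by
    simp [frobSq, matC2, Fin.sum_univ_four]; norm_num
  have f12 : frobSq (matC1 * matC2 - matC2 * matC1) = 16 := by
    simp [frobSq, matC1, matC2, Fin.sum_univ_four]; norm_num
  have f21 : frobSq (matC2 * matC1 - matC1 * matC2) = 16 := by
    simp [frobSq, matC1, matC2, Fin.sum_univ_four]; norm_num
  have hN : normSum (modelShape (4 + k) (2 + l) c) = 8 * c ^ 2 := by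
    simp only [normSum, Fin.sum_univ_add, Fin.sum_univ_two, hs0, hs1, hs2, frobSq_smul, hfrob,
      f1, f2]
    simp [frobSq]
    ring
  have hC : commSum (modelShape (4 + k) (2 + l) c) = 32 * c ^ 4 := by
    simp only [commSum, Fin.sum_univ_add, Fin.sum_univ_two, hs0, hs1, hs2, Matrix.smul_mul,
      Matrix.mul_smul, hmul, ← smul_sub, hsub, frobSq_smul, hfrob, f12, f21]
    simp [frobSq]
    ring
  rw [hN, hC]; ring

end Model

set_option maxSynthPendingDepth 3

/-! ### The Levi-Civita connection along a map -/

namespace Coord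

open Filter Topology

variable {E F : Type*} [NormedAddCommGroup E] [NormedSpace ℝ E]
  [NormedAddCommGroup F] [NormedSpace ℝ F]

lemma eq_of_forall_apply_eq {B : F →L[ℝ] F →L[ℝ] ℝ} (hB : ∀ v, v ≠ 0 → 0 < B v v) {v w : F}
    (h : ∀ z, B v z = B w z) : v = w := by
  by_contra hne
  have h1 := hB (v - w) (sub_ne_zero.2 hne)
  have h2 : B (v - w) = 0 := by
    ext z
    simp [h]
  rw [h2] at h1
  simp at h1

section Inverse

variable [FiniteDimensional ℝ F]

lemma exists_equiv_of_pos {B : F →L[ℝ] F →L[ℝ] ℝ} (hB : ∀ v, v ≠ 0 → 0 < B v v) :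
    ∃ e : F ≃L[ℝ] (F →L[ℝ] ℝ), (e : F →L[ℝ] F →L[ℝ] ℝ) = B := by
  have hinj : Function.Injective (B : F →ₗ[ℝ] F →L[ℝ] ℝ) := by
    rw [injective_iff_map_eq_zero]
    intro v hv
    by_contra hne
    have h1 := hB v hne
    have h2 : B v = 0 := hv
    rw [h2] at h1
    simp at h1
  have hdim : Module.finrank ℝ F = Module.finrank ℝ (F →L[ℝ] ℝ) := by
    rw [← (LinearMap.toContinuousLinearMap (𝕜 := ℝ) (E := F) (F' := ℝ)).finrank_eq]
    exact (Subspace.dual_finrank_eq (K := ℝ) (V := F)).symm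
  refine ⟨(LinearMap.linearEquivOfInjective _ hinj hdim).toContinuousLinearEquiv, ?_⟩
  ext v w
  rfl

lemma apply_inverse_of_pos {B : F →L[ℝ] F →L[ℝ] ℝ} (hB : ∀ v, v ≠ 0 → 0 < B v v)
    (l : F →L[ℝ] ℝ) : B (B.inverse l) = l := by
  obtain ⟨e, rfl⟩ := exists_equiv_of_pos hB
  simp [ContinuousLinearMap.inverse_equiv]

lemma contDiffAt_inverse_of_pos {B : E → F →L[ℝ] F →L[ℝ] ℝ} {x : E} (hB : ContDiffAt ℝ ∞ B x)
    (hpos : ∀ v, v ≠ 0 → 0 < B x v v) : ContDiffAt ℝ ∞ (fun x => (B x).inverse) x := by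
  obtain ⟨e, he⟩ := exists_equiv_of_pos hpos
  have : CompleteSpace F := FiniteDimensional.complete ℝ F
  have h := contDiffAt_map_inverse (𝕜 := ℝ) (n := ∞) e
  rw [he] at h
  exact h.comp x hB

end Inverse

lemma contDiffAt_fderiv {V : E → F} {x : E} (hV : ContDiffAt ℝ ∞ V x) :
    ContDiffAt ℝ ∞ (fderiv ℝ V) x :=
  hV.fderiv_right (m := ∞) (by simp)

lemma _root_.ContDiffAt.diff {V : E → F} {x : E} (hV : ContDiffAt ℝ ∞ V x) : DifferentiableAt ℝ V x :=
  hV.differentiableAt (by simp)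

lemma eventually_differentiableAt {V : E → F} {x : E} (hV : ContDiffAt ℝ ∞ V x) :
    ∀ᶠ x' in 𝓝 x, DifferentiableAt ℝ V x' := by
  have h : ContDiffAt ℝ 1 V x := hV.of_le (by exact_mod_cast le_top)
  filter_upwards [h.eventually (by simp)] with x' hx'
  exact hx'.differentiableAt (by simp)

lemma contDiffAt_fderiv_apply {V : E → F} {x : E} (hV : ContDiffAt ℝ ∞ V x) (v : E) :
    ContDiffAt ℝ ∞ (fun x' => fderiv ℝ V x' v) x :=
  (contDiffAt_fderiv hV).clm_apply contDiffAt_const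

lemma fderiv_fderiv_apply {V : E → F} {x : E} (hV : ContDiffAt ℝ ∞ V x) (u v : E) :
    fderiv ℝ (fun x' => fderiv ℝ V x' v) x u = fderiv ℝ (fderiv ℝ V) x u v := by
  rw [fderiv_clm_apply (contDiffAt_fderiv hV).diff (differentiableAt_const v)]
  simp

lemma fderiv_fderiv_comm {V : E → F} {x : E} (hV : ContDiffAt ℝ ∞ V x) (u v : E) :
    fderiv ℝ (fderiv ℝ V) x u v = fderiv ℝ (fderiv ℝ V) x v u :=
  (hV.isSymmSndFDerivAt (by
    rw [minSmoothness_of_isRCLikeNormedField]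
    exact WithTop.coe_le_coe.2 (le_top : (2 : ℕ∞) ≤ ⊤))) u v

/-- `G` is smooth, symmetric and positive definite near `y`. -/
structure IsMetricNear (G : F → F →L[ℝ] F →L[ℝ] ℝ) (y : F) : Prop where
  smooth_near : ∀ᶠ z in 𝓝 y, ContDiffAt ℝ ∞ G z
  symm : ∀ᶠ z in 𝓝 y, ∀ u v, G z u v = G z v u
  pos : ∀ᶠ z in 𝓝 y, ∀ v, v ≠ 0 → 0 < G z v v

section Connection

variable {G : F → F →L[ℝ] F →L[ℝ] ℝ}

lemma IsMetricNear.smooth {y : F} (hG : IsMetricNear G y) : ContDiffAt ℝ ∞ G y :=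
  hG.smooth_near.self_of_nhds

lemma IsMetricNear.eventually {y : F} (hG : IsMetricNear G y) :
    ∀ᶠ z in 𝓝 y, IsMetricNear G z := by
  filter_upwards [hG.smooth_near.eventually_nhds, hG.symm.eventually_nhds,
    hG.pos.eventually_nhds] with z h1 h2 h3 using ⟨h1, h2, h3⟩

lemma IsMetricNear.symm_at {y : F} (hG : IsMetricNear G y) (u v : F) : G y u v = G y v u :=
  hG.symm.self_of_nhds u v

lemma IsMetricNear.pos_at {y : F} (hG : IsMetricNear G y) (v : F) (hv : v ≠ 0) : 0 < G y v v :=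
  hG.pos.self_of_nhds v hv

lemma fderiv_apply_apply {y : F} (hG : DifferentiableAt ℝ G y) (u v w : F) :
    fderiv ℝ (fun z => G z v w) y u = fderiv ℝ G y u v w := by
  have h1 : DifferentiableAt ℝ (fun z => G z v) y := hG.clm_apply (differentiableAt_const v)
  rw [fderiv_clm_apply h1 (differentiableAt_const w),
    fderiv_clm_apply hG (differentiableAt_const v)]
  simp

lemma IsMetricNear.fderiv_symm {y : F} (hG : IsMetricNear G y) (u v w : F) :
    fderiv ℝ G y u v w = fderiv ℝ G y u w v := by
  have h : (fun z => G z v w) =ᶠ[𝓝 y] fun z => G z w v := by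
    filter_upwards [hG.symm] with z hz using hz v w
  rw [← fderiv_apply_apply hG.smooth.diff, ← fderiv_apply_apply hG.smooth.diff, h.fderiv_eq]

lemma IsMetricNear.apply_christoffel [FiniteDimensional ℝ F] {y : F} (hG : IsMetricNear G y)
    (u v z : F) : G y (christoffel G y u v) z =
      (fderiv ℝ G y u v z + fderiv ℝ G y v u z - fderiv ℝ G y z u v) / 2 := by
  rw [christoffel, apply_inverse_of_pos hG.pos_at]
  simp
  ring

/-- The Christoffel symbol as a continuous bilinear map. -/
noncomputable def christoffelL (G : F → F →L[ℝ] F →L[ℝ] ℝ) (y : F) : F →L[ℝ] F →L[ℝ] F :=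
  (ContinuousLinearMap.compL ℝ F (F →L[ℝ] ℝ) F (G y).inverse).comp
    ((1 / 2 : ℝ) • (fderiv ℝ G y + (fderiv ℝ G y).flip -
      ((ContinuousLinearMap.flipₗᵢ ℝ F F ℝ).toContinuousLinearEquiv :
        (F →L[ℝ] F →L[ℝ] ℝ) →L[ℝ] F →L[ℝ] F →L[ℝ] ℝ).comp (fderiv ℝ G y).flip))

lemma christoffelL_apply (y u v : F) : christoffelL G y u v = christoffel G y u v := by
  simp only [christoffelL, christoffel, ContinuousLinearMap.comp_apply,
    ContinuousLinearMap.compL_apply]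
  congr 1

lemma IsMetricNear.contDiffAt_christoffelL [FiniteDimensional ℝ F] {y : F}
    (hG : IsMetricNear G y) : ContDiffAt ℝ ∞ (christoffelL G) y := by
  have h1 := contDiffAt_inverse_of_pos hG.smooth hG.pos_at
  have h2 := contDiffAt_fderiv hG.smooth
  have h3 : ContDiffAt ℝ ∞ (fun y => (fderiv ℝ G y).flip) y :=
    ((ContinuousLinearMap.flipₗᵢ ℝ F F (F →L[ℝ] ℝ)).toContinuousLinearEquiv.contDiff
      (n := ∞)).contDiffAt.comp y h2
  exact ((ContinuousLinearMap.contDiff _).contDiffAt.comp y h1).clm_comp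
    ((((h2.add h3).sub (contDiffAt_const.clm_comp h3))).const_smul (1 / 2 : ℝ))

lemma covDeriv_eq (φ : E → F) (V : E → F) (x u : E) : covDeriv G φ V x u =
    fderiv ℝ V x u + christoffelL G (φ x) (fderiv ℝ φ x u) (V x) := by
  rw [christoffelL_apply, covDeriv]

lemma IsMetricNear.christoffel_comm [FiniteDimensional ℝ F] {y : F} (hG : IsMetricNear G y)
    (u v : F) : christoffel G y u v = christoffel G y v u := by
  refine eq_of_forall_apply_eq hG.pos_at fun z => ?_
  rw [hG.apply_christoffel, hG.apply_christoffel, hG.fderiv_symm z u v]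
  ring

lemma contDiffAt_covDeriv [FiniteDimensional ℝ F] {φ V : E → F} {x : E}
    (hG : IsMetricNear G (φ x)) (hφ : ContDiffAt ℝ ∞ φ x) (hV : ContDiffAt ℝ ∞ V x) (v : E) :
    ContDiffAt ℝ ∞ (fun x' => covDeriv G φ V x' v) x := by
  simp_rw [covDeriv_eq]
  exact (contDiffAt_fderiv_apply hV v).add (((hG.contDiffAt_christoffelL.comp x hφ).clm_apply
    (contDiffAt_fderiv_apply hφ v)).clm_apply hV)

/-- The connection is compatible with the metric. -/
lemma fderiv_metric [FiniteDimensional ℝ F] {φ V W : E → F} {x : E} (hG : IsMetricNear G (φ x))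
    (hφ : DifferentiableAt ℝ φ x) (hV : DifferentiableAt ℝ V x) (hW : DifferentiableAt ℝ W x)
    (u : E) : fderiv ℝ (fun x' => G (φ x') (V x') (W x')) x u =
      G (φ x) (covDeriv G φ V x u) (W x) + G (φ x) (V x) (covDeriv G φ W x u) := by
  have hGφ : DifferentiableAt ℝ (fun x' => G (φ x')) x := hG.smooth.diff.comp x hφ
  have h1 : fderiv ℝ (fun x' => G (φ x')) x = (fderiv ℝ G (φ x)).comp (fderiv ℝ φ x) :=
    fderiv_comp x hG.smooth.diff hφ
  have h2 : DifferentiableAt ℝ (fun x' => G (φ x') (V x')) x := hGφ.clm_apply hV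
  rw [fderiv_clm_apply h2 hW, fderiv_clm_apply hGφ hV, h1]
  simp only [covDeriv, map_add, add_apply, ContinuousLinearMap.comp_apply,
    ContinuousLinearMap.flip_apply]
  rw [hG.apply_christoffel, hG.symm_at (V x) (christoffel _ _ _ _), hG.apply_christoffel,
    hG.fderiv_symm (fderiv ℝ φ x u) (W x) (V x), hG.fderiv_symm (V x) _ (W x),
    hG.fderiv_symm (W x) _ (V x)]
  ring

/-- The connection is torsion-free. -/
lemma covDeriv_fderiv_comm [FiniteDimensional ℝ F] {φ : E → F} {x : E}
    (hG : IsMetricNear G (φ x)) (hφ : ContDiffAt ℝ ∞ φ x) (u v : E) :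
    covDeriv G φ (fun x' => fderiv ℝ φ x' v) x u =
      covDeriv G φ (fun x' => fderiv ℝ φ x' u) x v := by
  simp only [covDeriv]
  rw [fderiv_fderiv_apply hφ, fderiv_fderiv_apply hφ, fderiv_fderiv_comm hφ,
    hG.christoffel_comm]

lemma covDeriv_covDeriv [FiniteDimensional ℝ F] {φ V : E → F} {x : E}
    (hG : IsMetricNear G (φ x)) (hφ : ContDiffAt ℝ ∞ φ x) (hV : ContDiffAt ℝ ∞ V x) (u v : E) :
    covDeriv G φ (fun x' => covDeriv G φ V x' v) x u =
      fderiv ℝ (fderiv ℝ V) x u v +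
      (fderiv ℝ (christoffelL G) (φ x) (fderiv ℝ φ x u) (fderiv ℝ φ x v) (V x) +
        christoffelL G (φ x) (fderiv ℝ (fderiv ℝ φ) x u v) (V x) +
        christoffelL G (φ x) (fderiv ℝ φ x v) (fderiv ℝ V x u)) +
      (christoffelL G (φ x) (fderiv ℝ φ x u) (fderiv ℝ V x v) +
        christoffelL G (φ x) (fderiv ℝ φ x u)
          (christoffelL G (φ x) (fderiv ℝ φ x v) (V x))) := by
  simp_rw [covDeriv_eq]
  have hΓ := hG.contDiffAt_christoffelL.diff
  have hΓφ : DifferentiableAt ℝ (fun x' => christoffelL G (φ x')) x := hΓ.comp x hφ.diff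
  have h1 : fderiv ℝ (fun x' => christoffelL G (φ x')) x =
      (fderiv ℝ (christoffelL G) (φ x)).comp (fderiv ℝ φ x) :=
    fderiv_comp x hΓ hφ.diff
  have hφ' := (contDiffAt_fderiv_apply hφ v).diff
  have h2 : DifferentiableAt ℝ (fun x' => christoffelL G (φ x') (fderiv ℝ φ x' v)) x :=
    hΓφ.clm_apply hφ'
  have h3 : DifferentiableAt ℝ (fun x' => christoffelL G (φ x') (fderiv ℝ φ x' v) (V x')) x :=
    h2.clm_apply hV.diff
  rw [fderiv_fun_add (contDiffAt_fderiv_apply hV v).diff h3, fderiv_clm_apply h2 hV.diff,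
    fderiv_clm_apply hΓφ hφ', h1]
  simp only [add_apply, ContinuousLinearMap.comp_apply,
    ContinuousLinearMap.flip_apply, map_add, fderiv_fderiv_apply hV, fderiv_fderiv_apply hφ]
  abel

lemma curvature_eq [FiniteDimensional ℝ F] {y : F} (hG : IsMetricNear G y) (u v w : F) :
    curvature G y u v w =
      fderiv ℝ (christoffelL G) y u v w - fderiv ℝ (christoffelL G) y v u w +
      (christoffelL G y u (christoffelL G y v w) - christoffelL G y v (christoffelL G y u w)) := by
  have hG' : IsMetricNear G (id y) := hG
  unfold curvature
  rw [covDeriv_covDeriv hG' contDiffAt_id contDiffAt_const,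
    covDeriv_covDeriv hG' contDiffAt_id contDiffAt_const]
  have h1 : fderiv ℝ (fun _ : F => w) = 0 := by ext; simp
  have h2 : fderiv ℝ (id : F → F) = fun _ => ContinuousLinearMap.id ℝ F := by
    ext; simp
  rw [h1, h2]
  simp
  abel

/-- The curvature of the connection along a map is the pullback of the curvature tensor. -/
lemma covDeriv_covDeriv_sub [FiniteDimensional ℝ F] {φ V : E → F} {x : E}
    (hG : IsMetricNear G (φ x)) (hφ : ContDiffAt ℝ ∞ φ x) (hV : ContDiffAt ℝ ∞ V x) (u v : E) :
    covDeriv G φ (fun x' => covDeriv G φ V x' v) x u -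
      covDeriv G φ (fun x' => covDeriv G φ V x' u) x v =
      curvature G (φ x) (fderiv ℝ φ x u) (fderiv ℝ φ x v) (V x) := by
  rw [covDeriv_covDeriv hG hφ hV, covDeriv_covDeriv hG hφ hV, curvature_eq hG,
    fderiv_fderiv_comm hV u v, fderiv_fderiv_comm hφ u v]
  abel

end Connection

end Coord

/-! ### Symmetries of the curvature tensor -/

/-- A quadrilinear form with the symmetries of a curvature tensor vanishes if its sectional
curvatures do. -/
lemma curvatureLike_eq_zero {V : Type*} [AddCommGroup V] {S : V → V → V → V → ℝ}
    (h1 : ∀ u u' v w z, S (u + u') v w z = S u v w z + S u' v w z)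
    (h2 : ∀ u v v' w z, S u (v + v') w z = S u v w z + S u v' w z)
    (h3 : ∀ u v w w' z, S u v (w + w') z = S u v w z + S u v w' z)
    (h4 : ∀ u v w z z', S u v w (z + z') = S u v w z + S u v w z')
    (h12 : ∀ u v w z, S u v w z = -S v u w z) (h34 : ∀ u v w z, S u v w z = -S u v z w)
    (hB : ∀ u v w z, S u v w z + S v w u z + S w u v z = 0)
    (h0 : ∀ u v, S u v v u = 0) (u v w z : V) : S u v w z = 0 := by
  have hpair : ∀ u v w z, S u v w z = S w z u v := by
    intro u v w z
    linarith [hB u v w z, hB v w z u, hB w z u v, hB z u v w, h12 u v w z, h12 v w u z,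
      h12 w u v z, h34 u v w z, h34 v w u z, h34 w u v z, h12 w z u v, h34 w z u v, h12 z u v w,
      h34 z u v w, h12 u w z v, h34 u w z v, h12 v z w u, h34 v z w u, h12 z v w u, h34 z v u w,
      h12 u z v w, h34 u z v w, h34 v w z u, h12 v w z u, h12 z w v u]
  have hvv : ∀ u v z, S u v v z = 0 := by
    intro u v z
    have e := h0 (u + z) v
    rw [h1, h4, h4, h0, h0] at e
    have e2 : S z v v u = S u v v z := by
      rw [hpair z v v u, h12, h34]; ring
    linarith
  have hvw : ∀ u v w z, S u v w z = -S u w v z := by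
    intro u v w z
    have e := hvv u (v + w) z
    rw [h2, h3, h3, hvv, hvv] at e
    linarith
  linarith [hB u v w z, h12 v w u z, hvw v u w z, h12 v u w z, h12 w u v z, hvw u w v z]

namespace Coord

open Filter Topology

variable {E F : Type*} [NormedAddCommGroup E] [NormedSpace ℝ E]
  [NormedAddCommGroup F] [NormedSpace ℝ F]
  {G : F → F →L[ℝ] F →L[ℝ] ℝ}

section Symmetries

variable [FiniteDimensional ℝ F]

lemma IsMetricNear.curvature_bianchi {y : F} (hG : IsMetricNear G y) (u v w : F) :
    curvature G y u v w + curvature G y v w u + curvature G y w u v = 0 := by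
  have hΓ : ∀ u v, christoffelL G y u v = christoffelL G y v u := fun u v => by
    rw [christoffelL_apply, christoffelL_apply, hG.christoffel_comm]
  have hd := hG.contDiffAt_christoffelL.diff
  have hD : ∀ u v w, fderiv ℝ (christoffelL G) y u v w = fderiv ℝ (christoffelL G) y u w v := by
    intro u v w
    have he : ∀ v w, fderiv ℝ (fun z => christoffelL G z v w) y u =
        fderiv ℝ (christoffelL G) y u v w := by
      intro v w
      rw [fderiv_clm_apply (hd.clm_apply (differentiableAt_const v)) (differentiableAt_const w),
        fderiv_clm_apply hd (differentiableAt_const v)]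
      simp
    have h : (fun z => christoffelL G z v w) =ᶠ[𝓝 y] fun z => christoffelL G z w v := by
      filter_upwards [hG.eventually] with z hz
      rw [christoffelL_apply, christoffelL_apply, hz.christoffel_comm]
    rw [← he, ← he, h.fderiv_eq]
  rw [curvature_eq hG, curvature_eq hG, curvature_eq hG, hD u v w, hD v w u, hD w u v, hΓ v w,
    hΓ w u, hΓ u v]
  abel

lemma fderiv_fderiv_metric {φ V W : E → F} {x : E} (hG : IsMetricNear G (φ x))
    (hφ : ContDiffAt ℝ ∞ φ x) (hV : ContDiffAt ℝ ∞ V x) (hW : ContDiffAt ℝ ∞ W x) (u v : E) :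
    fderiv ℝ (fun x' => fderiv ℝ (fun x' => G (φ x') (V x') (W x')) x' v) x u =
      (G (φ x) (covDeriv G φ (fun x' => covDeriv G φ V x' v) x u) (W x) +
        G (φ x) (covDeriv G φ V x v) (covDeriv G φ W x u)) +
      (G (φ x) (covDeriv G φ V x u) (covDeriv G φ W x v) +
        G (φ x) (V x) (covDeriv G φ (fun x' => covDeriv G φ W x' v) x u)) := by
  have h1 : (fun x' => fderiv ℝ (fun x' => G (φ x') (V x') (W x')) x' v) =ᶠ[𝓝 x]
      fun x' => G (φ x') (covDeriv G φ V x' v) (W x') + G (φ x') (V x') (covDeriv G φ W x' v) := by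
    filter_upwards [hφ.continuousAt.eventually hG.eventually, eventually_differentiableAt hφ,
      eventually_differentiableAt hV, eventually_differentiableAt hW] with x' h1 h2 h3 h4
    exact fderiv_metric h1 h2 h3 h4 v
  have hGφ : ContDiffAt ℝ ∞ (fun x' => G (φ x')) x := hG.smooth.comp x hφ
  have hV' := contDiffAt_covDeriv hG hφ hV v
  have hW' := contDiffAt_covDeriv hG hφ hW v
  rw [h1.fderiv_eq, fderiv_fun_add ((hGφ.clm_apply hV').clm_apply hW).diff
    ((hGφ.clm_apply hV).clm_apply hW').diff, add_apply,
    fderiv_metric hG hφ.diff hV'.diff hW.diff, fderiv_metric hG hφ.diff hV.diff hW'.diff]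

lemma IsMetricNear.curvature_antisymm {y : F} (hG : IsMetricNear G y) (u v w z : F) :
    G y (curvature G y u v w) z = -G y (curvature G y u v z) w := by
  have hG' : IsMetricNear G (id y) := hG
  have hs : ContDiffAt ℝ ∞ (fun x' : F => G (id x') w z) y :=
    (hG.smooth.clm_apply contDiffAt_const).clm_apply contDiffAt_const
  have h1 := fderiv_fderiv_metric (V := fun _ => w) (W := fun _ => z) hG' contDiffAt_id
    contDiffAt_const contDiffAt_const u v
  have h2 := fderiv_fderiv_metric (V := fun _ => w) (W := fun _ => z) hG' contDiffAt_id
    contDiffAt_const contDiffAt_const v u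
  rw [fderiv_fderiv_apply hs] at h1 h2
  rw [fderiv_fderiv_comm hs] at h1
  rw [h1] at h2
  rw [hG.symm_at (curvature G y u v z) w]
  simp only [curvature, map_sub, sub_apply]
  simp only [id_eq] at h2
  linarith

/-- Constant sectional curvature determines the curvature tensor. -/
lemma IsMetricNear.curvature_of_constant {y : F} (hG : IsMetricNear G y) {κ : ℝ}
    (hκ : ∀ u v, G y (curvature G y u v v) u = κ * (G y u u * G y v v - G y u v ^ 2))
    (u v w z : F) : G y (curvature G y u v w) z =
      κ * (G y v w * G y u z - G y u w * G y v z) := by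
  have hs := hG.symm_at
  have h := curvatureLike_eq_zero (S := fun u v w z => G y (curvature G y u v w) z -
    κ * (G y v w * G y u z - G y u w * G y v z)) ?_ ?_ ?_ ?_ ?_ ?_ ?_ ?_ u v w z
  · linarith
  · intro u u' v w z
    simp only [curvature_eq hG, map_add, add_apply, map_sub, sub_apply]
    ring
  · intro u v v' w z
    simp only [curvature_eq hG, map_add, add_apply, map_sub, sub_apply]
    ring
  · intro u v w w' z
    simp only [curvature_eq hG, map_add, add_apply, map_sub, sub_apply]
    ring
  · intro u v w z z'
    simp only [map_add]
    ring
  · intro u v w z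
    simp only [curvature_eq hG, map_add, add_apply, map_sub, sub_apply]
    ring
  · intro u v w z
    rw [hG.curvature_antisymm u v w z]
    ring
  · intro u v w z
    have h1 := congrArg (fun t => G y t z) (hG.curvature_bianchi u v w)
    simp only [map_add, add_apply, map_zero, zero_apply] at h1
    rw [hs v w, hs u w, hs u v]
    linarith
  · intro u v
    rw [hκ, hs v u]
    ring

end Symmetries

/-! ### Immersions -/

/-- `φ` is a smooth immersion near `x`, and `G` is a Riemannian metric near `φ x`. -/
structure IsImmersionNear (G : F → F →L[ℝ] F →L[ℝ] ℝ) (φ : E → F) (x : E) : Prop where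
  metric : IsMetricNear G (φ x)
  smooth_near : ∀ᶠ x' in 𝓝 x, ContDiffAt ℝ ∞ φ x'
  injective : ∀ᶠ x' in 𝓝 x, Function.Injective (fderiv ℝ φ x')

section Immersion

variable {φ : E → F} {x : E}

lemma IsImmersionNear.smooth (h : IsImmersionNear G φ x) : ContDiffAt ℝ ∞ φ x :=
  h.smooth_near.self_of_nhds

lemma IsImmersionNear.eventually (h : IsImmersionNear G φ x) :
    ∀ᶠ x' in 𝓝 x, IsImmersionNear G φ x' := by
  filter_upwards [h.smooth.continuousAt.eventually h.metric.eventually,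
    h.smooth_near.eventually_nhds, h.injective.eventually_nhds] with x' h1 h2 h3
  exact ⟨h1, h2, h3⟩

lemma firstForm_apply (x u v : E) :
    firstForm G φ x u v = G (φ x) (fderiv ℝ φ x u) (fderiv ℝ φ x v) := rfl

lemma IsImmersionNear.contDiffAt_firstForm (h : IsImmersionNear G φ x) :
    ContDiffAt ℝ ∞ (firstForm G φ) x := by
  have hGφ : ContDiffAt ℝ ∞ (fun x' => G (φ x')) x := h.metric.smooth.comp x h.smooth
  have hφ := contDiffAt_fderiv h.smooth
  have h1 : ContDiffAt ℝ ∞ (fun x' => ((G (φ x')).comp (fderiv ℝ φ x')).flip) x :=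
    ((ContinuousLinearMap.flipₗᵢ ℝ E F ℝ).toContinuousLinearEquiv.contDiff
      (n := ∞)).contDiffAt.comp x (hGφ.clm_comp hφ)
  exact ((ContinuousLinearMap.flipₗᵢ ℝ E E ℝ).toContinuousLinearEquiv.contDiff
      (n := ∞)).contDiffAt.comp x (h1.clm_comp hφ)

/-- The first fundamental form of an immersion is a Riemannian metric. -/
lemma IsImmersionNear.firstForm_metric (h : IsImmersionNear G φ x) :
    IsMetricNear (firstForm G φ) x where
  smooth_near := by
    filter_upwards [h.eventually] with x' hx' using hx'.contDiffAt_firstForm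
  symm := by
    filter_upwards [h.eventually] with x' hx' u v
    exact hx'.metric.symm_at _ _
  pos := by
    filter_upwards [h.eventually, h.injective] with x' hx' hi v hv
    exact hx'.metric.pos_at _ fun h0 => hv (hi (h0.trans (map_zero _).symm))

/-- The tangential part of a vector. -/
noncomputable def tangPart (G : F → F →L[ℝ] F →L[ℝ] ℝ) (φ : E → F) (x : E) (w : F) : E :=
  (firstForm G φ x).inverse ((G (φ x) w).comp (fderiv ℝ φ x))

lemma normalProj_eq (w : F) : normalProj G φ x w = w - fderiv ℝ φ x (tangPart G φ x w) := rfl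

lemma IsImmersionNear.normalProj_apply_of_normal (h : IsImmersionNear G φ x) {ξ : F}
    (hξ : ∀ u, G (φ x) ξ (fderiv ℝ φ x u) = 0) (w : F) :
    G (φ x) (normalProj G φ x w) ξ = G (φ x) w ξ := by
  rw [normalProj_eq, map_sub, sub_apply, h.metric.symm_at (fderiv ℝ φ x _), hξ, sub_zero]

variable [FiniteDimensional ℝ E]

lemma IsImmersionNear.firstForm_tangPart (h : IsImmersionNear G φ x) (w : F) (u : E) :
    firstForm G φ x (tangPart G φ x w) u = G (φ x) w (fderiv ℝ φ x u) := by
  rw [tangPart, apply_inverse_of_pos h.firstForm_metric.pos_at]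
  rfl

lemma IsImmersionNear.normalProj_normal (h : IsImmersionNear G φ x) (w : F) (u : E) :
    G (φ x) (normalProj G φ x w) (fderiv ℝ φ x u) = 0 := by
  rw [normalProj_eq, map_sub, sub_apply, ← firstForm_apply (G := G), h.firstForm_tangPart, sub_self]

lemma IsImmersionNear.apply_eq (h : IsImmersionNear G φ x) (w z : F) :
    G (φ x) w z = firstForm G φ x (tangPart G φ x w) (tangPart G φ x z) +
      G (φ x) (normalProj G φ x w) (normalProj G φ x z) := by
  have hw : w = normalProj G φ x w + fderiv ℝ φ x (tangPart G φ x w) := by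
    rw [normalProj_eq]; abel
  have hz : z = normalProj G φ x z + fderiv ℝ φ x (tangPart G φ x z) := by
    rw [normalProj_eq]; abel
  conv_lhs => rw [hw, hz]
  simp only [map_add, add_apply]
  rw [h.normalProj_normal, h.metric.symm_at (fderiv ℝ φ x _) (normalProj G φ x z),
    h.normalProj_normal, firstForm_apply]
  ring

lemma IsImmersionNear.normalProj_of_normal (h : IsImmersionNear G φ x) {ξ : F}
    (hξ : ∀ u, G (φ x) ξ (fderiv ℝ φ x u) = 0) : normalProj G φ x ξ = ξ := by
  have : tangPart G φ x ξ = 0 := by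
    refine eq_of_forall_apply_eq h.firstForm_metric.pos_at fun z => ?_
    rw [h.firstForm_tangPart, hξ]; simp
  rw [normalProj_eq, this, map_zero, sub_zero]

lemma IsImmersionNear.contDiffAt_normalProj (h : IsImmersionNear G φ x) {V : E → F}
    (hV : ContDiffAt ℝ ∞ V x) : ContDiffAt ℝ ∞ (fun x' => normalProj G φ x' (V x')) x := by
  have hGφ : ContDiffAt ℝ ∞ (fun x' => G (φ x')) x := h.metric.smooth.comp x h.smooth
  have hφ := contDiffAt_fderiv h.smooth
  exact hV.sub (hφ.clm_apply ((contDiffAt_inverse_of_pos h.contDiffAt_firstForm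
    h.firstForm_metric.pos_at).clm_apply ((hGφ.clm_apply hV).clm_comp hφ)))

variable [FiniteDimensional ℝ F]

/-- The Levi-Civita connection of the first fundamental form is the tangential part of the ambient
connection. -/
lemma IsImmersionNear.covDeriv_firstForm (h : IsImmersionNear G φ x) (u v : E) :
    covDeriv (firstForm G φ) id (fun _ => v) x u =
      tangPart G φ x (covDeriv G φ (fun x' => fderiv ℝ φ x' v) x u) := by
  refine eq_of_forall_apply_eq h.firstForm_metric.pos_at fun z => ?_
  have hD : ∀ u v z, fderiv ℝ (firstForm G φ) x u v z =
      G (φ x) (covDeriv G φ (fun x' => fderiv ℝ φ x' v) x u) (fderiv ℝ φ x z) +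
        G (φ x) (fderiv ℝ φ x v) (covDeriv G φ (fun x' => fderiv ℝ φ x' z) x u) := by
    intro u v z
    rw [← fderiv_apply_apply h.contDiffAt_firstForm.diff,
      ← fderiv_metric h.metric h.smooth.diff (contDiffAt_fderiv_apply h.smooth v).diff
        (contDiffAt_fderiv_apply h.smooth z).diff]
    rfl
  have hc := covDeriv_fderiv_comm h.metric h.smooth
  rw [h.firstForm_tangPart]
  have h1 : covDeriv (firstForm G φ) id (fun _ => v) x u = christoffel (firstForm G φ) x u v := by
    simp [covDeriv]
  rw [h1, h.firstForm_metric.apply_christoffel, hD, hD, hD, hc v u, hc z u, hc z v,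
    h.metric.symm_at (fderiv ℝ φ x v)]
  ring

/-- The Gauss equation. -/
lemma IsImmersionNear.gauss (h : IsImmersionNear G φ x) (u v w z : E) :
    firstForm G φ x (curvature (firstForm G φ) x u v w) z =
      G (φ x) (curvature G (φ x) (fderiv ℝ φ x u) (fderiv ℝ φ x v) (fderiv ℝ φ x w))
        (fderiv ℝ φ x z) +
      (G (φ x) (secondForm G φ x v w) (secondForm G φ x u z) -
        G (φ x) (secondForm G φ x u w) (secondForm G φ x v z)) := by
  have key : ∀ u v, firstForm G φ x (covDeriv (firstForm G φ) id
      (fun x' => covDeriv (firstForm G φ) id (fun _ => w) x' v) x u) z =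
      G (φ x) (covDeriv G φ (fun x' => covDeriv G φ (fun x' => fderiv ℝ φ x' w) x' v) x u)
        (fderiv ℝ φ x z) + G (φ x) (secondForm G φ x v w) (secondForm G φ x u z) := by
    intro u v
    have hh : IsMetricNear (firstForm G φ) (id x) := h.firstForm_metric
    have hXw := contDiffAt_fderiv_apply h.smooth w
    have hXz := contDiffAt_fderiv_apply h.smooth z
    have h1 := fderiv_metric (V := fun x' => covDeriv (firstForm G φ) id (fun _ => w) x' v)
      (W := fun _ => z) hh differentiableAt_id
      (contDiffAt_covDeriv hh contDiffAt_id contDiffAt_const v).diff (differentiableAt_const z) u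
    have h2 : (fun x' => firstForm G φ (id x') (covDeriv (firstForm G φ) id (fun _ => w) x' v) z)
        =ᶠ[𝓝 x] fun x' => G (φ x') (covDeriv G φ (fun x' => fderiv ℝ φ x' w) x' v)
          (fderiv ℝ φ x' z) := by
      filter_upwards [h.eventually] with x' hx'
      rw [hx'.covDeriv_firstForm, id, hx'.firstForm_tangPart]
    rw [h2.fderiv_eq, fderiv_metric h.metric h.smooth.diff
      (contDiffAt_covDeriv h.metric h.smooth hXw v).diff hXz.diff,
      h.apply_eq (covDeriv G φ (fun x' => fderiv ℝ φ x' w) x v), h.covDeriv_firstForm,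
      h.covDeriv_firstForm] at h1
    simp only [id_eq, secondForm] at h1 ⊢
    linarith
  have hC := covDeriv_covDeriv_sub h.metric h.smooth (contDiffAt_fderiv_apply h.smooth w) u v
  rw [← hC, curvature, map_sub, sub_apply, key, key, map_sub, sub_apply]
  ring

/-- The tangential part of the derivative of a normal field. -/
lemma IsImmersionNear.firstForm_tangPart_covDeriv (h : IsImmersionNear G φ x) {ξ : F}
    (hξ : ∀ u, G (φ x) ξ (fderiv ℝ φ x u) = 0) (v z : E) :
    firstForm G φ x (tangPart G φ x (covDeriv G φ (fun x' => normalProj G φ x' ξ) x v)) z =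
      -G (φ x) (secondForm G φ x v z) ξ := by
  rw [h.firstForm_tangPart]
  have h1 : (fun x' => G (φ x') (normalProj G φ x' ξ) (fderiv ℝ φ x' z)) =ᶠ[𝓝 x] fun _ => 0 := by
    filter_upwards [h.eventually] with x' hx' using hx'.normalProj_normal ξ z
  have h2 := fderiv_metric h.metric h.smooth.diff (h.contDiffAt_normalProj contDiffAt_const).diff
    (contDiffAt_fderiv_apply h.smooth z).diff v (V := fun x' => normalProj G φ x' ξ)
  rw [h1.fderiv_eq, h.normalProj_of_normal hξ] at h2
  rw [secondForm, h.normalProj_apply_of_normal hξ, h.metric.symm_at _ ξ]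
  simp at h2
  linarith

/-- The Ricci equation. -/
lemma IsImmersionNear.ricci (h : IsImmersionNear G φ x) {ξ η : F}
    (hξ : ∀ u, G (φ x) ξ (fderiv ℝ φ x u) = 0) (hη : ∀ u, G (φ x) η (fderiv ℝ φ x u) = 0)
    (u v : E) : ∃ τ σ : E → E,
      (∀ v z, firstForm G φ x (τ v) z = -G (φ x) (secondForm G φ x v z) ξ) ∧
      (∀ v z, firstForm G φ x (σ v) z = -G (φ x) (secondForm G φ x v z) η) ∧
      G (φ x) (normalCurvature G φ x u v ξ) η =
        G (φ x) (curvature G (φ x) (fderiv ℝ φ x u) (fderiv ℝ φ x v) ξ) η +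
          (firstForm G φ x (τ v) (σ u) - firstForm G φ x (τ u) (σ v)) := by
  refine ⟨fun v => tangPart G φ x (covDeriv G φ (fun x' => normalProj G φ x' ξ) x v),
    fun v => tangPart G φ x (covDeriv G φ (fun x' => normalProj G φ x' η) x v),
    h.firstForm_tangPart_covDeriv hξ, h.firstForm_tangPart_covDeriv hη, ?_⟩
  have hΞ : ContDiffAt ℝ ∞ (fun x' => normalProj G φ x' ξ) x :=
    h.contDiffAt_normalProj contDiffAt_const
  have hH : ContDiffAt ℝ ∞ (fun x' => normalProj G φ x' η) x :=
    h.contDiffAt_normalProj contDiffAt_const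
  have key : ∀ u v, G (φ x) (normalCovDeriv G φ
      (fun x' => normalCovDeriv G φ (fun x'' => normalProj G φ x'' ξ) x' v) x u) η =
      G (φ x) (covDeriv G φ (fun x' => covDeriv G φ (fun x' => normalProj G φ x' ξ) x' v) x u) η +
        firstForm G φ x
          (tangPart G φ x (covDeriv G φ (fun x' => normalProj G φ x' ξ) x v))
          (tangPart G φ x (covDeriv G φ (fun x' => normalProj G φ x' η) x u)) := by
    intro u v
    have hY0 := contDiffAt_covDeriv h.metric h.smooth hΞ v
    have hY := h.contDiffAt_normalProj hY0
    have h1 : (fun x' => G (φ x') (normalProj G φ x'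
        (covDeriv G φ (fun x' => normalProj G φ x' ξ) x' v)) (normalProj G φ x' η)) =ᶠ[𝓝 x]
        fun x' => G (φ x') (covDeriv G φ (fun x' => normalProj G φ x' ξ) x' v)
          (normalProj G φ x' η) := by
      filter_upwards [h.eventually] with x' hx'
      exact hx'.normalProj_apply_of_normal (hx'.normalProj_normal η) _
    have h2 := fderiv_metric h.metric h.smooth.diff hY.diff hH.diff u
    have h3 : ∀ w z, G (φ x) (normalProj G φ x w) (normalProj G φ x z) =
        G (φ x) (normalProj G φ x w) z := fun w z => by
      rw [h.metric.symm_at, h.normalProj_apply_of_normal (h.normalProj_normal w),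
        h.metric.symm_at]
    rw [h1.fderiv_eq, fderiv_metric h.metric h.smooth.diff hY0.diff hH.diff u,
      h.normalProj_of_normal hη, h.apply_eq _ (covDeriv G φ (fun x' => normalProj G φ x' η) x u),
      h3] at h2
    rw [normalCovDeriv, h.normalProj_apply_of_normal hη]
    simp only [normalCovDeriv]
    linarith
  have hC := covDeriv_covDeriv_sub h.metric h.smooth hΞ u v
  rw [h.normalProj_of_normal hξ] at hC
  rw [← hC, normalCurvature, map_sub, sub_apply, key, key, map_sub, sub_apply]
  ring

end Immersion

end Coord

/-! ### From manifolds to coordinates -/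

section Chart

open Filter Topology Bundle

variable {d : ℕ} {X : Type*} [TopologicalSpace X] [ChartedSpace (EuclideanSpace ℝ (Fin d)) X]

/-- The differential of the inverse of the preferred chart around `x₀`. -/
noncomputable def chartSymmDeriv (x₀ : X) (y : EuclideanSpace ℝ (Fin d)) :
    EuclideanSpace ℝ (Fin d) →L[ℝ] TangentSpace (𝓡 d) ((extChartAt (𝓡 d) x₀).symm y) :=
  mfderiv 𝓘(ℝ, EuclideanSpace ℝ (Fin d)) (𝓡 d) (extChartAt (𝓡 d) x₀).symm y

lemma inChart_apply (T : BilinField d X) (x₀ : X) (y u v : EuclideanSpace ℝ (Fin d)) :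
    T.inChart x₀ y u v = T ((extChartAt (𝓡 d) x₀).symm y) (chartSymmDeriv x₀ y u)
      (chartSymmDeriv x₀ y v) := rfl

lemma BilinField.congr_apply (T : BilinField d X) {x x' : X} (hx : x = x')
    {u u' v v' : EuclideanSpace ℝ (Fin d)} (hu : u = u') (hv : v = v') : T x u v = T x' u' v' := by
  subst hx hu hv; rfl

variable [IsManifold (𝓡 d) ∞ X]

lemma contMDiffAt_extChartAt_symm {x₀ : X} {y : EuclideanSpace ℝ (Fin d)}
    (hy : y ∈ (extChartAt (𝓡 d) x₀).target) :
    ContMDiffAt 𝓘(ℝ, EuclideanSpace ℝ (Fin d)) (𝓡 d) ∞ (extChartAt (𝓡 d) x₀).symm y :=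
  (contMDiffOn_extChartAt_symm x₀).contMDiffAt (extChartAt_target_mem_nhds' hy)

lemma chartSymmDeriv_eq_symmL {x₀ x : X} (hx : x ∈ (chartAt (EuclideanSpace ℝ (Fin d)) x₀).source)
    (v : EuclideanSpace ℝ (Fin d)) :
    mfderiv 𝓘(ℝ, EuclideanSpace ℝ (Fin d)) (𝓡 d) (extChartAt (𝓡 d) x₀).symm
        (extChartAt (𝓡 d) x₀ x) v =
      (trivializationAt (EuclideanSpace ℝ (Fin d)) (TangentSpace (𝓡 d)) x₀).symm x v := by
  have : IsManifold (𝓡 d) 1 X := .of_le (n := ∞) (by norm_cast)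
  have h := TangentBundle.symmL_trivializationAt (I := 𝓡 d) hx
  rw [(𝓡 d).range_eq_univ, mfderivWithin_univ] at h
  rw [← Trivialization.symmL_apply _ (R := ℝ) (by simpa using hx)]
  exact (congrArg (fun A => A v) h).symm

lemma injective_chartSymmDeriv {x₀ : X} {y : EuclideanSpace ℝ (Fin d)}
    (hy : y ∈ (extChartAt (𝓡 d) x₀).target) : Function.Injective (chartSymmDeriv x₀ y) := by
  have : IsManifold (𝓡 d) 1 X := .of_le (n := ∞) (by norm_cast)
  have h := isInvertible_mfderivWithin_extChartAt_symm (I := 𝓡 d) hy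
  rw [(𝓡 d).range_eq_univ, mfderivWithin_univ] at h
  exact h.injective

lemma chartSymmDeriv_self (x₀ : X) (v : EuclideanSpace ℝ (Fin d)) :
    chartSymmDeriv x₀ (extChartAt (𝓡 d) x₀ x₀) v = v := by
  have : IsManifold (𝓡 d) 1 X := .of_le (n := ∞) (by norm_cast)
  have h := mfderivWithin_range_extChartAt_symm (I := 𝓡 d) (x := x₀)
  rw [(𝓡 d).range_eq_univ, mfderivWithin_univ] at h
  exact congrArg (fun A => A v) h

lemma inChart_self (T : BilinField d X) (x₀ : X) (u v : EuclideanSpace ℝ (Fin d)) :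
    T.inChart x₀ (extChartAt (𝓡 d) x₀ x₀) u v = T x₀ u v :=
  T.congr_apply (extChartAt_to_inv x₀) (chartSymmDeriv_self x₀ u) (chartSymmDeriv_self x₀ v)

variable (g : SmoothMetric d X)

lemma contDiffAt_inChart {x₀ : X} {y : EuclideanSpace ℝ (Fin d)}
    (hy : y ∈ (extChartAt (𝓡 d) x₀).target) :
    ContDiffAt ℝ ∞ (BilinField.inChart g.inner x₀) y := by
  have hsec : ∀ v : EuclideanSpace ℝ (Fin d), ContMDiffOn (𝓡 d) (𝓡 d).tangent ∞
      (fun b => TotalSpace.mk' (EuclideanSpace ℝ (Fin d)) b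
        ((trivializationAt (EuclideanSpace ℝ (Fin d)) (TangentSpace (𝓡 d)) x₀).symm b v))
      (chartAt (EuclideanSpace ℝ (Fin d)) x₀).source := by
    intro v
    have h := (trivializationAt (EuclideanSpace ℝ (Fin d))
      (TangentSpace (𝓡 d)) x₀).contMDiffOn_symm (n := ∞) (IB := 𝓡 d)
    refine (h.comp (f := fun b : X => (b, v)) (contMDiffOn_id.prodMk contMDiffOn_const)
      ?_).congr ?_
    · intro b hb
      rw [Set.mem_preimage, Trivialization.mem_target]
      simpa using hb
    · intro b hb
      exact Trivialization.mk_symm _ (by simpa using hb) v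
  have hsm : ∀ u v, ContDiffOn ℝ ∞ (fun y => BilinField.inChart g.inner x₀ y u v)
      (extChartAt (𝓡 d) x₀).target := by
    intro u v
    have h1 : ContMDiffOn (𝓡 d) ((𝓡 d).prod 𝓘(ℝ, ℝ)) ∞
        (fun b => TotalSpace.mk' ℝ (E := Trivial X ℝ) b (g.inner b
          ((trivializationAt (EuclideanSpace ℝ (Fin d)) (TangentSpace (𝓡 d)) x₀).symm b u)
          ((trivializationAt (EuclideanSpace ℝ (Fin d)) (TangentSpace (𝓡 d)) x₀).symm b v)))
        (chartAt (EuclideanSpace ℝ (Fin d)) x₀).source :=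
      ContMDiffOn.clm_bundle_apply₂ (F₃ := ℝ) (E₃ := Trivial X ℝ) g.contMDiff.contMDiffOn
        (hsec u) (hsec v)
    have h2 : ContMDiffOn (𝓡 d) 𝓘(ℝ, ℝ) ∞ (fun b => g.inner b
          ((trivializationAt (EuclideanSpace ℝ (Fin d)) (TangentSpace (𝓡 d)) x₀).symm b u)
          ((trivializationAt (EuclideanSpace ℝ (Fin d)) (TangentSpace (𝓡 d)) x₀).symm b v))
        (chartAt (EuclideanSpace ℝ (Fin d)) x₀).source := by
      intro b hb
      have h3 := h1 b hb
      rw [contMDiffWithinAt_totalSpace] at h3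
      simpa using! h3.2
    rw [← contMDiffOn_iff_contDiffOn]
    refine (h2.comp (contMDiffOn_extChartAt_symm x₀) ?_).congr ?_
    · intro z hz
      simpa using (extChartAt (𝓡 d) x₀).map_target hz
    · intro z hz
      have hz' : (extChartAt (𝓡 d) x₀).symm z ∈ (chartAt (EuclideanSpace ℝ (Fin d)) x₀).source := by
        simpa using (extChartAt (𝓡 d) x₀).map_target hz
      have h4 := chartSymmDeriv_eq_symmL hz'
      rw [(extChartAt (𝓡 d) x₀).right_inv hz] at h4
      simp only [Function.comp_apply]
      rw [← h4, ← h4]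
      rfl
  have h : ContDiffOn ℝ ∞ (BilinField.inChart g.inner x₀) (extChartAt (𝓡 d) x₀).target :=
    contDiffOn_clm_apply.2 fun u => contDiffOn_clm_apply.2 fun v => hsm u v
  exact h.contDiffAt (extChartAt_target_mem_nhds' hy)

lemma isMetricNear_inChart {x₀ : X} {y : EuclideanSpace ℝ (Fin d)}
    (hy : y ∈ (extChartAt (𝓡 d) x₀).target) :
    Coord.IsMetricNear (BilinField.inChart g.inner x₀) y where
  smooth_near := by
    filter_upwards [extChartAt_target_mem_nhds' hy] with z hz using contDiffAt_inChart g hz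
  symm := Eventually.of_forall fun z u v => by
    rw [inChart_apply, inChart_apply]
    exact g.symm _ (chartSymmDeriv x₀ z u) (chartSymmDeriv x₀ z v)
  pos := by
    filter_upwards [extChartAt_target_mem_nhds' hy] with z hz v hv
    rw [inChart_apply]
    exact g.pos _ (chartSymmDeriv x₀ z v) fun h0 =>
      hv ((map_eq_zero_iff _ (injective_chartSymmDeriv hz)).1 h0)

end Chart

section Immersion

open Filter Topology

variable {n m : ℕ}
  {M : Type*} [TopologicalSpace M] [ChartedSpace (EuclideanSpace ℝ (Fin n)) M]
  {N : Type*} [TopologicalSpace N] [ChartedSpace (EuclideanSpace ℝ (Fin (n + m))) N] {f : M → N}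

lemma writtenInExtChartAt_self (x : M) : writtenInExtChartAt (𝓡 n) (𝓡 (n + m)) x f
    (extChartAt (𝓡 n) x x) = extChartAt (𝓡 (n + m)) (f x) (f x) := by
  simp only [writtenInExtChartAt, Function.comp_apply, extChartAt_to_inv]

lemma writtenInExtChartAt_mem_target (x : M) {y : EuclideanSpace ℝ (Fin n)}
    (hy' : f ((extChartAt (𝓡 n) x).symm y) ∈ (extChartAt (𝓡 (n + m)) (f x)).source) :
    writtenInExtChartAt (𝓡 n) (𝓡 (n + m)) x f y ∈ (extChartAt (𝓡 (n + m)) (f x)).target :=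
  (extChartAt (𝓡 (n + m)) (f x)).map_source hy'

lemma mem_nhds_chart_preimage (hf : ContMDiff (𝓡 n) (𝓡 (n + m)) ∞ f) (x : M)
    {y : EuclideanSpace ℝ (Fin n)} (hy : y ∈ (extChartAt (𝓡 n) x).target)
    (hy' : f ((extChartAt (𝓡 n) x).symm y) ∈ (extChartAt (𝓡 (n + m)) (f x)).source) :
    ∀ᶠ z in 𝓝 y, z ∈ (extChartAt (𝓡 n) x).target ∧
      f ((extChartAt (𝓡 n) x).symm z) ∈ (extChartAt (𝓡 (n + m)) (f x)).source :=
  (eventually_mem_set.2 (extChartAt_target_mem_nhds' hy)).and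
    ((hf.continuous.continuousAt.comp (continuousAt_extChartAt_symm'' hy)).eventually
      ((isOpen_extChartAt_source (f x)).mem_nhds hy'))

lemma fderiv_writtenInExtChartAt_self (hf : ContMDiff (𝓡 n) (𝓡 (n + m)) ∞ f) (x : M)
    (u : EuclideanSpace ℝ (Fin n)) :
    fderiv ℝ (writtenInExtChartAt (𝓡 n) (𝓡 (n + m)) x f) (extChartAt (𝓡 n) x x) u =
      mfderiv (𝓡 n) (𝓡 (n + m)) f x u := by
  have h : MDifferentiableAt (𝓡 n) (𝓡 (n + m)) f x :=
    hf.contMDiffAt.mdifferentiableAt (by simp)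
  have h1 : fderivWithin ℝ (writtenInExtChartAt (𝓡 n) (𝓡 (n + m)) x f) (Set.range (𝓡 n))
      (extChartAt (𝓡 n) x x) =
        fderiv ℝ (writtenInExtChartAt (𝓡 n) (𝓡 (n + m)) x f) (extChartAt (𝓡 n) x x) := by
    rw [(𝓡 n).range_eq_univ, fderivWithin_univ]
  exact (congrArg (fun A : EuclideanSpace ℝ (Fin n) →L[ℝ] EuclideanSpace ℝ (Fin (n + m)) => A u)
    (h.mfderiv.trans h1)).symm

variable [IsManifold (𝓡 (n + m)) ∞ N]

lemma inChart_writtenInExtChartAt_self (T : BilinField (n + m) N) (x : M)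
    (u v : EuclideanSpace ℝ (Fin (n + m))) :
    T.inChart (f x) (writtenInExtChartAt (𝓡 n) (𝓡 (n + m)) x f (extChartAt (𝓡 n) x x)) u v =
      T (f x) u v := by
  rw [writtenInExtChartAt_self, inChart_self]

lemma inducedMetric_eq_firstForm (hf : ContMDiff (𝓡 n) (𝓡 (n + m)) ∞ f)
    (T : BilinField (n + m) N) (x : M) (u v : EuclideanSpace ℝ (Fin n)) :
    inducedMetric T f x u v = Coord.firstForm (T.inChart (f x))
      (writtenInExtChartAt (𝓡 n) (𝓡 (n + m)) x f) (extChartAt (𝓡 n) x x) u v := by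
  rw [Coord.firstForm_apply, inChart_writtenInExtChartAt_self]
  exact (T.congr_apply rfl (fderiv_writtenInExtChartAt_self hf x u)
    (fderiv_writtenInExtChartAt_self hf x v)).symm

lemma isNormalVector_iff (hf : ContMDiff (𝓡 n) (𝓡 (n + m)) ∞ f)
    (T : BilinField (n + m) N) (x : M) (ξ : EuclideanSpace ℝ (Fin (n + m))) :
    IsNormalVector T f x ξ ↔ ∀ u, T.inChart (f x)
      (writtenInExtChartAt (𝓡 n) (𝓡 (n + m)) x f (extChartAt (𝓡 n) x x)) ξ
      (fderiv ℝ (writtenInExtChartAt (𝓡 n) (𝓡 (n + m)) x f) (extChartAt (𝓡 n) x x) u) = 0 := by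
  refine forall_congr' fun u => ?_
  rw [inChart_writtenInExtChartAt_self]
  exact iff_of_eq (congrArg (· = 0)
    (T.congr_apply rfl rfl (fderiv_writtenInExtChartAt_self hf x u))).symm

variable [IsManifold (𝓡 n) ∞ M]

lemma contDiffAt_writtenInExtChartAt (hf : ContMDiff (𝓡 n) (𝓡 (n + m)) ∞ f) (x : M)
    {y : EuclideanSpace ℝ (Fin n)} (hy : y ∈ (extChartAt (𝓡 n) x).target)
    (hy' : f ((extChartAt (𝓡 n) x).symm y) ∈ (extChartAt (𝓡 (n + m)) (f x)).source) :
    ContDiffAt ℝ ∞ (writtenInExtChartAt (𝓡 n) (𝓡 (n + m)) x f) y := by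
  rw [← contMDiffAt_iff_contDiffAt]
  refine ContMDiffAt.comp y (contMDiffAt_extChartAt' (by simpa using hy')) ?_
  exact hf.contMDiffAt.comp y (contMDiffAt_extChartAt_symm hy)

/-- The chain rule for `f` read in charts. -/
lemma chartSymmDeriv_fderiv_writtenInExtChartAt (hf : ContMDiff (𝓡 n) (𝓡 (n + m)) ∞ f) (x : M)
    {y : EuclideanSpace ℝ (Fin n)} (hy : y ∈ (extChartAt (𝓡 n) x).target)
    (hy' : f ((extChartAt (𝓡 n) x).symm y) ∈ (extChartAt (𝓡 (n + m)) (f x)).source)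
    (u : EuclideanSpace ℝ (Fin n)) :
    (chartSymmDeriv (f x) (writtenInExtChartAt (𝓡 n) (𝓡 (n + m)) x f y)
        (fderiv ℝ (writtenInExtChartAt (𝓡 n) (𝓡 (n + m)) x f) y u) :
          EuclideanSpace ℝ (Fin (n + m))) =
      mfderiv (𝓡 n) (𝓡 (n + m)) f ((extChartAt (𝓡 n) x).symm y) (chartSymmDeriv x y u) := by
  have h : (extChartAt (𝓡 (n + m)) (f x)).symm ∘ writtenInExtChartAt (𝓡 n) (𝓡 (n + m)) x f =ᶠ[𝓝 y]
      f ∘ (extChartAt (𝓡 n) x).symm := by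
    filter_upwards [mem_nhds_chart_preimage hf x hy hy'] with z hz
    exact (extChartAt (𝓡 (n + m)) (f x)).left_inv hz.2
  have h1 := h.mfderiv_eq (I := 𝓘(ℝ, EuclideanSpace ℝ (Fin n))) (I' := 𝓡 (n + m))
  have hne : (∞ : WithTop ℕ∞) ≠ 0 := by simp
  have hφ := contDiffAt_writtenInExtChartAt hf x hy hy'
  have h2 := mfderiv_comp y
    ((contMDiffAt_extChartAt_symm (writtenInExtChartAt_mem_target x hy')).mdifferentiableAt hne)
    (hφ.contMDiffAt.mdifferentiableAt hne)
  have h3 := mfderiv_comp y (hf.contMDiffAt.mdifferentiableAt hne)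
    ((contMDiffAt_extChartAt_symm hy).mdifferentiableAt hne)
  rw [mfderiv_eq_fderiv] at h2
  have h4 := h2.symm.trans (h1.trans h3)
  exact congrArg (fun A : EuclideanSpace ℝ (Fin n) →L[ℝ] EuclideanSpace ℝ (Fin (n + m)) => A u) h4

lemma isImmersionNear (hf : IsSmoothImmersion (n := n) (m := m) f) (g : SmoothMetric (n + m) N)
    (x : M) :
    Coord.IsImmersionNear (BilinField.inChart g.inner (f x))
      (writtenInExtChartAt (𝓡 n) (𝓡 (n + m)) x f) (extChartAt (𝓡 n) x x) := by
  have hx0 : f ((extChartAt (𝓡 n) x).symm (extChartAt (𝓡 n) x x)) ∈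
      (extChartAt (𝓡 (n + m)) (f x)).source := by
    rw [extChartAt_to_inv]; exact mem_extChartAt_source _
  have hnear := mem_nhds_chart_preimage hf.1 x (mem_extChartAt_target x) hx0
  refine ⟨isMetricNear_inChart g (writtenInExtChartAt_mem_target x hx0), ?_, ?_⟩
  · filter_upwards [hnear] with y hy using contDiffAt_writtenInExtChartAt hf.1 x hy.1 hy.2
  · filter_upwards [hnear] with y hy
    intro u v huv
    have hu := chartSymmDeriv_fderiv_writtenInExtChartAt hf.1 x hy.1 hy.2 u
    have hv := chartSymmDeriv_fderiv_writtenInExtChartAt hf.1 x hy.1 hy.2 v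
    rw [huv] at hu
    exact injective_chartSymmDeriv hy.1 (hf.2 _ (hu.symm.trans hv))

/-- The induced metric read in a chart is the first fundamental form. -/
lemma inChart_inducedMetric (hf : ContMDiff (𝓡 n) (𝓡 (n + m)) ∞ f) (T : BilinField (n + m) N)
    (x : M) : BilinField.inChart (inducedMetric T f) x =ᶠ[𝓝 (extChartAt (𝓡 n) x x)]
      Coord.firstForm (T.inChart (f x)) (writtenInExtChartAt (𝓡 n) (𝓡 (n + m)) x f) := by
  have hx0 : f ((extChartAt (𝓡 n) x).symm (extChartAt (𝓡 n) x x)) ∈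
      (extChartAt (𝓡 (n + m)) (f x)).source := by
    rw [extChartAt_to_inv]; exact mem_extChartAt_source _
  filter_upwards [mem_nhds_chart_preimage hf x (mem_extChartAt_target x) hx0] with y hy
  ext1 u
  ext1 v
  exact (T.congr_apply ((extChartAt (𝓡 (n + m)) (f x)).left_inv hy.2)
    (chartSymmDeriv_fderiv_writtenInExtChartAt hf x hy.1 hy.2 u)
    (chartSymmDeriv_fderiv_writtenInExtChartAt hf x hy.1 hy.2 v)).symm

end Immersion

namespace Coord

open Filter Topology

variable {F : Type*} [NormedAddCommGroup F] [NormedSpace ℝ F]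

lemma christoffel_congr {G G' : F → F →L[ℝ] F →L[ℝ] ℝ} {y : F} (h : G =ᶠ[𝓝 y] G') (u v : F) :
    christoffel G y u v = christoffel G' y u v := by
  rw [christoffel, christoffel, h.fderiv_eq, h.eq_of_nhds]

lemma curvature_congr {G G' : F → F →L[ℝ] F →L[ℝ] ℝ} {y : F} (h : G =ᶠ[𝓝 y] G') (u v w : F) :
    curvature G y u v w = curvature G' y u v w := by
  have h1 : ∀ v, (fun y' => covDeriv G id (fun _ => w) y' v) =ᶠ[𝓝 y]
      fun y' => covDeriv G' id (fun _ => w) y' v := by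
    intro v
    filter_upwards [h.eventually_nhds] with z hz
    simp only [covDeriv, id_eq]
    rw [christoffel_congr hz]
  simp only [curvature]
  simp only [covDeriv, id_eq] at h1 ⊢
  rw [(h1 v).fderiv_eq, (h1 u).fderiv_eq]
  simp only [christoffel_congr h]

end Coord

/-- The ambient curvature in constant sectional curvature. -/
lemma curvature_inChart_of_constant {d : ℕ} {X : Type*} [TopologicalSpace X]
    [ChartedSpace (EuclideanSpace ℝ (Fin d)) X] [IsManifold (𝓡 d) ∞ X] (g : SmoothMetric d X)
    {κ : ℝ} (hg : HasConstantSectionalCurvature g.inner κ) (z : X)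
    (u v w t : EuclideanSpace ℝ (Fin d)) :
    BilinField.inChart g.inner z (extChartAt (𝓡 d) z z)
      (Coord.curvature (BilinField.inChart g.inner z) (extChartAt (𝓡 d) z z) u v w) t =
      κ * (g.inner z v w * g.inner z u t - g.inner z u w * g.inner z v t) := by
  rw [(isMetricNear_inChart g (mem_extChartAt_target z)).curvature_of_constant (κ := κ)]
  · simp only [inChart_self]
  · intro u v
    simp only [inChart_self]
    exact hg z u v

/-! ### Orthonormal frames of a bilinear form -/

section Frames

variable {V : Type*} [NormedAddCommGroup V] [NormedSpace ℝ V] [FiniteDimensional ℝ V]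
  {ι : Type*} [Fintype ι] [DecidableEq ι]

lemma eq_sum_of_orthonormal {B : V →L[ℝ] V →L[ℝ] ℝ} {e : ι → V}
    (he : ∀ i j, B (e i) (e j) = if i = j then 1 else 0)
    (hc : Fintype.card ι = Module.finrank ℝ V) (a : V) : a = ∑ i, B a (e i) • e i := by
  have hcoef : ∀ (c : ι → ℝ) j, B (∑ i, c i • e i) (e j) = c j := by
    intro c j
    simp [map_sum, he]
  have hli : LinearIndependent ℝ e := by
    rw [Fintype.linearIndependent_iff]
    intro c hc i
    rw [← hcoef c i, hc]
    simp
  have ha := (basisOfLinearIndependentOfCardEqFinrank' e hli hc).sum_repr a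
  simp only [coe_basisOfLinearIndependentOfCardEqFinrank'] at ha
  generalize (basisOfLinearIndependentOfCardEqFinrank' e hli hc).repr a = c at ha
  have h := hcoef c
  rw [ha] at h
  simp_rw [h]
  exact ha.symm

lemma apply_eq_sum_of_orthonormal {B : V →L[ℝ] V →L[ℝ] ℝ} {e : ι → V}
    (he : ∀ i j, B (e i) (e j) = if i = j then 1 else 0)
    (hc : Fintype.card ι = Module.finrank ℝ V) (a b : V) :
    B a b = ∑ i, B a (e i) * B b (e i) := by
  conv_lhs => rw [eq_sum_of_orthonormal he hc b]
  simp only [map_sum, map_smul, smul_eq_mul]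
  exact Finset.sum_congr rfl fun k _ => mul_comm _ _

lemma exists_orthonormal_of_le_finrank {B : V →L[ℝ] V →L[ℝ] ℝ} (hs : ∀ u v, B u v = B v u)
    (hpos : ∀ v, v ≠ 0 → 0 < B v v) (W : Submodule ℝ V) {k : ℕ} (hk : k ≤ Module.finrank ℝ W) :
    ∃ e : Fin k → V, (∀ i, e i ∈ W) ∧ ∀ i j, B (e i) (e j) = if i = j then 1 else 0 := by
  let b : LinearMap.BilinForm ℝ W :=
    LinearMap.mk₂ ℝ (fun u v : W => B u v) (by intros; simp) (by intros; simp) (by intros; simp)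
      (by intros; simp)
  have hb : ∀ u v : W, b u v = B u v := fun u v => rfl
  obtain ⟨v, hv⟩ := LinearMap.BilinForm.exists_orthogonal_basis (B := b)
    ⟨fun u v => by simp [hb, hs (u : V) v]⟩
  have hvp : ∀ i, 0 < B (v i) (v i) := fun i => hpos _ fun h => v.ne_zero i (Subtype.ext h)
  refine ⟨fun i => (√(B (v (Fin.castLE hk i)) (v (Fin.castLE hk i))))⁻¹ • (v (Fin.castLE hk i) : V),
    fun i => W.smul_mem _ (v _).2, fun i j => ?_⟩
  simp only [map_smul, smul_apply, smul_eq_mul]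
  split_ifs with h
  · subst h
    have h1 := hvp (Fin.castLE hk i)
    have h2 := Real.mul_self_sqrt h1.le
    have h3 := (Real.sqrt_pos.2 h1).ne'
    field_simp
    rw [pow_two, h2]
  · have h1 : B (v (Fin.castLE hk i)) (v (Fin.castLE hk j)) = 0 :=
      hv (by simpa [Fin.ext_iff] using h)
    rw [h1]
    simp

end Frames

namespace Coord

variable {E F : Type*} [NormedAddCommGroup E] [NormedSpace ℝ E]
  [NormedAddCommGroup F] [NormedSpace ℝ F] {G : F → F →L[ℝ] F →L[ℝ] ℝ} {φ : E → F} {x : E}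

/-- The full second covariant derivative `∇_u (dφ v)` of `φ`. -/
noncomputable def hessian (G : F → F →L[ℝ] F →L[ℝ] ℝ) (φ : E → F) (x : E) : E →L[ℝ] E →L[ℝ] F :=
  fderiv ℝ (fderiv ℝ φ) x + (christoffelL G (φ x)).bilinearComp (fderiv ℝ φ x) (fderiv ℝ φ x)

lemma IsImmersionNear.hessian_apply (h : IsImmersionNear G φ x) (u v : E) :
    hessian G φ x u v = covDeriv G φ (fun x' => fderiv ℝ φ x' v) x u := by
  rw [covDeriv, fderiv_clm_apply (contDiffAt_fderiv h.smooth).diff (differentiableAt_const v)]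
  simp [hessian, christoffelL_apply]

variable [FiniteDimensional ℝ F]

lemma IsImmersionNear.hessian_comm (h : IsImmersionNear G φ x) (u v : E) :
    hessian G φ x u v = hessian G φ x v u := by
  rw [h.hessian_apply, h.hessian_apply, covDeriv_fderiv_comm h.metric h.smooth]

end Coord

section Pointwise

variable {n m : ℕ}
  {M : Type*} [TopologicalSpace M] [ChartedSpace (EuclideanSpace ℝ (Fin n)) M]
  {N : Type*} [TopologicalSpace N] [ChartedSpace (EuclideanSpace ℝ (Fin (n + m))) N]
  [IsManifold (𝓡 (n + m)) ∞ N] {f : M → N} {g : SmoothMetric (n + m) N}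

lemma inducedMetric_eq_sum {x : M} {e : Fin n → TangentSpace (𝓡 n) x}
    (he : IsTangentFrame g.inner f x e) (a b : EuclideanSpace ℝ (Fin n)) :
    inducedMetric g.inner f x a b =
      ∑ k, inducedMetric g.inner f x a (e k) * inducedMetric g.inner f x b (e k) :=
  apply_eq_sum_of_orthonormal (V := EuclideanSpace ℝ (Fin n)) (B := inducedMetric g.inner f x)
    he (by simp) a b

/-- A tangent frame and a normal frame together form a frame of the ambient tangent space. -/
lemma isOrthonormal_sumElim {x : M} {e : Fin n → TangentSpace (𝓡 n) x}
    (he : IsTangentFrame g.inner f x e) {ξ : Fin m → TangentSpace (𝓡 (n + m)) (f x)}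
    (hξ : IsNormalFrame g.inner f x ξ) (i j : Fin n ⊕ Fin m) :
    g.inner (f x) (Sum.elim (fun i => mfderiv (𝓡 n) (𝓡 (n + m)) f x (e i)) ξ i)
      (Sum.elim (fun i => mfderiv (𝓡 n) (𝓡 (n + m)) f x (e i)) ξ j) = if i = j then 1 else 0 := by
  rcases i with i | i <;> rcases j with j | j
  · exact (he i j).trans (by simp)
  · simpa using (g.symm _ _ _).trans (hξ.1 j (e i))
  · simpa using hξ.1 i (e j)
  · simpa using hξ.2 i j

lemma inner_eq_sum_of_normal {x : M} {e : Fin n → TangentSpace (𝓡 n) x}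
    (he : IsTangentFrame g.inner f x e) {ξ : Fin m → TangentSpace (𝓡 (n + m)) (f x)}
    (hξ : IsNormalFrame g.inner f x ξ) {a : EuclideanSpace ℝ (Fin (n + m))}
    (ha : IsNormalVector g.inner f x a) (b : EuclideanSpace ℝ (Fin (n + m))) :
    g.inner (f x) a b = ∑ r, g.inner (f x) a (ξ r) * g.inner (f x) b (ξ r) := by
  have h := apply_eq_sum_of_orthonormal (V := EuclideanSpace ℝ (Fin (n + m)))
    (B := g.inner (f x)) (isOrthonormal_sumElim he hξ) (by simp) a b
  rw [Fintype.sum_sum_type] at h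
  refine h.trans ((congrArg (· + _) (Finset.sum_eq_zero fun i _ => ?_)).trans (zero_add _))
  exact mul_eq_zero_of_left (ha (e i)) _

lemma eq_sum_of_normalFrame {x : M} {e : Fin n → TangentSpace (𝓡 n) x}
    (he : IsTangentFrame g.inner f x e) {ξ : Fin m → TangentSpace (𝓡 (n + m)) (f x)}
    (hξ : IsNormalFrame g.inner f x ξ) {a : EuclideanSpace ℝ (Fin (n + m))}
    (ha : IsNormalVector g.inner f x a) : a = ∑ r, g.inner (f x) a (ξ r) • ξ r := by
  have h := eq_sum_of_orthonormal (V := EuclideanSpace ℝ (Fin (n + m)))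
    (B := g.inner (f x)) (isOrthonormal_sumElim he hξ) (by simp) a
  rw [Fintype.sum_sum_type] at h
  refine h.trans ((congrArg (· + _) (Finset.sum_eq_zero fun i _ => ?_)).trans (zero_add _))
  exact smul_eq_zero_of_left (ha (e i)) _

/-- Normal frames exist. -/
lemma exists_normalFrame (g : SmoothMetric (n + m) N) (f : M → N) (x : M) :
    ∃ ξ : Fin m → TangentSpace (𝓡 (n + m)) (f x), IsNormalFrame g.inner f x ξ := by
  let B : EuclideanSpace ℝ (Fin (n + m)) →L[ℝ] EuclideanSpace ℝ (Fin (n + m)) →L[ℝ] ℝ :=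
    g.inner (f x)
  let L : EuclideanSpace ℝ (Fin n) →L[ℝ] EuclideanSpace ℝ (Fin (n + m)) :=
    mfderiv (𝓡 n) (𝓡 (n + m)) f x
  let K : EuclideanSpace ℝ (Fin (n + m)) →ₗ[ℝ] Module.Dual ℝ (EuclideanSpace ℝ (Fin n)) :=
    LinearMap.mk₂ ℝ (fun ξ u => B ξ (L u)) (by intros; simp) (by intros; simp) (by intros; simp)
      (by intros; simp)
  have h1 := K.finrank_range_add_finrank_ker
  have h2 := Submodule.finrank_le (LinearMap.range K)
  rw [Subspace.dual_finrank_eq, finrank_euclideanSpace_fin] at h2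
  rw [finrank_euclideanSpace_fin] at h1
  obtain ⟨ξ, hξ1, hξ2⟩ := exists_orthonormal_of_le_finrank (B := B) (g.symm (f x)) (g.pos (f x))
    (LinearMap.ker K) (k := m) (by omega)
  exact ⟨ξ, fun r u => congrArg (fun A => A u) (LinearMap.mem_ker.1 (hξ1 r)), hξ2⟩

variable [IsManifold (𝓡 n) ∞ M]

lemma exists_hessian (hf : IsSmoothImmersion (n := n) (m := m) f) (g : SmoothMetric (n + m) N)
    (x : M) : ∃ H : EuclideanSpace ℝ (Fin n) →L[ℝ] EuclideanSpace ℝ (Fin n) →L[ℝ]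
      EuclideanSpace ℝ (Fin (n + m)), (∀ u v, H u v = H v u) ∧
        ∀ ξ : EuclideanSpace ℝ (Fin (n + m)), IsNormalVector g.inner f x ξ →
        ∀ u v : EuclideanSpace ℝ (Fin n),
          g.inner (f x) (secondFundamentalForm g.inner f x u v) ξ = g.inner (f x) (H u v) ξ := by
  have h := isImmersionNear hf g x
  refine ⟨_, h.hessian_comm, fun ξ hξ u v => ?_⟩
  replace hξ := (isNormalVector_iff hf.1 _ _ _).1 hξ
  have h1 := h.normalProj_apply_of_normal hξ
    (Coord.covDeriv (BilinField.inChart g.inner (f x)) (writtenInExtChartAt (𝓡 n) (𝓡 (n + m)) x f)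
      (fun x' => fderiv ℝ (writtenInExtChartAt (𝓡 n) (𝓡 (n + m)) x f) x' v)
      (extChartAt (𝓡 n) x x) u)
  refine (inChart_writtenInExtChartAt_self g.inner x _ ξ).symm.trans
    (h1.trans ?_)
  rw [← h.hessian_apply]
  exact inChart_writtenInExtChartAt_self g.inner x _ ξ

lemma isNormalVector_secondFundamentalForm (hf : IsSmoothImmersion (n := n) (m := m) f)
    (g : SmoothMetric (n + m) N) (x : M) (u v : TangentSpace (𝓡 n) x) :
    IsNormalVector g.inner f x (secondFundamentalForm g.inner f x u v) :=
  (isNormalVector_iff hf.1 _ _ _).2 fun w => (isImmersionNear hf g x).normalProj_normal _ w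

/-- The Gauss equation in a space of constant sectional curvature. -/
lemma gauss_equation {κ : ℝ} (hg : HasConstantSectionalCurvature (d := n + m) g.inner κ)
    (hf : IsSmoothImmersion (n := n) (m := m) f) (x : M) (u v w z : EuclideanSpace ℝ (Fin n)) :
    inducedMetric g.inner f x (riemannCurvature (inducedMetric g.inner f) x u v w) z =
      κ * (inducedMetric g.inner f x v w * inducedMetric g.inner f x u z -
        inducedMetric g.inner f x u w * inducedMetric g.inner f x v z) +
      (g.inner (f x) (secondFundamentalForm g.inner f x v w)
          (secondFundamentalForm g.inner f x u z) -
        g.inner (f x) (secondFundamentalForm g.inner f x u w)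
          (secondFundamentalForm g.inner f x v z)) := by
  have h := (isImmersionNear hf g x).gauss u v w z
  have hR : riemannCurvature (inducedMetric g.inner f) x u v w = _ :=
    Coord.curvature_congr (inChart_inducedMetric hf.1 g.inner x) u v w
  have hc := curvature_inChart_of_constant g hg (f x)
  rw [← writtenInExtChartAt_self x] at hc
  rw [hc, ← inducedMetric_eq_firstForm hf.1, inChart_writtenInExtChartAt_self,
    inChart_writtenInExtChartAt_self, ← hR] at h
  simp only [inducedMetric_eq_firstForm hf.1 g.inner x, Coord.firstForm_apply,
    inChart_writtenInExtChartAt_self] at h ⊢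
  exact h

/-- The Ricci equation in a space of constant sectional curvature. -/
lemma ricci_equation {κ : ℝ} (hg : HasConstantSectionalCurvature (d := n + m) g.inner κ)
    (hf : IsSmoothImmersion (n := n) (m := m) f) (x : M) {ξ η : EuclideanSpace ℝ (Fin (n + m))}
    (hξ : IsNormalVector g.inner f x ξ) (hη : IsNormalVector g.inner f x η)
    (u v : EuclideanSpace ℝ (Fin n)) :
    ∃ τ σ : EuclideanSpace ℝ (Fin n) → EuclideanSpace ℝ (Fin n),
      (∀ v z, inducedMetric g.inner f x (τ v) z =
        -g.inner (f x) (secondFundamentalForm g.inner f x v z) ξ) ∧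
      (∀ v z, inducedMetric g.inner f x (σ v) z =
        -g.inner (f x) (secondFundamentalForm g.inner f x v z) η) ∧
      g.inner (f x) (normalCurvature g.inner f x u v ξ) η =
        inducedMetric g.inner f x (τ v) (σ u) - inducedMetric g.inner f x (τ u) (σ v) := by
  have hξ' := (isNormalVector_iff hf.1 _ _ _).1 hξ
  have hη' := (isNormalVector_iff hf.1 _ _ _).1 hη
  obtain ⟨τ, σ, h1, h2, h3⟩ := (isImmersionNear hf g x).ricci hξ' hη' u v
  have hc := curvature_inChart_of_constant g hg (f x)
  rw [← writtenInExtChartAt_self x] at hc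
  refine ⟨τ, σ, fun v z => ?_, fun v z => ?_, ?_⟩
  · exact (inducedMetric_eq_firstForm hf.1 g.inner x _ _).trans
      ((h1 v z).trans (congrArg Neg.neg (inChart_writtenInExtChartAt_self g.inner x _ _)))
  · exact (inducedMetric_eq_firstForm hf.1 g.inner x _ _).trans
      ((h2 v z).trans (congrArg Neg.neg (inChart_writtenInExtChartAt_self g.inner x _ _)))
  · rw [hc, ← inducedMetric_eq_firstForm hf.1, ← inducedMetric_eq_firstForm hf.1,
      inChart_writtenInExtChartAt_self] at h3
    simp only [inChart_writtenInExtChartAt_self] at hξ' hη'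
    have hs := g.symm (f x)
    refine h3.trans ?_
    have e1 : ∀ u, g.inner (f x) (fderiv ℝ (writtenInExtChartAt (𝓡 n) (𝓡 (n + m)) x f)
        (extChartAt (𝓡 n) x x) u) ξ = 0 := fun u => (hs _ _).trans (hξ' u)
    have e2 : κ * (g.inner (f x) (fderiv ℝ (writtenInExtChartAt (𝓡 n) (𝓡 (n + m)) x f)
        (extChartAt (𝓡 n) x x) v) ξ * g.inner (f x) (fderiv ℝ
          (writtenInExtChartAt (𝓡 n) (𝓡 (n + m)) x f) (extChartAt (𝓡 n) x x) u) η -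
        g.inner (f x) (fderiv ℝ (writtenInExtChartAt (𝓡 n) (𝓡 (n + m)) x f)
        (extChartAt (𝓡 n) x x) u) ξ * g.inner (f x) (fderiv ℝ
          (writtenInExtChartAt (𝓡 n) (𝓡 (n + m)) x f) (extChartAt (𝓡 n) x x) v) η) = 0 := by
      rw [e1, e1]; ring
    exact (congrArg (· + _) e2).trans (zero_add _)

end Pointwise

section Formulas

open Matrix

variable {n m : ℕ}
  {M : Type*} [TopologicalSpace M] [ChartedSpace (EuclideanSpace ℝ (Fin n)) M]
  [IsManifold (𝓡 n) ∞ M]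
  {N : Type*} [TopologicalSpace N] [ChartedSpace (EuclideanSpace ℝ (Fin (n + m))) N]
  [IsManifold (𝓡 (n + m)) ∞ N] {f : M → N} {g : SmoothMetric (n + m) N} {κ : ℝ}

lemma shapeMatrix_isSymm (hf : IsSmoothImmersion (n := n) (m := m) f) {x : M}
    (e : Fin n → TangentSpace (𝓡 n) x) {ξ : EuclideanSpace ℝ (Fin (n + m))}
    (hξ : IsNormalVector g.inner f x ξ) : (shapeMatrix g.inner f x e ξ).IsSymm := by
  obtain ⟨H, hH, hII⟩ := exists_hessian hf g x
  ext i j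
  have h : ∀ w w' : EuclideanSpace ℝ (Fin (n + m)), w = w' →
      g.inner (f x) w ξ = g.inner (f x) w' ξ := fun w w' h => by rw [h]
  exact (hII ξ hξ _ _).trans ((h _ _ (hH _ _)).trans (hII ξ hξ _ _).symm)

lemma gauss_frame (hg : HasConstantSectionalCurvature (d := n + m) g.inner κ)
    (hf : IsSmoothImmersion (n := n) (m := m) f) {x : M} {e : Fin n → TangentSpace (𝓡 n) x}
    (he : IsTangentFrame g.inner f x e) {ξ : Fin m → TangentSpace (𝓡 (n + m)) (f x)}
    (hξ : IsNormalFrame g.inner f x ξ) {i j : Fin n} (hij : i ≠ j) :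
    inducedMetric g.inner f x (riemannCurvature (inducedMetric g.inner f) x (e i) (e j) (e j))
        (e i) =
      κ + ∑ r, (shapeMatrix g.inner f x e (ξ r) i i * shapeMatrix g.inner f x e (ξ r) j j -
        shapeMatrix g.inner f x e (ξ r) i j ^ 2) := by
  have hII := isNormalVector_secondFundamentalForm hf g x
  set A := fun r => shapeMatrix g.inner f x e (ξ r) with hA
  have hP : ∀ i j k l, g.inner (f x) (secondFundamentalForm g.inner f x (e i) (e j))
      (secondFundamentalForm g.inner f x (e k) (e l)) = ∑ r, A r i j * A r k l :=
    fun i j k l => inner_eq_sum_of_normal he hξ (hII _ _) _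
  have aux : ∀ {X a b c d P Q : ℝ}, X = κ * (a * b - c * d) + (P - Q) → a = 1 → b = 1 → c = 0 →
      X = κ + (P - Q) := by
    rintro X a b c d P Q h rfl rfl rfl
    rw [h]; ring
  refine (aux (gauss_equation hg hf x (e i) (e j) (e j) (e i)) ((he j j).trans (if_pos rfl))
    ((he i i).trans (if_pos rfl)) ((he i j).trans (if_neg hij))).trans ?_
  have hs : ∀ r, A r j i = A r i j := fun r => (shapeMatrix_isSymm hf e (hξ.1 r)).apply i j
  refine (congrArg (κ + ·) (congrArg₂ (· - ·) (hP j j i i) (hP i j j i))).trans ?_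
  simp only [← Finset.sum_sub_distrib, hs]
  congr 1
  exact Finset.sum_congr rfl fun r _ => by ring

lemma ricci_frame (hg : HasConstantSectionalCurvature (d := n + m) g.inner κ)
    (hf : IsSmoothImmersion (n := n) (m := m) f) {x : M} {e : Fin n → TangentSpace (𝓡 n) x}
    (he : IsTangentFrame g.inner f x e) {ξ : Fin m → TangentSpace (𝓡 (n + m)) (f x)}
    (hξ : IsNormalFrame g.inner f x ξ) (i j : Fin n) (r s : Fin m) :
    g.inner (f x) (normalCurvature g.inner f x (e i) (e j) (ξ r)) (ξ s) =
      (shapeMatrix g.inner f x e (ξ s) * shapeMatrix g.inner f x e (ξ r) -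
        shapeMatrix g.inner f x e (ξ r) * shapeMatrix g.inner f x e (ξ s)) i j := by
  obtain ⟨τ, σ, hτ, hσ, h⟩ := ricci_equation hg hf x (hξ.1 r) (hξ.1 s) (e i) (e j)
  set A := fun r => shapeMatrix g.inner f x e (ξ r) with hA
  have hs : ∀ r i j, A r i j = A r j i := fun r i j =>
    (shapeMatrix_isSymm hf e (hξ.1 r)).apply j i
  have aux : ∀ {a b p q : ℝ}, a = -p → b = -q → a * b = p * q := by
    rintro a b p q rfl rfl
    ring
  have hP : ∀ i j, inducedMetric g.inner f x (τ (e i)) (σ (e j)) = ∑ k, A r i k * A s j k :=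
    fun i j => (inducedMetric_eq_sum he _ _).trans
      (Finset.sum_congr rfl fun k _ => aux (hτ _ _) (hσ _ _))
  refine h.trans ((congrArg₂ (· - ·) (hP j i) (hP i j)).trans ?_)
  simp only [Matrix.sub_apply, Matrix.mul_apply]
  refine congrArg₂ (· - ·) (Finset.sum_congr rfl fun k _ => ?_)
    (Finset.sum_congr rfl fun k _ => ?_)
  · rw [hs r j k, mul_comm]
  · rw [hs s j k]

/-- Twice the sum over all pairs `i < j` is the sum over all `i ≠ j`. -/
lemma two_mul_sum_Ioi {k : ℕ} {F : Fin k → Fin k → ℝ} (hs : ∀ i j, F i j = F j i)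
    (h0 : ∀ i, F i i = 0) : 2 * ∑ i, ∑ j ∈ Finset.Ioi i, F i j = ∑ i, ∑ j, F i j := by
  have h1 : ∀ i, ∑ j ∈ Finset.Ioi i, F i j = ∑ j, if i < j then F i j else 0 := fun i => by
    rw [← Finset.sum_filter]
    congr 1
    ext j
    simp
  have h2 : ∑ i, ∑ j ∈ Finset.Ioi i, F i j = ∑ i, ∑ j, if j < i then F i j else 0 := by
    simp_rw [h1]
    rw [Finset.sum_comm]
    simp_rw [hs]
  rw [two_mul]
  nth_rewrite 1 [h2]
  simp_rw [h1, ← Finset.sum_add_distrib]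
  refine Finset.sum_congr rfl fun i _ => Finset.sum_congr rfl fun j _ => ?_
  rcases lt_trichotomy i j with h | h | h
  · simp [h, h.asymm]
  · subst h; simp [h0]
  · simp [h, h.asymm]

lemma normalizedScalarCurvature_eq (hn : 2 ≤ n)
    (hg : HasConstantSectionalCurvature (d := n + m) g.inner κ)
    (hf : IsSmoothImmersion (n := n) (m := m) f) {x : M}
    (hex : ∃ e : Fin n → TangentSpace (𝓡 n) x, IsTangentFrame g.inner f x e)
    {ξ : Fin m → TangentSpace (𝓡 (n + m)) (f x)} (hξ : IsNormalFrame g.inner f x ξ) :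
    ∃ e : Fin n → TangentSpace (𝓡 n) x, IsTangentFrame g.inner f x e ∧
      ((∀ r, (shapeMatrix g.inner f x e (ξ r)).trace = 0) →
        κ - normalizedScalarCurvature (inducedMetric g.inner f) x =
          normSum (fun r => shapeMatrix g.inner f x e (ξ r)) / (n * (n - 1))) := by
  have hex' : ∃ e : Fin n → TangentSpace (𝓡 n) x,
    IsOrthonormalFrame (inducedMetric g.inner f) x e := hex
  refine ⟨hex'.choose, hex'.choose_spec, fun htr => ?_⟩
  rw [normalizedScalarCurvature, dif_pos hex']
  have he : IsTangentFrame g.inner f x hex'.choose := hex'.choose_spec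
  generalize hex'.choose = e at he htr ⊢
  set A := fun r => shapeMatrix g.inner f x e (ξ r) with hA
  have h1 : ∑ i, ∑ j ∈ Finset.Ioi i, inducedMetric g.inner f x
      (riemannCurvature (inducedMetric g.inner f) x (e i) (e j) (e j)) (e i) =
      ∑ i, ∑ j ∈ Finset.Ioi i, ((if i = j then 0 else κ) +
        ∑ r, (A r i i * A r j j - A r i j ^ 2)) := by
    refine Finset.sum_congr rfl fun i _ => Finset.sum_congr rfl fun j hj => ?_
    have hij : i ≠ j := (Finset.mem_Ioi.1 hj).ne
    rw [if_neg hij]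
    exact gauss_frame hg hf he hξ hij
  have h2 := two_mul_sum_Ioi (F := fun i j => (if i = j then 0 else κ) +
        ∑ r, (A r i i * A r j j - A r i j ^ 2)) ?_ ?_
  · have h3 : ∑ i : Fin n, ∑ j : Fin n, ((if i = j then 0 else κ) +
        ∑ r, (A r i i * A r j j - A r i j ^ 2)) = κ * (n * (n - 1)) - normSum A := by
      simp_rw [Finset.sum_add_distrib]
      have h4 : ∑ i : Fin n, ∑ j : Fin n, (if i = j then 0 else κ) = κ * (n * (n - 1)) := by
        have : ∀ i j : Fin n, (if i = j then 0 else κ) = κ - if i = j then κ else 0 := by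
          intro i j; split_ifs <;> simp
        simp_rw [this, Finset.sum_sub_distrib]
        simp
        ring
      have h5 : ∑ i : Fin n, ∑ j : Fin n, ∑ r, (A r i i * A r j j - A r i j ^ 2) = -normSum A := by
        have h6 : ∀ r, ∑ i, ∑ j, (A r i i * A r j j - A r i j ^ 2) = -frobSq (A r) := by
          intro r
          have ht : ∑ i, A r i i = 0 := htr r
          simp_rw [Finset.sum_sub_distrib, ← Finset.mul_sum, ht]
          simp [frobSq]
        rw [normSum, ← Finset.sum_neg_distrib, ← Finset.sum_congr rfl fun r _ => h6 r]
        rw [Finset.sum_comm]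
        simp_rw [Finset.sum_comm (s := Finset.univ (α := Fin m))]
        rw [Finset.sum_comm]
      rw [h4, h5]
      ring
    rw [h1]
    rw [h3] at h2
    have hn' : (2 : ℝ) ≤ n := by exact_mod_cast hn
    have hpos : (n : ℝ) * (n - 1) ≠ 0 := by
      have : (0 : ℝ) < n - 1 := by linarith
      positivity
    rw [eq_div_iff hpos, sub_mul, div_mul_eq_mul_div, div_mul_cancel₀ _ hpos, h2]
    ring
  · intro i j
    have hs : ∀ r, A r i j = A r j i := fun r =>
      ((shapeMatrix_isSymm hf e (hξ.1 r)).apply i j).symm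
    simp only [hs, eq_comm (a := i)]
    congr 1
    exact Finset.sum_congr rfl fun r _ => by ring
  · intro i
    simp [pow_two]

lemma normalizedNormalScalarCurvature_eq
    (hg : HasConstantSectionalCurvature (d := n + m) g.inner κ)
    (hf : IsSmoothImmersion (n := n) (m := m) f) {x : M}
    (hex : ∃ e : Fin n → TangentSpace (𝓡 n) x, IsTangentFrame g.inner f x e)
    (hex' : ∃ ξ : Fin m → TangentSpace (𝓡 (n + m)) (f x), IsNormalFrame g.inner f x ξ) :
    ∃ (e : Fin n → TangentSpace (𝓡 n) x) (ξ : Fin m → TangentSpace (𝓡 (n + m)) (f x)),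
      IsTangentFrame g.inner f x e ∧ IsNormalFrame g.inner f x ξ ∧
        normalizedNormalScalarCurvature g.inner f x =
          √(commSum (fun r => shapeMatrix g.inner f x e (ξ r))) / (n * (n - 1)) := by
  have h : (∃ e : Fin n → TangentSpace (𝓡 n) x, IsTangentFrame g.inner f x e) ∧
      ∃ ξ : Fin m → TangentSpace (𝓡 (n + m)) (f x), IsNormalFrame g.inner f x ξ := ⟨hex, hex'⟩
  refine ⟨h.1.choose, h.2.choose, h.1.choose_spec, h.2.choose_spec, ?_⟩
  rw [normalizedNormalScalarCurvature, dif_pos h]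
  have he := h.1.choose_spec
  have hξ := h.2.choose_spec
  generalize h.1.choose = e at he ⊢
  generalize h.2.choose = ξ at hξ ⊢
  simp_rw [ricci_frame hg hf he hξ]
  set A := fun r => shapeMatrix g.inner f x e (ξ r) with hA
  change 2 / ((n : ℝ) * (n - 1)) * √(∑ i, ∑ j ∈ Finset.Ioi i, ∑ r, ∑ s ∈ Finset.Ioi r,
    (A s * A r - A r * A s) i j ^ 2) = _
  have hT : ∀ r s i j, (A s * A r - A r * A s) i j = -(A s * A r - A r * A s) j i := by
    intro r s i j
    have hs : ∀ r, (A r)ᵀ = A r := fun r => shapeMatrix_isSymm hf e (hξ.1 r)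
    have h1 : (A s * A r - A r * A s)ᵀ = -(A s * A r - A r * A s) := by
      rw [Matrix.transpose_sub, Matrix.transpose_mul, Matrix.transpose_mul, hs, hs, neg_sub]
    exact congrFun (congrFun h1 j) i
  have h1 : ∀ i j, 2 * ∑ r, ∑ s ∈ Finset.Ioi r, (A s * A r - A r * A s) i j ^ 2 =
      ∑ r, ∑ s, (A s * A r - A r * A s) i j ^ 2 := fun i j =>
    two_mul_sum_Ioi (F := fun r s => (A s * A r - A r * A s) i j ^ 2)
      (fun r s => by simp only [Matrix.sub_apply]; ring) (fun r => by simp)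
  have h2 := two_mul_sum_Ioi (F := fun i j => ∑ r, ∑ s, (A s * A r - A r * A s) i j ^ 2)
    (fun i j => Finset.sum_congr rfl fun r _ => Finset.sum_congr rfl fun s _ => by
      rw [hT r s i j, neg_sq])
    (fun i => Finset.sum_eq_zero fun r _ => Finset.sum_eq_zero fun s _ => by
      have := hT r s i i
      rw [show (A s * A r - A r * A s) i i = 0 by linarith]; simp)
  have h3 : ∑ i, ∑ j, ∑ r, ∑ s, (A s * A r - A r * A s) i j ^ 2 = commSum A := by
    have h4 : ∀ i, ∑ j, ∑ r, ∑ s, (A s * A r - A r * A s) i j ^ 2 =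
        ∑ r, ∑ s, ∑ j, (A s * A r - A r * A s) i j ^ 2 := fun i => by
      rw [Finset.sum_comm]
      exact Finset.sum_congr rfl fun r _ => Finset.sum_comm
    have h5 : ∀ r, ∑ i, ∑ s, ∑ j, (A s * A r - A r * A s) i j ^ 2 =
        ∑ s, frobSq (A s * A r - A r * A s) := fun r => Finset.sum_comm
    exact (Finset.sum_congr rfl fun i _ => h4 i).trans (Finset.sum_comm.trans
      ((Finset.sum_congr rfl fun r _ => h5 r).trans Finset.sum_comm))
  have h6 : commSum A = 2 ^ 2 * ∑ i, ∑ j ∈ Finset.Ioi i, ∑ r, ∑ s ∈ Finset.Ioi r,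
      (A s * A r - A r * A s) i j ^ 2 := by
    rw [← h3, ← h2, pow_two, mul_assoc]
    congr 1
    rw [Finset.mul_sum]
    refine Finset.sum_congr rfl fun i _ => ?_
    rw [Finset.mul_sum]
    exact Finset.sum_congr rfl fun j _ => (h1 i j).symm
  rw [h6, Real.sqrt_mul (by norm_num), Real.sqrt_sq (by norm_num)]
  ring

end Formulas

section ChangeOfFrames

open Matrix

variable {V W : Type*} [NormedAddCommGroup V] [NormedSpace ℝ V]
  [NormedAddCommGroup W] [NormedSpace ℝ W] {n m : ℕ}

lemma exists_orthogonal_of_orthonormal [FiniteDimensional ℝ V] {ι : Type*} [Fintype ι]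
    [DecidableEq ι] {B : V →L[ℝ] V →L[ℝ] ℝ} {e e' : ι → V}
    (he : ∀ i j, B (e i) (e j) = if i = j then 1 else 0)
    (he' : ∀ i j, B (e' i) (e' j) = if i = j then 1 else 0)
    (hc : Fintype.card ι = Module.finrank ℝ V) :
    ∃ R : Matrix ι ι ℝ, Rᵀ * R = 1 ∧ ∀ i, e' i = ∑ k, R k i • e k := by
  refine ⟨Matrix.of fun k i => B (e' i) (e k), ?_, fun i => eq_sum_of_orthonormal he hc (e' i)⟩
  ext i j
  rw [Matrix.one_apply, ← he', apply_eq_sum_of_orthonormal he hc]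
  rfl

lemma orthonormal_sum {ι : Type*} [Fintype ι] [DecidableEq ι] {B : V →L[ℝ] V →L[ℝ] ℝ} {e : ι → V}
    (he : ∀ i j, B (e i) (e j) = if i = j then 1 else 0) {R : Matrix ι ι ℝ} (hR : Rᵀ * R = 1)
    (i j : ι) : B (∑ k, R k i • e k) (∑ k, R k j • e k) = if i = j then 1 else 0 := by
  rw [← Matrix.one_apply, ← hR]
  simp only [Matrix.mul_apply, Matrix.transpose_apply, map_sum, map_smul, _root_.sum_apply,
    _root_.smul_apply, he, smul_eq_mul, mul_ite, mul_one, mul_zero, Finset.sum_ite_eq',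
    Finset.mem_univ, if_true]
  exact Finset.sum_congr rfl fun k _ => mul_comm _ _

lemma bilin_sum_eq_rotFamily (B : W →L[ℝ] W →L[ℝ] ℝ) (H : V →L[ℝ] V →L[ℝ] W) (e : Fin n → V)
    (ξ : Fin m → W) (R : Matrix (Fin n) (Fin n) ℝ) (O : Matrix (Fin m) (Fin m) ℝ) (i j : Fin n)
    (r : Fin m) :
    B (H (∑ k, R k i • e k) (∑ k, R k j • e k)) (∑ s, O s r • ξ s) =
      rotFamily R O (fun s => Matrix.of fun k l => B (H (e k) (e l)) (ξ s)) r i j := by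
  simp only [rotFamily, Matrix.sum_apply, Matrix.smul_apply, Matrix.mul_apply, map_sum, map_smul,
    _root_.sum_apply, _root_.smul_apply, smul_eq_mul, Matrix.transpose_apply, Matrix.of_apply]
  refine Finset.sum_congr rfl fun s _ => ?_
  congr 1
  refine Finset.sum_congr rfl fun l _ => ?_
  rw [Finset.sum_mul, Finset.mul_sum]
  exact Finset.sum_congr rfl fun k _ => by ring

lemma trace_rotFamily_eq_zero {R : Matrix (Fin n) (Fin n) ℝ} (hR : Rᵀ * R = 1)
    (O : Matrix (Fin m) (Fin m) ℝ) {A : Fin m → Matrix (Fin n) (Fin n) ℝ}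
    (hA : ∀ r, (A r).trace = 0) (r : Fin m) : (rotFamily R O A r).trace = 0 := by
  rw [rotFamily, Matrix.trace_sum]
  refine Finset.sum_eq_zero fun s _ => ?_
  rw [Matrix.trace_smul, Matrix.mul_assoc, Matrix.trace_mul_comm, Matrix.mul_assoc,
    mul_eq_one_comm.1 hR, Matrix.mul_one, hA, smul_zero]

end ChangeOfFrames

section ShapeMatrix

open Matrix

variable {n m : ℕ}
  {M : Type*} [TopologicalSpace M] [ChartedSpace (EuclideanSpace ℝ (Fin n)) M]
  {N : Type*} [TopologicalSpace N] [ChartedSpace (EuclideanSpace ℝ (Fin (n + m))) N]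
  [IsManifold (𝓡 (n + m)) ∞ N] {f : M → N} {g : SmoothMetric (n + m) N}

lemma isTangentFrame_sum {x : M} {e : Fin n → EuclideanSpace ℝ (Fin n)}
    (he : IsTangentFrame g.inner f x e) {R : Matrix (Fin n) (Fin n) ℝ} (hR : Rᵀ * R = 1) :
    IsTangentFrame g.inner f x (fun i => (∑ k, R k i • e k : EuclideanSpace ℝ (Fin n))) :=
  orthonormal_sum (V := EuclideanSpace ℝ (Fin n)) (B := inducedMetric g.inner f x) he hR

lemma isNormalFrame_sum {x : M} {ξ : Fin m → EuclideanSpace ℝ (Fin (n + m))}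
    (hξ : IsNormalFrame g.inner f x ξ) {O : Matrix (Fin m) (Fin m) ℝ} (hO : Oᵀ * O = 1) :
    IsNormalFrame g.inner f x
      (fun r => (∑ s, O s r • ξ s : EuclideanSpace ℝ (Fin (n + m)))) := by
  refine ⟨fun r u => ?_, orthonormal_sum (V := EuclideanSpace ℝ (Fin (n + m)))
    (B := g.inner (f x)) hξ.2 hO⟩
  let B : EuclideanSpace ℝ (Fin (n + m)) →L[ℝ] EuclideanSpace ℝ (Fin (n + m)) →L[ℝ] ℝ :=
    g.inner (f x)
  let w : EuclideanSpace ℝ (Fin (n + m)) := mfderiv (𝓡 n) (𝓡 (n + m)) f x u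
  have h : ∀ s, B (ξ s) w = 0 := fun s => hξ.1 s u
  have h2 : B (∑ s, O s r • ξ s) w = 0 := by
    simp [map_sum, _root_.sum_apply, h]
  exact h2

lemma exists_orthogonal_of_normalFrame {x : M} {e : Fin n → TangentSpace (𝓡 n) x}
    (he : IsTangentFrame g.inner f x e) {ξ ξ' : Fin m → EuclideanSpace ℝ (Fin (n + m))}
    (hξ : IsNormalFrame g.inner f x ξ) (hξ' : IsNormalFrame g.inner f x ξ') :
    ∃ O : Matrix (Fin m) (Fin m) ℝ, Oᵀ * O = 1 ∧ ∀ r, ξ' r = ∑ s, O s r • ξ s := by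
  refine ⟨Matrix.of fun s r => g.inner (f x) (ξ' r) (ξ s), ?_,
    fun r => eq_sum_of_normalFrame he hξ (hξ'.1 r)⟩
  ext r s
  rw [Matrix.one_apply]
  exact (inner_eq_sum_of_normal he hξ (hξ'.1 r) (ξ' s)).symm.trans (hξ'.2 r s)

variable [IsManifold (𝓡 n) ∞ M]

lemma shapeMatrix_sum (hf : IsSmoothImmersion (n := n) (m := m) f) {x : M}
    (e : Fin n → EuclideanSpace ℝ (Fin n)) {ξ : Fin m → EuclideanSpace ℝ (Fin (n + m))}
    (hξ : IsNormalFrame g.inner f x ξ) (R : Matrix (Fin n) (Fin n) ℝ)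
    {O : Matrix (Fin m) (Fin m) ℝ} (hO : Oᵀ * O = 1) (r : Fin m) :
    shapeMatrix g.inner f x (fun i => (∑ k, R k i • e k : EuclideanSpace ℝ (Fin n)))
        (∑ s, O s r • ξ s : EuclideanSpace ℝ (Fin (n + m))) =
      rotFamily R O (fun s => shapeMatrix g.inner f x e (ξ s)) r := by
  obtain ⟨H, -, hII⟩ := exists_hessian hf g x
  have h1 : (fun s => shapeMatrix g.inner f x e (ξ s)) =
      fun s => Matrix.of fun k l => g.inner (f x) (H (e k) (e l)) (ξ s) := by
    funext s
    ext k l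
    exact hII _ (hξ.1 s) _ _
  rw [h1]
  ext i j
  exact (hII _ ((isNormalFrame_sum hξ hO).1 r) _ _).trans
    (bilin_sum_eq_rotFamily (V := EuclideanSpace ℝ (Fin n)) (W := EuclideanSpace ℝ (Fin (n + m)))
      (g.inner (f x)) H e ξ R O i j r)

/-- Two shape families in different frames differ by orthogonal matrices. -/
lemma exists_rotFamily_eq (hf : IsSmoothImmersion (n := n) (m := m) f) {x : M}
    {e e' : Fin n → TangentSpace (𝓡 n) x} (he : IsTangentFrame g.inner f x e)
    (he' : IsTangentFrame g.inner f x e') {ξ ξ' : Fin m → TangentSpace (𝓡 (n + m)) (f x)}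
    (hξ : IsNormalFrame g.inner f x ξ) (hξ' : IsNormalFrame g.inner f x ξ') :
    ∃ (R : Matrix (Fin n) (Fin n) ℝ) (O : Matrix (Fin m) (Fin m) ℝ), Rᵀ * R = 1 ∧ Oᵀ * O = 1 ∧
      (fun r => shapeMatrix g.inner f x e' (ξ' r)) =
        rotFamily R O (fun r => shapeMatrix g.inner f x e (ξ r)) := by
  obtain ⟨R, hR, hRe⟩ := exists_orthogonal_of_orthonormal (V := EuclideanSpace ℝ (Fin n))
    (B := inducedMetric g.inner f x) he he' (by simp)
  obtain ⟨O, hO, hOξ⟩ := exists_orthogonal_of_normalFrame he hξ hξ'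
  refine ⟨R, O, hR, hO, funext fun r => ?_⟩
  rw [← shapeMatrix_sum hf e hξ R hO r]
  exact congrArg₂ (shapeMatrix g.inner f x) (funext hRe) (hOξ r)

lemma sqrt_div_le_iff {C S D : ℝ} (hC : 0 ≤ C) (hS : 0 ≤ S) (hD : 0 < D) :
    (√C / D ≤ √2 / 2 * (S / D) ↔ C ≤ S ^ 2 / 2) ∧
      (√C / D = √2 / 2 * (S / D) ↔ C = S ^ 2 / 2) := by
  have h : √2 / 2 * (S / D) = √(S ^ 2 / 2) / D := by
    have h1 : √(S ^ 2 / 2) = √2 / 2 * S := by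
      rw [Real.sqrt_eq_iff_mul_self_eq (by positivity) (by positivity)]
      nlinarith [Real.mul_self_sqrt (show (0 : ℝ) ≤ 2 by norm_num)]
    rw [h1]; ring
  rw [h, div_le_div_iff_of_pos_right hD, Real.sqrt_le_sqrt_iff (by positivity),
    div_left_inj' hD.ne', Real.sqrt_inj hC (by positivity)]
  exact ⟨Iff.rfl, Iff.rfl⟩

end ShapeMatrix

/-- Let `f : M → N` be an immersed austere submanifold of type `Q(p, q)` of a Riemannian manifold
`(N, g)` with constant sectional curvature `κ`.  Then `ρ^⊥ ≤ (√2 / 2) (κ - ρ)` at every point `x`,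
with equality at `x` if and only if in suitable orthonormal bases of the tangent and normal spaces
the second fundamental form is given by `c diag(C₁, 0)`, `c diag(C₂, 0)`, `0`, …, `0`.
A nonzero `c` needs room for the two matrices: `n = p + q ≥ 4` and codimension `m ≥ 2`. -/
theorem mainTheorem4 (p q m : ℕ) (hp : 1 ≤ p) (hq : 1 ≤ q) (κ : ℝ)
    {M : Type*} [TopologicalSpace M] [ChartedSpace (EuclideanSpace ℝ (Fin (p + q))) M]
    [IsManifold (𝓡 (p + q)) ∞ M]
    {N : Type*} [TopologicalSpace N] [ChartedSpace (EuclideanSpace ℝ (Fin (p + q + m))) N]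
    [IsManifold (𝓡 (p + q + m)) ∞ N]
    (g : SmoothMetric (p + q + m) N)
    (hg : HasConstantSectionalCurvature (d := p + q + m) g.inner κ)
    (f : M → N) (hf : IsSmoothImmersion (n := p + q) (m := m) f)
    (hQ : IsAustereOfType g.inner f (austereQ p q)) (x : M) :
    normalizedNormalScalarCurvature g.inner f x ≤
        √2 / 2 * (κ - normalizedScalarCurvature (inducedMetric g.inner f) x) ∧
      (normalizedNormalScalarCurvature g.inner f x =
          √2 / 2 * (κ - normalizedScalarCurvature (inducedMetric g.inner f) x) ↔
        ∃ (c : ℝ) (e : Fin (p + q) → TangentSpace (𝓡 (p + q)) x)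
          (ξ : Fin m → TangentSpace (𝓡 (p + q + m)) (f x)),
          IsTangentFrame g.inner f x e ∧ IsNormalFrame g.inner f x ξ ∧
            (c ≠ 0 → 4 ≤ p + q ∧ 2 ≤ m) ∧
            ∀ r, shapeMatrix g.inner f x e (ξ r) = modelShape (p + q) m c r) := by
  obtain ⟨e₀, he₀, hQ₀⟩ := hQ.2 x
  obtain ⟨e₁, ξ, he₁, hξ, hperp⟩ := normalizedNormalScalarCurvature_eq hg hf ⟨e₀, he₀⟩
    (exists_normalFrame g f x)
  obtain ⟨e₂, he₂, hρ⟩ := normalizedScalarCurvature_eq (by omega) hg hf ⟨e₀, he₀⟩ hξ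
  set B := fun r => shapeMatrix g.inner f x e₀ (ξ r) with hB
  have hBQ : ∀ r, B r ∈ austereQ p q := fun r =>
    hQ₀ (Submodule.subset_span ⟨ξ r, hξ.1 r, rfl⟩)
  obtain ⟨R₁, O₁, hR₁, hO₁, h₁⟩ := exists_rotFamily_eq hf he₀ he₁ hξ hξ
  obtain ⟨R₂, O₂, hR₂, hO₂, h₂⟩ := exists_rotFamily_eq hf he₀ he₂ hξ hξ
  rw [h₁, commSum_rotFamily hR₁ hO₁] at hperp
  have hρ' := hρ fun r => by
    rw [congrFun h₂ r]
    exact trace_rotFamily_eq_zero hR₂ O₂ (fun r => trace_eq_zero_of_mem_austereQ (hBQ r)) r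
  rw [h₂, normSum_rotFamily hR₂ hO₂] at hρ'
  have hn : (2 : ℝ) ≤ (p + q : ℕ) := by exact_mod_cast (by omega : 2 ≤ p + q)
  have hD : (0 : ℝ) < (p + q : ℕ) * ((p + q : ℕ) - 1) := mul_pos (by linarith) (by linarith)
  have hC : 0 ≤ commSum B :=
    Finset.sum_nonneg fun r _ => Finset.sum_nonneg fun s _ => frobSq_nonneg _
  have hS : 0 ≤ normSum B := Finset.sum_nonneg fun r _ => frobSq_nonneg _
  obtain ⟨hle, heq⟩ := sqrt_div_le_iff hC hS hD
  obtain ⟨hle', heq'⟩ := commSum_le (A := B) (a := fun r => upperBlock p q (B r))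
    (fun r s => upperBlock_mul_upperBlock _ _) fun r => eq_upperBlock_add_transpose (hBQ r)
  rw [hperp, hρ', hle, heq]
  refine ⟨hle', fun h => ?_, ?_⟩
  · obtain ⟨c, R, O, hR, hO, hc, hmodel⟩ := heq' h
    exact ⟨c, _, _, isTangentFrame_sum he₀ hR, isNormalFrame_sum hξ hO, hc, fun r =>
      (shapeMatrix_sum hf e₀ hξ R hO r).trans (hmodel r)⟩
  · rintro ⟨c, e, η, he, hη, hc, hmodel⟩
    obtain ⟨R, O, hR, hO, h⟩ := exists_rotFamily_eq hf he₀ he hξ hη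
    rw [← commSum_rotFamily hR hO B, ← normSum_rotFamily hR hO B, ← h, funext hmodel]
    exact commSum_modelShape hc
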